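/- **Problem.** Let $A\in\mathbb R^{n\times d}$, $\bar A\in\mathbb R^{\bar n\times d}$, $b\in\mathbb R^n$, $\bar b\in\mathbb R^{\bar n}$, and consider $$\min_{x\in\mathbb R^d,\,y\in\mathbb R^{\bar n}} F(x,y):=f_0(x)+\bar g(y)\quad\text{s.t. } Ax+b=0,\ y=\bar Ax+\bar b. \tag{SP}$$ Assume: $f_0$ is differentiable and $l_f$-Lipschitz, $\nabla f_0$ is $L_f$-Lipschitz with $L_f>0$; $\bar g:\mathbb R^{\bar n}\to\mathbb R$ is convex and $l_g$-Lipschitz; $\inf F>-\infty$; $A$ has full row rank; $M:=[\bar A;A]\ne0$. Let $(x^{(0)},y^{(0)})$ be feasible, $\Delta_F:=F(x^{(0)},y^{(0)})-\inf F$, $\sigma>0$, $\tau:=2L_f$. Let $\lambda_{\max},\lambda_{\min}$ be the largest and the smallest positive eigenvalue of $MM^\top$, and $\kappa(M):=\sqrt{\lambda_{\max}/\lambda_{\min}}$. A point $(x,y)$ is $\epsilon$-stationary if for some $z_1,z_2$ the numbers $\mathrm{dist}(0,\partial\bar g(y)-z_1)$, $\|\nabla f_0(x)+\bar A^\top z_1+A^\top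 z_2\|$, $\|y-\bar Ax-\bar b\|$, $\|Ax+b\|$ are all at most $\epsilon$. **Method.** Given $x^{(k)}$, write $z=(z_1,z_2)$ and $$\mathcal D_k(z):=\tfrac1{2\tau}\|\bar A^\top z_1+A^\top z_2+\nabla f_0(x^{(k)})-\tau x^{(k)}\|^2+\bar g^\star(z_1)-z_1^\top\bar b-z_2^\top b,$$ $\Omega^{(k+1)}:=\arg\min\mathcal D_k$, $\mathcal D_k^*:=\min\mathcal D_k$. The vector $\nu^{(k)}:=\bar A^\top z_1+A^\top z_2+\nabla f_0(x^{(k)})-\tau x^{(k)}$ is the same for all $z\in\Omega^{(k+1)}$. The inexact proximal gradient method (IPG) computes $z^{(k+1)}$ with $$z_1^{(k+1)}\in\mathrm{dom}\,\bar g^\star,\qquad \mathrm{dist}(z^{(k+1)},\Omega^{(k+1)})\le\delta,\tag{1}$$ and sets $x^{(k+1)}=x^{(k)}-\frac1\tau(\bar A^\top z_1^{(k+1)}+A^\top z_2^{(k+1)}+\nabla f_0(x^{(k)}))$ and $y^{(k+1)}=\mathrm{prox}_{\sigma^{-1}\bar g}(\sigma^{-1}z_1^{(k+1)}+\bar Ax^{(k+1)}+\bar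 b)$. Here $z^{(k+1)}$ is the result of $i_k$ consecutive loops of $j_k$ accelerated proximal gradient (APG) steps on $\mathcal D_k$. The first loop starts at $z^{\rm ini}:=(y^{(0)},Ax^{(0)})$ and each later one at the result of the loop before. A loop started at $z^0$ sets $\hat z^0=z^0$, $\alpha_0=1$ and, for $j=0,\dots,j_k-1$, with $r=\bar A^\top\hat z^j_1+A^\top\hat z^j_2+\nabla f_0(x^{(k)})-\tau x^{(k)}$ and $L=\lambda_{\max}/\tau$, $$z_1^{j+1}=\mathrm{prox}_{L^{-1}\bar g^\star}\big(\hat z_1^j-\tfrac1L(\tfrac1\tau\bar Ar-\bar b)\big),\quad z_2^{j+1}=\hat z_2^j-\tfrac1L(\tfrac1\tau Ar-b),$$ $$\alpha_{j+1}=\tfrac{1+\sqrt{1+4\alpha_j^2}}2,\quad \hat z^{j+1}=z^{j+1}+\tfrac{\alpha_j-1}{\alpha_{j+1}}(z^{j+1}-z^j).$$ **Parameters.** $\delta=\delta_\epsilon$, where $$\delta_\epsilon:=\min\Big\{\tfrac{\epsilon}{B_1\sigma},\ \tfrac{\epsilon}{B_1},\ \tfrac{\epsilon^2}{48L_fB_1(B_2+\sigma\|\bar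 A\|B_4+l_g)},\ \sqrt{\tfrac{\epsilon^2}{48L_fB_1B_3(1+\frac1\tau\sigma\|\bar A\|\|M\|)}}\Big\},$$ $B_1=\frac1\tau\|\bar A\|\|M\|+\sigma^{-1}+\frac1\tau(\|\bar A\|+\|A\|)\|M\|$, $B_2=\|(AA^\top)^{-1}A\|(l_f+\|\bar A\|l_g)$, $B_3=1+\|(AA^\top)^{-1}A\|\|M\|$, $B_4=\frac1\tau(l_f+\|M\|(l_g+B_2))$. In case (a) below put $j_k=\lceil2\sqrt2\,\kappa(M)\rceil$ and $\rho_k=\lambda_{\min}/\tau$. In cases (b) and (c), where $\bar g(y)=\max\{u^\top y:Cu\le c\}$, put $j_k=\lceil2\sqrt{2\lambda_{\max}/(\tau\rho_k)}\rceil$ with $$\rho_k=\begin{cases}[\theta_0^2\tau]^{-1}&\text{if }\bar b=0\text{ and }b=0,\\ \big[\theta^2(\tau+\mathcal D_k(z^{\rm ini})-\mathcal D_k^*+2\|\nu^{(k)}\|^2/\tau)\big]^{-1}&\text{otherwise.}\end{cases}$$ Here $\theta_0=\theta(\bar A,A,C)$ is the Hoffman constant of the systems $\{M^\top z=r,\ Cz_1\le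 e\}$ and $\theta=\theta(\bar A,A,\bar b,b,C)$ that of the systems $\{M^\top z=r,\ -z_1^\top\bar b-z_2^\top b=s,\ Cz_1\le e\}$, i.e. the least constant such that, for all right-hand sides for which the system is solvable, the distance of any $z$ to the solution set is at most the constant times the Euclidean norm of the residual (with positive parts for the inequalities). The number $i_k$ is chosen by one of two rules: either it is the least $i\ge0$ for which the point reached after $i$ loops satisfies (1); or, when $\bar g^\star(y^{(0)})<\infty$, $i_k=\max\{0,\lceil\log_2(2(\mathcal D_k(z^{\rm ini})-\mathcal D_k^*)/(\rho_k\delta^2))\rceil\}$ (with $i_k=0$ if $\mathcal D_k(z^{\rm ini})=\mathcal D_k^*$). **Theorem.** Put $$\Lambda_0:=2+L_f+L_f^{-1}+l_f+l_g+\sigma+\sigma^{-1}+\|M\|+\|(AA^\top)^{-1}A\|+\|x^{(0)}\|+\|y^{(0)}\|+\Delta_F+\Delta_F^{-1}+\big(\bar g^\star(y^{(0)})+\bar g(0)\big),$$ where $\Delta_F^{-1}$ is omitted if $\Delta_F=0$ and the last bracket is omitted if $\bar g^\star(y^{(0)})=\infty$. There are absolute constants $C_0>0$ and $p\in\mathbb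 N$ such that for every such problem the following holds, for each of the two rules for $i_k$. "Finds an $\epsilon$-stationary point with at most $N$ APG steps" means that for some $K\ge0$ the points $z^{(1)},\dots,z^{(K)}$ satisfy (1), $(x^{(K)},y^{(K)})$ is $\epsilon$-stationary, and $\sum_{k<K}i_kj_k\le N$. (Expressions $0\cdot\log 0$ are read as $0$.) (a) If $M=[\bar A;A]$ has full row rank, then for all $0<\epsilon\le(\Lambda_0+\lambda_{\min}^{-1})^{-p}$, IPG finds an $\epsilon$-stationary point of (SP) with at most $$C_0\,\kappa([\bar A;A])\,\log\Big(\frac{\Delta_F}\epsilon\Big)\frac{L_f\Delta_F}{\epsilon^2}\quad\text{APG steps.}$$ (b) If $\bar g(y)=\max\{u^\top y:Cu\le c\}$ and $\bar b=0$, $b=0$, then for all $0<\epsilon\le(\Lambda_0+\theta_0)^{-p}$, IPG finds an $\epsilon$-stationary point of (SP) with at most $$C_0\sqrt{\lambda_{\max}\,\theta(\bar A,A,C)^2}\,\log\Big(\frac{\Delta_F}\epsilon\Big)\frac{L_f\Delta_F}{\epsilon^2}\quad\text{APG steps.}$$ (c) Let $\bar g(y)=\max\{u^\top y:Cu\le c\}$.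 Let $B_5,B_6$ be such that, along the run for $\epsilon$, $\|\nu^{(k)}\|^2\le B_5$ and $\mathcal D_k(z^{\rm ini})-\mathcal D_k^*\le B_6$ for all $k\ge0$. If $0<\epsilon\le(\Lambda_0+\theta+B_5+B_6+B_6^{-1})^{-p}$ ($B_6^{-1}$ omitted if $B_6=0$), then IPG finds an $\epsilon$-stationary point of (SP) with at most $$C_0\max\Big\{1,\sqrt{\lambda_{\max}\,\theta(\bar A,A,\bar b,b,C)^2\,\big(1+B_6/\tau+2B_5/\tau^2\big)}\Big\}\log\Big(\frac{B_6}\epsilon\Big)\frac{L_f\Delta_F}{\epsilon^2}\quad\text{APG steps.}$$ If $\bar g^\star(y^{(0)})<\infty$, then for every $R$ there are such $B_5,B_6$, independent of $\epsilon$, that work for every iterate with $\|x^{(k)}\|\le R$; in particular they exist whenever the sequences $\{x^{(k)}\}$ are bounded uniformly in $\epsilon$. -/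

import Mathlib

open scoped InnerProductSpace

noncomputable section

namespace IPG

/-- `ℝ^n` with the Euclidean norm. -/
abbrev E (n : ℕ) : Type := EuclideanSpace ℝ (Fin n)

/-- The space `ℝ^nbar × ℝ^n` of dual variables `z = (z₁, z₂)`, with the Euclidean norm. -/
abbrev Dual (nbar n : ℕ) : Type := WithLp 2 (E nbar × E n)

/-! ### Convex analysis -/

section Convex

variable {V : Type*} [NormedAddCommGroup V] [InnerProductSpace ℝ V]

/-- The subdifferential `∂h(y)` of a real-valued convex function. -/
def subdiff (h : V → ℝ) (y : V) : Set V :=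
  {ξ | ∀ w, h y + ⟪ξ, w - y⟫_ℝ ≤ h w}

/-- The convex conjugate `h⋆(z) = sup_y (⟨y, z⟩ - h y)`, with values in the extended reals. -/
def conj (h : V → ℝ) (z : V) : EReal :=
  ⨆ y : V, ((⟪y, z⟫_ℝ - h y : ℝ) : EReal)

/-- `prox_{η h}(v)`: a minimizer of `h q + ‖q - v‖² / (2η)` (it is unique when `h` is a proper
lower semicontinuous convex function and `0 < η`). -/
def prox (h : V → EReal) (η : ℝ) (v : V) : V :=
  Classical.epsilon fun p => ∀ q : V,
    h p + ((‖p - v‖ ^ 2 / (2 * η) : ℝ) : EReal) ≤ h q + ((‖q - v‖ ^ 2 / (2 * η) : ℝ) : EReal)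

/-- Largest eigenvalue of an operator (finite dimension). -/
def lamMax (T : V →L[ℝ] V) : ℝ := sSup (spectrum ℝ T)

/-- Smallest positive eigenvalue of an operator (finite dimension). -/
def lamMin (T : V →L[ℝ] V) : ℝ := sInf {t | t ∈ spectrum ℝ T ∧ 0 < t}

/-- Solution set of the linear system `T z = r`, `S z ≤ e` (componentwise). -/
def linSol {W : Type*} [NormedAddCommGroup W] [InnerProductSpace ℝ W] {m : ℕ}
    (T : V →L[ℝ] W) (S : V →L[ℝ] E m) (r : W) (e : E m) : Set V :=
  {z | T z = r ∧ ∀ i, S z i ≤ e i}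

/-- The Hoffman constant of the pair `(T, S)`: the least `θ ≥ 0` such that, for all right-hand
sides `(r, e)` for which the system `T z = r`, `S z ≤ e` is solvable, the distance of every point
`z` to the solution set is at most `θ` times the Euclidean norm of the residual
`(T z - r, (S z - e)₊)`. -/
def hoffman {W : Type*} [NormedAddCommGroup W] [InnerProductSpace ℝ W] {m : ℕ}
    (T : V →L[ℝ] W) (S : V →L[ℝ] E m) : ℝ :=
  sInf {θ : ℝ | 0 ≤ θ ∧ ∀ (r : W) (e : E m), (linSol T S r e).Nonempty → ∀ z : V,
    Metric.infDist z (linSol T S r e) ≤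
      θ * Real.sqrt (‖T z - r‖ ^ 2 + ∑ i, (max (S z i - e i) 0) ^ 2)}

end Convex

/-! ### The problem and its data -/

/-- The data of the splitting problem
`min f₀(x) + ḡ(y)` subject to `A x + b = 0`, `y = Ā x + b̄`, with the Lipschitz constants `Lf` of
`∇f₀`, `lf` of `f₀`, `lg` of `ḡ`, and the input `(x₀, y₀)`, `σ` of the method. -/
structure Data (d n nbar : ℕ) where
  f₀ : E d → ℝ
  gbar : E nbar → ℝ
  A : E d →L[ℝ] E n
  Abar : E d →L[ℝ] E nbar
  b : E n
  bbar : E nbar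
  Lf : ℝ
  lf : ℝ
  lg : ℝ
  σ : ℝ
  x₀ : E d
  y₀ : E nbar

namespace Data

variable {d n nbar : ℕ} (P : Data d n nbar)

/-- The stacked operator `[Ā; A]`. -/
def M : E d →L[ℝ] Dual nbar n :=
  ((WithLp.prodContinuousLinearEquiv 2 ℝ (E nbar) (E n)).symm :
    (E nbar × E n) →L[ℝ] Dual nbar n).comp (P.Abar.prod P.A)

/-- The transpose `[Ā; A]ᵀ`, that is `z ↦ Āᵀ z₁ + Aᵀ z₂`. -/
def Mt : Dual nbar n →L[ℝ] E d := ContinuousLinearMap.adjoint P.M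

/-- `[Ā; A] [Ā; A]ᵀ`. -/
def gram : Dual nbar n →L[ℝ] Dual nbar n := P.M.comp P.Mt

/-- The joint condition number `κ([Ā; A])`. -/
def kappa : ℝ := Real.sqrt (lamMax P.gram / lamMin P.gram)

/-- `(A Aᵀ)⁻¹ A`. -/
def AAtInvA : E d →L[ℝ] E n :=
  (Ring.inverse (P.A.comp (ContinuousLinearMap.adjoint P.A)) : E n →L[ℝ] E n).comp P.A

/-- The objective `F(x, y) = f₀(x) + ḡ(y)`. -/
def F (p : E d × E nbar) : ℝ := P.f₀ p.1 + P.gbar p.2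

/-- `Δ_F = F(x₀, y₀) - inf F`. -/
def DeltaF : ℝ := P.F (P.x₀, P.y₀) - sInf (Set.range P.F)

/-- The standing assumptions. -/
structure Standing : Prop where
  diff : Differentiable ℝ P.f₀
  Lf_pos : 0 < P.Lf
  grad_lip : ∀ x x', ‖gradient P.f₀ x - gradient P.f₀ x'‖ ≤ P.Lf * ‖x - x'‖
  lf_nonneg : 0 ≤ P.lf
  f_lip : ∀ x x', |P.f₀ x - P.f₀ x'| ≤ P.lf * ‖x - x'‖
  g_convex : ConvexOn ℝ Set.univ P.gbar
  lg_nonneg : 0 ≤ P.lg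
  g_lip : ∀ y y', |P.gbar y - P.gbar y'| ≤ P.lg * ‖y - y'‖
  F_bddBelow : BddBelow (Set.range P.F)
  A_fullRowRank : Function.Surjective P.A
  M_ne_zero : P.M ≠ 0
  σ_pos : 0 < P.σ
  feas_x : P.A P.x₀ + P.b = 0
  feas_y : P.y₀ = P.Abar P.x₀ + P.bbar

/-- `ḡ(y) = max {uᵀ y : C u ≤ c}`. -/
def Polyhedral {m : ℕ} (C : E nbar →L[ℝ] E m) (c : E m) : Prop :=
  ∀ y, IsGreatest {t : ℝ | ∃ u : E nbar, (∀ i, C u i ≤ c i) ∧ t = ⟪u, y⟫_ℝ} (P.gbar y)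

/-- `ε`-stationary points of the splitting problem. -/
def Stationary (ε : ℝ) (p : E d × E nbar) : Prop :=
  ∃ (z₁ : E nbar) (z₂ : E n),
    Metric.infEDist 0 ((fun ξ => ξ - z₁) '' subdiff P.gbar p.2) ≤ ENNReal.ofReal ε ∧
    ‖gradient P.f₀ p.1 + ContinuousLinearMap.adjoint P.Abar z₁
      + ContinuousLinearMap.adjoint P.A z₂‖ ≤ ε ∧
    ‖p.2 - P.Abar p.1 - P.bbar‖ ≤ ε ∧
    ‖P.A p.1 + P.b‖ ≤ ε

/-! ### The method -/

/-- The proximal parameter `τ = 2 L_f`. -/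
def τ : ℝ := 2 * P.Lf

/-- `Āᵀ z₁ + Aᵀ z₂ + ∇f₀(x) - τ x`. -/
def resid (x : E d) (z : Dual nbar n) : E d :=
  ContinuousLinearMap.adjoint P.Abar z.fst + ContinuousLinearMap.adjoint P.A z.snd
    + gradient P.f₀ x - P.τ • x

/-- The negative dual function `D_k` of the subproblem at `x = x^(k)`. -/
def dualObj (x : E d) (z : Dual nbar n) : EReal :=
  ((1 / (2 * P.τ) * ‖P.resid x z‖ ^ 2 - ⟪z.fst, P.bbar⟫_ℝ - ⟪z.snd, P.b⟫_ℝ : ℝ) : EReal)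
    + conj P.gbar z.fst

/-- The set `Ω^(k+1)` of minimizers of `D_k`. -/
def Omega (x : E d) : Set (Dual nbar n) :=
  {z | ∀ w, P.dualObj x z ≤ P.dualObj x w}

/-- `D_k^* = min D_k`. -/
def dualOpt (x : E d) : EReal := ⨅ z, P.dualObj x z

/-- The accuracy required of the dual point `z^(k+1)`: `z₁ ∈ dom ḡ⋆` and `dist(z, Ω^(k+1)) ≤ δ`. -/
def Crit (δ : ℝ) (x : E d) (z : Dual nbar n) : Prop :=
  conj P.gbar z.fst ≠ ⊤ ∧ Metric.infEDist z (P.Omega x) ≤ ENNReal.ofReal δ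

/-- `L_D = λ_max([Ā; A] [Ā; A]ᵀ) / τ`. -/
def LD : ℝ := lamMax P.gram / P.τ

/-- The initial dual point `z^ini = (y₀, A x₀)`. -/
def zini : Dual nbar n := WithLp.toLp 2 (P.y₀, P.A P.x₀)

/-- One accelerated proximal gradient step on `D_k`; the state is `(z^(j), ẑ^(j), α_j)`. -/
def apgStep (x : E d) (s : Dual nbar n × Dual nbar n × ℝ) : Dual nbar n × Dual nbar n × ℝ :=
  let z := s.1
  let zh := s.2.1
  let α := s.2.2
  let G₁ : E nbar := (1 / P.τ) • P.Abar (P.resid x zh) - P.bbar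
  let G₂ : E n := (1 / P.τ) • P.A (P.resid x zh) - P.b
  let z' : Dual nbar n := WithLp.toLp 2
    (prox (conj P.gbar) (1 / P.LD) (zh.fst - (1 / P.LD) • G₁), zh.snd - (1 / P.LD) • G₂)
  let α' : ℝ := (1 + Real.sqrt (1 + 4 * α ^ 2)) / 2
  (z', z' + ((α - 1) / α') • (z' - z), α')

/-- One inner loop: `j` steps started from `z` with `ẑ = z` and `α = 1`. -/
def apgEpoch (x : E d) (j : ℕ) (z : Dual nbar n) : Dual nbar n :=
  ((P.apgStep x)^[j] (z, z, 1)).1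

/-- The output of restarted APG with `i` inner loops of `j` steps, started from `z^ini`. -/
def restartedAPG (x : E d) (i j : ℕ) : Dual nbar n :=
  (P.apgEpoch x j)^[i] P.zini

/-- The primal update `x^(k+1)` from `x^(k) = x` and `z^(k+1) = z`. -/
def xUpdate (x : E d) (z : Dual nbar n) : E d :=
  x - (1 / P.τ) • (ContinuousLinearMap.adjoint P.Abar z.fst
    + ContinuousLinearMap.adjoint P.A z.snd + gradient P.f₀ x)

/-- The update `y^(k+1)` from `x^(k+1) = x'` and `z^(k+1) = z`. -/
def yUpdate (x' : E d) (z : Dual nbar n) : E nbar :=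
  prox (fun y => (P.gbar y : EReal)) (1 / P.σ) ((1 / P.σ) • z.fst + P.Abar x' + P.bbar)

/-- The iterates `(x^(k), y^(k))` of the inexact proximal gradient method with restarted APG as
inner solver; `i_k = I x^(k)` is the number of inner loops and `j_k = J x^(k)` their length. -/
def iterate (I J : E d → ℕ) : ℕ → E d × E nbar
  | 0 => (P.x₀, P.y₀)
  | k + 1 =>
    let x := (iterate I J k).1
    let z := P.restartedAPG x (I x) (J x)
    (P.xUpdate x z, P.yUpdate (P.xUpdate x z) z)

/-- The method, run with required dual accuracy `δ`, finds an `ε`-stationary point after at most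
`N` inner iterations: for some `K`, the first `K` dual points satisfy the accuracy criterion,
`(x^(K), y^(K))` is `ε`-stationary, and `∑_{k<K} i_k j_k ≤ N`. -/
def Finds (I J : E d → ℕ) (δ ε N : ℝ) : Prop :=
  ∃ K : ℕ,
    (∀ k < K, P.Crit δ (P.iterate I J k).1
      (P.restartedAPG (P.iterate I J k).1 (I (P.iterate I J k).1) (J (P.iterate I J k).1))) ∧
    P.Stationary ε (P.iterate I J K) ∧
    ((∑ k ∈ Finset.range K, I (P.iterate I J k).1 * J (P.iterate I J k).1 : ℕ) : ℝ) ≤ N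

/-! ### Constants and parameter choices -/

def B₁ : ℝ := 1 / P.τ * ‖P.Abar‖ * ‖P.M‖ + 1 / P.σ + 1 / P.τ * (‖P.Abar‖ + ‖P.A‖) * ‖P.M‖

def B₂ : ℝ := ‖P.AAtInvA‖ * (P.lf + ‖P.Abar‖ * P.lg)

def B₃ : ℝ := 1 + ‖P.AAtInvA‖ * ‖P.M‖

def B₄ : ℝ := 1 / P.τ * (P.lf + ‖P.M‖ * (P.lg + P.B₂))

/-- The accuracy `δ_ε`. -/
def deltaEps (ε : ℝ) : ℝ :=
  min (min (ε / (P.B₁ * P.σ)) (ε / P.B₁))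
    (min (ε ^ 2 / (48 * P.Lf * P.B₁ * (P.B₂ + P.σ * ‖P.Abar‖ * P.B₄ + P.lg)))
      (Real.sqrt (ε ^ 2 /
        (48 * P.Lf * P.B₁ * P.B₃ * (1 + 1 / P.τ * P.σ * ‖P.Abar‖ * ‖P.M‖)))))

/-- `D_k(z^ini) - D_k^*`. -/
def gap (x : E d) : ℝ := (P.dualObj x P.zini - P.dualOpt x).toReal

/-- The common value `ν^(k)` of `Āᵀ z₁ + Aᵀ z₂ + ∇f₀(x) - τ x` over all `z ∈ Ω^(k+1)`. -/
def nu (x : E d) : E d := P.resid x (Classical.epsilon fun z => z ∈ P.Omega x)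

/-- `z ↦ C z₁`. -/
def ineqOp {m : ℕ} (C : E nbar →L[ℝ] E m) : Dual nbar n →L[ℝ] E m :=
  C.comp ((ContinuousLinearMap.fst ℝ (E nbar) (E n)).comp
    (WithLp.prodContinuousLinearEquiv 2 ℝ (E nbar) (E n) : Dual nbar n →L[ℝ] (E nbar × E n)))

/-- `z ↦ ([Ā; A]ᵀ z, - z₁ᵀ b̄ - z₂ᵀ b)`. -/
def eqOp : Dual nbar n →L[ℝ] WithLp 2 (E d × ℝ) :=
  ((WithLp.prodContinuousLinearEquiv 2 ℝ (E d) ℝ).symm :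
    (E d × ℝ) →L[ℝ] WithLp 2 (E d × ℝ)).comp
      (P.Mt.prod (-(innerSL ℝ (WithLp.toLp 2 (P.bbar, P.b) : Dual nbar n))))

/-- The Hoffman constant `θ(Ā, A, C)`. -/
def thetaHom {m : ℕ} (C : E nbar →L[ℝ] E m) : ℝ := hoffman P.Mt (ineqOp (n := n) C)

/-- The Hoffman constant `θ(Ā, A, b̄, b, C)`. -/
def thetaFull {m : ℕ} (C : E nbar →L[ℝ] E m) : ℝ := hoffman P.eqOp (ineqOp (n := n) C)

/-- The strong convexity modulus `μ_D = λ_min([Ā; A] [Ā; A]ᵀ) / τ`. -/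
def muD : ℝ := lamMin P.gram / P.τ

open Classical in
/-- The quadratic growth modulus `ρ_k` in the polyhedral case. -/
def rho {m : ℕ} (C : E nbar →L[ℝ] E m) (x : E d) : ℝ :=
  if P.bbar = 0 ∧ P.b = 0 then 1 / (P.thetaHom C ^ 2 * P.τ)
  else 1 / (P.thetaFull C ^ 2 * (P.τ + P.gap x + 2 * ‖P.nu x‖ ^ 2 / P.τ))

/-- Length of the inner loops under full row rank. -/
def lenStrong (_x : E d) : ℕ := ⌈2 * Real.sqrt 2 * P.kappa⌉₊

/-- Length of the inner loops in the polyhedral case. -/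
def lenPoly {m : ℕ} (C : E nbar →L[ℝ] E m) (x : E d) : ℕ :=
  ⌈2 * Real.sqrt (2 * P.LD / P.rho C x)⌉₊

/-- A priori number of inner loops, for the growth modulus `μ` of the dual objective. -/
def loopsPrior (μ : E d → ℝ) (δ : ℝ) (x : E d) : ℕ :=
  ⌈Real.logb 2 (2 * P.gap x / (μ x * δ ^ 2))⌉₊

/-- Number of inner loops when restarting stops as soon as the accuracy criterion holds. -/
def loopsFirst (J : E d → ℕ) (δ : ℝ) (x : E d) : ℕ :=
  sInf {i : ℕ | P.Crit δ x (P.restartedAPG x i (J x))}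

/-- The two rules for the number of inner loops: stop at the first restart at which the accuracy
criterion holds, or, when `ḡ⋆(y₀)` and hence `D_k(z^ini)` is finite, use the a priori number. -/
def LoopRule (μ : E d → ℝ) (J : E d → ℕ) (δ : ℝ) (I : E d → ℕ) : Prop :=
  I = P.loopsFirst J δ ∨ (conj P.gbar P.y₀ ≠ ⊤ ∧ I = P.loopsPrior μ δ)

/-- `‖ν^(k)‖² ≤ B₅` and `D_k(z^ini) - D_k^* ≤ B₆`. -/
def DualBounds (B₅ B₆ : ℝ) (x : E d) : Prop :=
  ‖P.nu x‖ ^ 2 ≤ B₅ ∧ P.dualObj x P.zini ≤ P.dualOpt x + (B₆ : EReal)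

/-- The size of the data: a sum of the parameters on which the complexity bounds depend only
logarithmically. The last term is `0` when `ḡ⋆(y₀) = ∞`. -/
def size : ℝ :=
  2 + P.Lf + P.Lf⁻¹ + P.lf + P.lg + P.σ + P.σ⁻¹ + ‖P.M‖ + ‖P.AAtInvA‖ + ‖P.x₀‖ + ‖P.y₀‖
    + P.DeltaF + P.DeltaF⁻¹ + (conj P.gbar P.y₀ + (P.gbar 0 : EReal)).toReal

end Data

end IPG

end

/-! Eliminating y leaves φ(x) = f₀(x) + ḡ(Āx + b̄) on the affine set Ax + b = 0, and the method is
proximal gradient descent on φ whose subproblem is solved through its dual D_k. An exact dual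
minimizer z gives a feasible point x⁺ with z₁ ∈ ∂ḡ(Āx⁺ + b̄) and ∇f₀(x) + Āᵀz₁ + Aᵀz₂ = -τ(x⁺ - x).
So the step length measures stationarity, and from a feasible x the value of φ drops by at least 3/2
· L_f times its square.

A dual point within δ of Ω moves x⁺ by at most ‖M‖δ/τ. The infeasibility of x then enters the
descent estimate through ⟨z₂, Ax + b⟩. The multipliers z₂ obey a bound that does not involve ‖x‖,
because A has full row rank and x stays near the feasible set (`norm_snd_le_of_near`). The accuracy
δ_ε keeps the total error below ε²/(16 L_f) (`error_le`). A step that does not end at an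
ε-stationary point is longer than ε/(3 L_f) (`stationary_of_short`), hence lowers φ by ε²/(64 L_f)
(`decrease`), and at most 64 L_f Δ_F/ε² + 1 outer steps occur (`exists_stationary`).

For the inner solver, APG has the rate 2L‖z⁰ - z*‖²/(j + 1)² (`accel_rate`). If D_k - D_k^* ≥ ρ/2 ·
dist(·, Ω)², a loop of length about √(L/ρ) halves the gap, so logarithmically many loops suffice
(`restart_gap`). If ḡ⋆(y₀) = ∞ the initial gap is infinite; the squared distance to Ω is then halved
instead (`crit_of_infDist_zini`). The growth has one source: D_k is a convex function plus a
quadratic in Mᵀz, so the gap controls ‖Mᵀ(z - z*)‖² (`growth_Mt`). Under full row rank this is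
already the distance. For polyhedral ḡ, the conjugate is the indicator of {Cu ≤ c}, and Ω contains
the solution set of a linear system through any of its points, so Hoffman's bound gives the
distance. With b̄, b present the residual also contains the change of the linear term, which is
controlled only on a sublevel set; this is where the gap and ν^(k) enter ρ_k (`growth_full`).

For the logarithm, put T = 1/ε. The smallness of ε puts every parameter below T, so 1/δ_ε, the
initial gap or distance, and 1/ρ are bounded by fixed powers of T, and the number of loops is
O(log(1/ε)). The iterates are bounded by a power of T too, being reached by polynomially many steps
of polynomial length; hence (a) and (b) need no boundedness assumption. Finally log(1/ε) is at most
twice log(Δ_F/ε), respectively log(B₆/ε) (`log_le_two_mul_log`). -/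

open scoped InnerProductSpace

noncomputable section

namespace IPG

/-! ### Minimizers of a convex function plus a quadratic. -/

section Convex

variable {V : Type*} [NormedAddCommGroup V] [InnerProductSpace ℝ V]
  {W : Type*} [NormedAddCommGroup W] [InnerProductSpace ℝ W]

/-- First-order optimality for a convex function plus a quadratic. -/
lemma firstOrder_of_isMin {K : Set V} {φ : V → ℝ} (hφ : ConvexOn ℝ K φ) (T : V →L[ℝ] W) (a : W)
    {c : ℝ} {p : V} (hp : p ∈ K)
    (hmin : ∀ w ∈ K, φ p + c * ‖T p - a‖ ^ 2 ≤ φ w + c * ‖T w - a‖ ^ 2) :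
    ∀ w ∈ K, 0 ≤ φ w - φ p + 2 * c * ⟪T p - a, T (w - p)⟫_ℝ := by
  intro w hw
  -- Minimality is tested at (1 - t)p + tw; after division by t the remaining error is of order t
  -- and disappears in the limit.
  have key : ∀ t : ℝ, 0 < t → t ≤ 1 →
      0 ≤ φ w - φ p + 2 * c * ⟪T p - a, T (w - p)⟫_ℝ + c * t * ‖T (w - p)‖ ^ 2 := by
    intro t ht ht1
    have hK : (1 - t) • p + t • w ∈ K := hφ.1 hp hw (by linarith) ht.le (by ring)
    have h1 := hφ.2 hp hw (by linarith : 0 ≤ 1 - t) ht.le (by ring)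
    have h2 := hmin _ hK
    have h3 : T ((1 - t) • p + t • w) - a = (T p - a) + t • T (w - p) := by
      simp only [map_add, map_smul, map_sub]
      module
    rw [h3, norm_add_sq_real, inner_smul_right, norm_smul, Real.norm_eq_abs, mul_pow, sq_abs]
      at h2
    simp only [smul_eq_mul] at h1
    have h4 : 0 ≤ t * (φ w - φ p + 2 * c * ⟪T p - a, T (w - p)⟫_ℝ
        + c * t * ‖T (w - p)‖ ^ 2) := by nlinarith
    exact nonneg_of_mul_nonneg_right h4 ht
  have hlim : Filter.Tendsto (fun t : ℝ => φ w - φ p + 2 * c * ⟪T p - a, T (w - p)⟫_ℝ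
      + c * t * ‖T (w - p)‖ ^ 2) (nhdsWithin 0 (Set.Ioi 0))
      (nhds (φ w - φ p + 2 * c * ⟪T p - a, T (w - p)⟫_ℝ + c * 0 * ‖T (w - p)‖ ^ 2)) := by
    apply Filter.Tendsto.mono_left _ nhdsWithin_le_nhds
    apply Continuous.tendsto
    fun_prop
  have := ge_of_tendsto hlim (by
    filter_upwards [Ioo_mem_nhdsGT (zero_lt_one' ℝ)] with t ht
    exact key t ht.1 ht.2.le)
  simpa using this

/-- Quadratic growth at a minimizer of a convex function plus a quadratic. -/
lemma quadGrowth_of_isMin {K : Set V} {φ : V → ℝ} (hφ : ConvexOn ℝ K φ) (T : V →L[ℝ] W) (a : W)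
    {c : ℝ} {p : V} (hp : p ∈ K)
    (hmin : ∀ w ∈ K, φ p + c * ‖T p - a‖ ^ 2 ≤ φ w + c * ‖T w - a‖ ^ 2) :
    ∀ w ∈ K, φ p + c * ‖T p - a‖ ^ 2 + c * ‖T (w - p)‖ ^ 2 ≤ φ w + c * ‖T w - a‖ ^ 2 := by
  intro w hw
  have h := firstOrder_of_isMin hφ T a hp hmin w hw
  have h3 : T w - a = (T p - a) + T (w - p) := by
    simp only [map_sub]
    abel
  rw [h3, norm_add_sq_real]
  linarith

/-! ### The Hoffman bound -/

lemma convex_linSol {m : ℕ} (T : V →L[ℝ] W) (S : V →L[ℝ] E m) (r : W) (e : E m) :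
    Convex ℝ (linSol T S r e) := by
  intro x hx y hy a b ha hb hab
  refine ⟨?_, fun i => ?_⟩
  · rw [map_add, map_smul, map_smul, hx.1, hy.1, ← add_smul, hab, one_smul]
  · have h1 := hx.2 i
    have h2 := hy.2 i
    simp only [map_add, map_smul, PiLp.add_apply, PiLp.smul_apply, smul_eq_mul]
    calc a * S x i + b * S y i ≤ a * e i + b * e i := by gcongr
      _ = e i := by rw [← add_mul, hab, one_mul]

lemma isClosed_linSol {m : ℕ} (T : V →L[ℝ] W) (S : V →L[ℝ] E m) (r : W) (e : E m) :
    IsClosed (linSol T S r e) := by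
  have : linSol T S r e = {z | T z = r} ∩ ⋂ i, {z | S z i ≤ e i} := by
    ext z; simp [linSol]
  rw [this]
  refine (isClosed_eq T.continuous continuous_const).inter (isClosed_iInter fun i => ?_)
  exact isClosed_le (by fun_prop) continuous_const

/-- The residual bound for a homogeneous system on the polar of its solution cone. -/
lemma exists_polar_bound [FiniteDimensional ℝ V] {m : ℕ} (T : V →L[ℝ] W) (S : V →L[ℝ] E m)
    (I : Finset (Fin m)) :
    ∃ θ : ℝ, 0 ≤ θ ∧ ∀ y : V, (∀ u : V, T u = 0 → (∀ i ∈ I, S u i ≤ 0) → ⟪y, u⟫_ℝ ≤ 0) →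
      ‖y‖ ≤ θ * Real.sqrt (‖T y‖ ^ 2 + ∑ i ∈ I, (max (S y i) 0) ^ 2) := by
  set R : V → ℝ := fun y => Real.sqrt (‖T y‖ ^ 2 + ∑ i ∈ I, (max (S y i) 0) ^ 2) with hR
  set Q : Set V := {y | ∀ u : V, T u = 0 → (∀ i ∈ I, S u i ≤ 0) → ⟪y, u⟫_ℝ ≤ 0} with hQ
  have hRc : Continuous R := by
    simp only [hR]
    fun_prop
  have hQc : IsClosed Q := by
    have : Q = ⋂ (u : V) (_ : T u = 0) (_ : ∀ i ∈ I, S u i ≤ 0), {y | ⟪y, u⟫_ℝ ≤ 0} := by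
      ext y; simp [hQ]
    rw [this]
    refine isClosed_iInter fun u => isClosed_iInter fun _ => isClosed_iInter fun _ => ?_
    exact isClosed_le (by fun_prop) continuous_const
  have hRs : ∀ (t : ℝ) (y : V), 0 ≤ t → R (t • y) = t * R y := by
    intro t y ht
    simp only [hR, map_smul, norm_smul, PiLp.smul_apply, smul_eq_mul]
    have : ∀ i, (max (t * S y i) 0) ^ 2 = t ^ 2 * (max (S y i) 0) ^ 2 := by
      intro i
      rw [← mul_pow, mul_max_of_nonneg _ _ ht, mul_zero]
    simp only [this]
    rw [← Finset.mul_sum, mul_pow, Real.norm_eq_abs, sq_abs, ← mul_add, Real.sqrt_mul (sq_nonneg t),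
      Real.sqrt_sq ht]
  rcases (Metric.sphere (0 : V) 1 ∩ Q).eq_empty_or_nonempty with hne | hne
  · refine ⟨0, le_rfl, fun y hy => ?_⟩
    by_cases hy0 : y = 0
    · simp [hy0]
    exfalso
    have : ‖y‖⁻¹ • y ∈ Metric.sphere (0 : V) 1 ∩ Q := by
      refine ⟨by simp [norm_smul, hy0], fun u h1 h2 => ?_⟩
      rw [real_inner_smul_left]
      exact mul_nonpos_of_nonneg_of_nonpos (by positivity) (hy u h1 h2)
    rw [hne] at this
    exact this
  · have hc : IsCompact (Metric.sphere (0 : V) 1 ∩ Q) := (isCompact_sphere _ _).inter_right hQc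
    obtain ⟨y₀, hy₀, hmin⟩ := hc.exists_isMinOn hne hRc.continuousOn
    -- If R y₀ = 0, then y₀ lies in the cone whose polar is Q, so ⟪y₀, y₀⟫ ≤ 0, against ‖y₀‖ = 1.
    -- Homogeneity carries the positive minimum of R on the sphere to all of Q.
    have hpos : 0 < R y₀ := by
      rcases (Real.sqrt_nonneg _ : 0 ≤ R y₀).lt_or_eq with h | h
      · exact h
      exfalso
      have hsum : ‖T y₀‖ ^ 2 + ∑ i ∈ I, (max (S y₀ i) 0) ^ 2 = 0 := by
        refine (Real.sqrt_eq_zero ?_).1 h.symm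
        positivity
      have h0 : 0 ≤ ∑ i ∈ I, (max (S y₀ i) 0) ^ 2 := Finset.sum_nonneg fun i _ => sq_nonneg _
      have hT : T y₀ = 0 := by
        have : ‖T y₀‖ ^ 2 = 0 := by nlinarith [sq_nonneg ‖T y₀‖]
        simpa using this
      have hS : ∑ i ∈ I, (max (S y₀ i) 0) ^ 2 = 0 := by
        simpa [hT] using hsum
      rw [Finset.sum_eq_zero_iff_of_nonneg fun i _ => sq_nonneg _] at hS
      have h2 := hy₀.2 y₀ hT fun i hi => by
        have := hS i hi
        simpa using this
      have h3 : ‖y₀‖ = 1 := by simpa using hy₀.1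
      rw [real_inner_self_eq_norm_sq, h3] at h2
      norm_num at h2
    refine ⟨(R y₀)⁻¹, by positivity, fun y hy => ?_⟩
    by_cases hy0 : y = 0
    · simp [hy0]
    have hyn : 0 < ‖y‖ := norm_pos_iff.2 hy0
    have : ‖y‖⁻¹ • y ∈ Metric.sphere (0 : V) 1 ∩ Q := by
      refine ⟨by simp [norm_smul, hy0], fun u h1 h2 => ?_⟩
      rw [real_inner_smul_left]
      exact mul_nonpos_of_nonneg_of_nonpos (by positivity) (hy u h1 h2)
    have h4 : R y₀ ≤ R (‖y‖⁻¹ • y) := hmin this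
    rw [hRs _ _ (by positivity)] at h4
    have h5 : ‖y‖ * R y₀ ≤ R y := by
      calc ‖y‖ * R y₀ ≤ ‖y‖ * (‖y‖⁻¹ * R y) := by gcongr
        _ = R y := by field_simp
    change ‖y‖ ≤ (R y₀)⁻¹ * R y
    rw [inv_mul_eq_div, le_div_iff₀ hpos]
    exact h5

/-- **Hoffman's theorem**: a finite Hoffman constant exists. -/
lemma exists_hoffman [FiniteDimensional ℝ V] {m : ℕ} (T : V →L[ℝ] W) (S : V →L[ℝ] E m) :
    ∃ θ : ℝ, 0 ≤ θ ∧ ∀ (r : W) (e : E m), (linSol T S r e).Nonempty → ∀ z : V,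
      Metric.infDist z (linSol T S r e) ≤
        θ * Real.sqrt (‖T z - r‖ ^ 2 + ∑ i, (max (S z i - e i) 0) ^ 2) := by
  classical
  choose θ hθ0 hθ using exists_polar_bound T S
  -- Only finitely many active sets exist, whatever the right-hand side; the sum of their constants
  -- dominates each one.
  refine ⟨∑ I, θ I, Finset.sum_nonneg fun I _ => hθ0 I, fun r e hne z => ?_⟩
  obtain ⟨p, hp, hpz⟩ := exists_norm_eq_iInf_of_complete_convex hne
    (isClosed_linSol T S r e).isComplete (convex_linSol T S r e) z
  rw [norm_eq_iInf_iff_real_inner_le_zero (convex_linSol T S r e) hp] at hpz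
  set I : Finset (Fin m) := Finset.univ.filter fun i => S p i = e i with hI
  -- A direction admissible for the rows active at the projection p stays feasible for small t > 0,
  -- the other rows having slack. The variational inequality of the projection then puts z - p in
  -- the polar cone.
  have hpol : ∀ u : V, T u = 0 → (∀ i ∈ I, S u i ≤ 0) → ⟪z - p, u⟫_ℝ ≤ 0 := by
    intro u hu1 hu2
    have hev : ∀ᶠ t : ℝ in nhdsWithin 0 (Set.Ioi 0), ∀ i, S (p + t • u) i ≤ e i := by
      rw [Filter.eventually_all]
      intro i
      by_cases hi : i ∈ I
      · filter_upwards [self_mem_nhdsWithin] with t ht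
        have h1 : S p i = e i := (Finset.mem_filter.1 hi).2
        have h2 := hu2 i hi
        have h3 : (0 : ℝ) < t := ht
        simp only [map_add, map_smul, PiLp.add_apply, PiLp.smul_apply, smul_eq_mul]
        nlinarith
      · have h1 : S p i < e i := lt_of_le_of_ne (hp.2 i) fun h => hi (by simp [hI, h])
        have h2 : Filter.Tendsto (fun t : ℝ => S (p + t • u) i) (nhdsWithin 0 (Set.Ioi 0))
            (nhds (S (p + (0 : ℝ) • u) i)) := by
          apply Filter.Tendsto.mono_left _ nhdsWithin_le_nhds
          apply Continuous.tendsto (f := fun t : ℝ => S (p + t • u) i)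
          fun_prop
        rw [zero_smul, add_zero] at h2
        exact (h2.eventually_lt_const h1).mono fun t => le_of_lt
    obtain ⟨t, ht, ht0⟩ := (hev.and self_mem_nhdsWithin).exists
    have h0 : (0 : ℝ) < t := ht0
    have h1 := hpz (p + t • u) ⟨by rw [map_add, map_smul, hu1, smul_zero, add_zero, hp.1], ht⟩
    rw [add_sub_cancel_left, inner_smul_right] at h1
    by_contra hcon
    push Not at hcon
    nlinarith
  have h1 := hθ I (z - p) hpol
  calc Metric.infDist z (linSol T S r e) ≤ dist z p := Metric.infDist_le_dist_of_mem hp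
    _ = ‖z - p‖ := dist_eq_norm _ _
    _ ≤ θ I * Real.sqrt (‖T (z - p)‖ ^ 2 + ∑ i ∈ I, (max (S (z - p) i) 0) ^ 2) := h1
    _ ≤ (∑ I, θ I) * Real.sqrt (‖T z - r‖ ^ 2 + ∑ i, (max (S z i - e i) 0) ^ 2) := by
      refine mul_le_mul (Finset.single_le_sum (fun J _ => hθ0 J) (Finset.mem_univ I))
        (Real.sqrt_le_sqrt ?_) (Real.sqrt_nonneg _) (Finset.sum_nonneg fun I _ => hθ0 I)
      rw [map_sub, hp.1]
      gcongr
      calc ∑ i ∈ I, (max (S (z - p) i) 0) ^ 2 = ∑ i ∈ I, (max (S z i - e i) 0) ^ 2 := by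
            refine Finset.sum_congr rfl fun i hi => ?_
            rw [map_sub, PiLp.sub_apply, (Finset.mem_filter.1 hi).2]
        _ ≤ _ := Finset.sum_le_sum_of_subset_of_nonneg (Finset.subset_univ _)
            fun i _ _ => sq_nonneg _

lemma hoffman_nonneg {m : ℕ} (T : V →L[ℝ] W) (S : V →L[ℝ] E m) : 0 ≤ hoffman T S :=
  Real.sInf_nonneg fun _ h => h.1

/-- The Hoffman constant is attained. -/
lemma infDist_le_hoffman [FiniteDimensional ℝ V] {m : ℕ} (T : V →L[ℝ] W) (S : V →L[ℝ] E m)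
    (r : W) (e : E m) (hne : (linSol T S r e).Nonempty) (z : V) :
    Metric.infDist z (linSol T S r e) ≤
      hoffman T S * Real.sqrt (‖T z - r‖ ^ 2 + ∑ i, (max (S z i - e i) 0) ^ 2) := by
  set s := Real.sqrt (‖T z - r‖ ^ 2 + ∑ i, (max (S z i - e i) 0) ^ 2) with hs
  have hs0 : 0 ≤ s := Real.sqrt_nonneg _
  obtain ⟨θ₀, hθ₀⟩ := exists_hoffman T S
  rcases hs0.eq_or_lt with h | h
  · have := hθ₀.2 r e hne z
    rw [← hs, ← h, mul_zero] at this
    rw [← h, mul_zero]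
    exact this
  · rw [← div_le_iff₀ h]
    refine le_csInf ⟨θ₀, hθ₀⟩ fun θ hθ => ?_
    rw [div_le_iff₀ h]
    exact hθ.2 r e hne z

lemma infDist_le_hoffman_of_feasible [FiniteDimensional ℝ V] {m : ℕ} (T : V →L[ℝ] W)
    (S : V →L[ℝ] E m) (r : W) (e : E m) (hne : (linSol T S r e).Nonempty) (z : V)
    (hz : ∀ i, S z i ≤ e i) :
    Metric.infDist z (linSol T S r e) ≤ hoffman T S * ‖T z - r‖ := by
  have h := infDist_le_hoffman T S r e hne z
  have h0 : ∑ i, (max (S z i - e i) 0) ^ 2 = 0 :=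
    Finset.sum_eq_zero fun i _ => by simp [hz i]
  rwa [h0, add_zero, Real.sqrt_sq (norm_nonneg _)] at h

/-! ### Extreme eigenvalues of `T T*` -/

lemma mem_spectrum_iff_exists [FiniteDimensional ℝ V] (T : V →L[ℝ] V) (t : ℝ) :
    t ∈ spectrum ℝ T ↔ ∃ u : V, u ≠ 0 ∧ T u = t • u := by
  have : CompleteSpace V := FiniteDimensional.complete ℝ V
  rw [ContinuousLinearMap.spectrum_eq, ← Module.End.hasEigenvalue_iff_mem_spectrum]
  constructor
  · intro h
    obtain ⟨u, hu⟩ := h.exists_hasEigenvector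
    exact ⟨u, hu.2, hu.apply_eq_smul⟩
  · rintro ⟨u, hu, h⟩
    exact Module.End.hasEigenvalue_of_hasEigenvector
      ⟨Module.End.mem_eigenspace_iff.2 h, hu⟩

lemma eigen_gram [FiniteDimensional ℝ V] {Tt : V →L[ℝ] W} {G : V →L[ℝ] V} (hG : ∀ u w, ⟪G u, w⟫_ℝ = ⟪Tt u, Tt w⟫_ℝ)
    {t : ℝ} (ht : t ∈ spectrum ℝ G) : ∃ u : V, u ≠ 0 ∧ ‖Tt u‖ ^ 2 = t * ‖u‖ ^ 2 := by
  obtain ⟨u, hu, h⟩ := (mem_spectrum_iff_exists G t).1 ht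
  refine ⟨u, hu, ?_⟩
  have := hG u u
  rwa [h, real_inner_smul_left, real_inner_self_eq_norm_sq, real_inner_self_eq_norm_sq, eq_comm]
    at this

lemma gram_symm {Tt : V →L[ℝ] W} {G : V →L[ℝ] V} (hG : ∀ u w, ⟪G u, w⟫_ℝ = ⟪Tt u, Tt w⟫_ℝ) :
    (G : V →ₗ[ℝ] V).IsSymmetric := by
  intro u w
  have h1 := hG u w
  have h2 := hG w u
  simp only [ContinuousLinearMap.coe_coe]
  rw [h1, real_inner_comm, ← h2, real_inner_comm]

lemma spectrum_gram_le [FiniteDimensional ℝ V] {Tt : V →L[ℝ] W} {G : V →L[ℝ] V}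
    (hG : ∀ u w, ⟪G u, w⟫_ℝ = ⟪Tt u, Tt w⟫_ℝ) {t : ℝ} (ht : t ∈ spectrum ℝ G) :
    t ≤ ‖Tt‖ ^ 2 := by
  obtain ⟨u, hu, h⟩ := eigen_gram hG ht
  have h1 : ‖Tt u‖ ^ 2 ≤ (‖Tt‖ * ‖u‖) ^ 2 := by
    gcongr
    exact Tt.le_opNorm u
  have h2 : 0 < ‖u‖ ^ 2 := by positivity
  rw [h, mul_pow] at h1
  exact le_of_mul_le_mul_right h1 h2

lemma lamMax_le [FiniteDimensional ℝ V] {Tt : V →L[ℝ] W} {G : V →L[ℝ] V} (hG : ∀ u w, ⟪G u, w⟫_ℝ = ⟪Tt u, Tt w⟫_ℝ) :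
    lamMax G ≤ ‖Tt‖ ^ 2 :=
  Real.sSup_le (fun _ ht => spectrum_gram_le hG ht) (sq_nonneg _)

/-- The supremum and infimum of the Rayleigh quotient ‖Tt u‖²/‖u‖² of the symmetric operator G are
eigenvalues. This connects the spectral definitions of `lamMax` and `lamMin` with norm inequalities.
-/
lemma exists_spectrum_rayleigh [FiniteDimensional ℝ V] [Nontrivial V] {Tt : V →L[ℝ] W} {G : V →L[ℝ] V}
    (hG : ∀ u w, ⟪G u, w⟫_ℝ = ⟪Tt u, Tt w⟫_ℝ) :
    (∃ t ∈ spectrum ℝ G, ∀ u, ‖Tt u‖ ^ 2 ≤ t * ‖u‖ ^ 2) ∧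
    (∃ t ∈ spectrum ℝ G, ∀ u, t * ‖u‖ ^ 2 ≤ ‖Tt u‖ ^ 2) := by
  have : CompleteSpace V := FiniteDimensional.complete ℝ V
  have hsymm := gram_symm hG
  have hval : ∀ u : V, RCLike.re ⟪(G : V →ₗ[ℝ] V) u, u⟫_ℝ = ‖Tt u‖ ^ 2 := by
    intro u
    simp only [ContinuousLinearMap.coe_coe]
    rw [hG, real_inner_self_eq_norm_sq]
    rfl
  have h1 := hsymm.hasEigenvalue_iSup_of_finiteDimensional
  have h2 := hsymm.hasEigenvalue_iInf_of_finiteDimensional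
  simp only [hval] at h1 h2
  have hbd : ∀ u : {u : V // u ≠ 0}, ‖Tt u‖ ^ 2 / ‖(u : V)‖ ^ 2 ≤ ‖Tt‖ ^ 2 := by
    intro u
    have : 0 < ‖(u : V)‖ := norm_pos_iff.2 u.2
    rw [div_le_iff₀ (by positivity), ← mul_pow]
    gcongr
    exact Tt.le_opNorm _
  refine ⟨⟨⨆ u : {u : V // u ≠ 0}, ‖Tt u‖ ^ 2 / ‖(u : V)‖ ^ 2, ?_, fun u => ?_⟩,
    ⟨⨅ u : {u : V // u ≠ 0}, ‖Tt u‖ ^ 2 / ‖(u : V)‖ ^ 2, ?_, fun u => ?_⟩⟩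
  · rw [ContinuousLinearMap.spectrum_eq, ← Module.End.hasEigenvalue_iff_mem_spectrum]
    exact h1
  · by_cases hu : u = 0
    · simp [hu]
    have hu' : 0 < ‖u‖ := norm_pos_iff.2 hu
    rw [← div_le_iff₀ (by positivity)]
    exact le_ciSup (f := fun u : {u : V // u ≠ 0} => ‖Tt u‖ ^ 2 / ‖(u : V)‖ ^ 2)
      ⟨‖Tt‖ ^ 2, by rintro _ ⟨u, rfl⟩; exact hbd u⟩ ⟨u, hu⟩
  · rw [ContinuousLinearMap.spectrum_eq, ← Module.End.hasEigenvalue_iff_mem_spectrum]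
    exact h2
  · by_cases hu : u = 0
    · simp [hu]
    have hu' : 0 < ‖u‖ := norm_pos_iff.2 hu
    rw [← le_div_iff₀ (by positivity)]
    exact ciInf_le (f := fun u : {u : V // u ≠ 0} => ‖Tt u‖ ^ 2 / ‖(u : V)‖ ^ 2)
      ⟨0, by rintro _ ⟨u, rfl⟩; positivity⟩ ⟨u, hu⟩

lemma norm_sq_le_lamMax [FiniteDimensional ℝ V] [Nontrivial V] {Tt : V →L[ℝ] W} {G : V →L[ℝ] V}
    (hG : ∀ u w, ⟪G u, w⟫_ℝ = ⟪Tt u, Tt w⟫_ℝ) (u : V) : ‖Tt u‖ ^ 2 ≤ lamMax G * ‖u‖ ^ 2 := by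
  obtain ⟨⟨t, ht, h⟩, -⟩ := exists_spectrum_rayleigh hG
  refine (h u).trans ?_
  gcongr
  exact le_csSup ⟨‖Tt‖ ^ 2, fun _ hs => spectrum_gram_le hG hs⟩ ht

lemma lamMax_eq [FiniteDimensional ℝ V] [Nontrivial V] {Tt : V →L[ℝ] W} {G : V →L[ℝ] V}
    (hG : ∀ u w, ⟪G u, w⟫_ℝ = ⟪Tt u, Tt w⟫_ℝ) : lamMax G = ‖Tt‖ ^ 2 := by
  refine le_antisymm (lamMax_le hG) ?_
  have h0 : 0 ≤ lamMax G := by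
    obtain ⟨u, hu⟩ := exists_ne (0 : V)
    have h := norm_sq_le_lamMax hG u
    have : 0 < ‖u‖ ^ 2 := by positivity
    by_contra hcon
    nlinarith [sq_nonneg ‖Tt u‖]
  have h1 : ‖Tt‖ ≤ Real.sqrt (lamMax G) := by
    refine Tt.opNorm_le_bound (Real.sqrt_nonneg _) fun u => ?_
    rw [← Real.sqrt_sq (norm_nonneg u), ← Real.sqrt_mul h0]
    exact Real.le_sqrt_of_sq_le (by simpa using norm_sq_le_lamMax hG u)
  calc ‖Tt‖ ^ 2 ≤ Real.sqrt (lamMax G) ^ 2 := by gcongr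
    _ = lamMax G := Real.sq_sqrt h0

/-- Injectivity makes the least Rayleigh value positive, so the restriction to positive eigenvalues
in `lamMin` removes nothing. -/
lemma lamMin_spec [FiniteDimensional ℝ V] [Nontrivial V] {Tt : V →L[ℝ] W} {G : V →L[ℝ] V}
    (hG : ∀ u w, ⟪G u, w⟫_ℝ = ⟪Tt u, Tt w⟫_ℝ) (hinj : Function.Injective Tt) :
    0 < lamMin G ∧ lamMin G ≤ lamMax G ∧ ∀ u, lamMin G * ‖u‖ ^ 2 ≤ ‖Tt u‖ ^ 2 := by
  obtain ⟨-, ⟨t, ht, h⟩⟩ := exists_spectrum_rayleigh hG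
  have ht0 : 0 < t := by
    obtain ⟨u, hu, hut⟩ := eigen_gram hG ht
    have h1 : 0 < ‖Tt u‖ := norm_pos_iff.2 fun h0 => hu (hinj (h0.trans (map_zero Tt).symm))
    have h2 : 0 < ‖u‖ ^ 2 := by positivity
    have h3 : 0 < t * ‖u‖ ^ 2 := by rw [← hut]; positivity
    exact pos_of_mul_pos_left h3 h2.le
  have hle : lamMin G ≤ t := csInf_le ⟨0, fun s hs => hs.2.le⟩ ⟨ht, ht0⟩
  have hge : t ≤ lamMin G := by
    refine le_csInf ⟨t, ht, ht0⟩ fun s hs => ?_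
    obtain ⟨u, hu, hus⟩ := eigen_gram hG hs.1
    have h1 := h u
    rw [hus] at h1
    exact le_of_mul_le_mul_right h1 (by positivity)
  have heq : lamMin G = t := le_antisymm hle hge
  rw [heq]
  exact ⟨ht0, le_csSup ⟨‖Tt‖ ^ 2, fun _ hs => spectrum_gram_le hG hs⟩ ht, h⟩

end Convex

end IPG

namespace IPG

/-! ### Conjugates, their effective domains, and proximal points. -/

section Conj

variable {V : Type*} [NormedAddCommGroup V] [InnerProductSpace ℝ V]

/-- The effective domain of the conjugate. -/
def conjDom (g : V → ℝ) : Set V := {z | conj g z ≠ ⊤}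

/-- The conjugate as a real-valued function, meaningful on its effective domain. -/
def conjReal (g : V → ℝ) (z : V) : ℝ := (conj g z).toReal

lemma le_conj (g : V → ℝ) (y z : V) : ((⟪y, z⟫_ℝ - g y : ℝ) : EReal) ≤ conj g z :=
  le_iSup (fun y : V => ((⟪y, z⟫_ℝ - g y : ℝ) : EReal)) y

lemma conj_ne_bot (g : V → ℝ) (z : V) : conj g z ≠ ⊥ := by
  intro h
  have := le_conj g 0 z
  rw [h, le_bot_iff] at this
  exact EReal.coe_ne_bot _ this

lemma conj_eq_coe {g : V → ℝ} {z : V} (hz : z ∈ conjDom g) :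
    conj g z = (conjReal g z : EReal) :=
  (EReal.coe_toReal hz (conj_ne_bot g z)).symm

lemma le_conjReal {g : V → ℝ} {z : V} (hz : z ∈ conjDom g) (y : V) :
    ⟪y, z⟫_ℝ - g y ≤ conjReal g z := by
  have := le_conj g y z
  rw [conj_eq_coe hz] at this
  exact EReal.coe_le_coe_iff.1 this

lemma mem_conjDom_of_le {g : V → ℝ} {z : V} {t : ℝ} (h : ∀ y, ⟪y, z⟫_ℝ - g y ≤ t) :
    z ∈ conjDom g ∧ conjReal g z ≤ t := by
  have h1 : conj g z ≤ (t : EReal) := iSup_le fun y => EReal.coe_le_coe_iff.2 (h y)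
  have h2 : z ∈ conjDom g := ne_top_of_le_ne_top (EReal.coe_ne_top t) h1
  rw [conj_eq_coe h2] at h1
  exact ⟨h2, EReal.coe_le_coe_iff.1 h1⟩

lemma convexOn_conjReal (g : V → ℝ) : ConvexOn ℝ (conjDom g) (conjReal g) := by
  have key : ∀ x ∈ conjDom g, ∀ y ∈ conjDom g, ∀ a b : ℝ, 0 ≤ a → 0 ≤ b → a + b = 1 →
      ∀ u, ⟪u, a • x + b • y⟫_ℝ - g u ≤ a * conjReal g x + b * conjReal g y := by
    intro x hx y hy a b ha hb hab u
    have h1 := mul_le_mul_of_nonneg_left (le_conjReal hx u) ha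
    have h2 := mul_le_mul_of_nonneg_left (le_conjReal hy u) hb
    rw [inner_add_right, inner_smul_right, inner_smul_right]
    have h3 : g u = a * g u + b * g u := by rw [← add_mul, hab, one_mul]
    linarith
  refine ⟨fun x hx y hy a b ha hb hab => ?_, fun x hx y hy a b ha hb hab => ?_⟩
  · exact (mem_conjDom_of_le (key x hx y hy a b ha hb hab)).1
  · exact (mem_conjDom_of_le (key x hx y hy a b ha hb hab)).2

lemma lowerSemicontinuous_conj (g : V → ℝ) : LowerSemicontinuous (conj g) := by
  refine lowerSemicontinuous_iSup fun y => Continuous.lowerSemicontinuous ?_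
  exact continuous_coe_real_ereal.comp (by fun_prop)

/-- The conjugate of an `l`-Lipschitz function has its domain in the ball of radius `l`. -/
lemma norm_le_of_mem_conjDom {g : V → ℝ} {l : ℝ} (hl : 0 ≤ l)
    (hg : ∀ y y', |g y - g y'| ≤ l * ‖y - y'‖) {z : V} (hz : z ∈ conjDom g) : ‖z‖ ≤ l := by
  by_contra hcon
  push Not at hcon
  have hn : 0 < ‖z‖ := hl.trans_lt hcon
  -- Along the ray y = tz the pairing grows like t‖z‖², while g grows at most like tl‖z‖; a finite
  -- conjugate forbids ‖z‖ > l.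
  have key : ∀ t : ℝ, 0 ≤ t → t * (‖z‖ * (‖z‖ - l)) ≤ conjReal g z + g 0 := by
    intro t ht
    have h1 := le_conjReal hz (t • z)
    have h2 := (abs_le.1 (hg (t • z) 0)).2
    rw [sub_zero, norm_smul, Real.norm_eq_abs, abs_of_nonneg ht] at h2
    rw [real_inner_smul_left, real_inner_self_eq_norm_sq] at h1
    nlinarith
  have hpos : 0 < ‖z‖ * (‖z‖ - l) := mul_pos hn (by linarith)
  have h1 := key ((|conjReal g z + g 0| + 1) / (‖z‖ * (‖z‖ - l))) (by positivity)
  rw [div_mul_cancel₀ _ hpos.ne'] at h1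
  linarith [le_abs_self (conjReal g z + g 0)]

/-- The slope of an affine minorant that lies η below g at y is an η-subgradient. This approximate
Fenchel equality is all of biconjugation that is needed. -/
lemma exists_conjReal_le [CompleteSpace V] {g : V → ℝ} (hc : Continuous g)
    (hg : ConvexOn ℝ Set.univ g) (y : V) {η : ℝ} (hη : 0 < η) :
    ∃ ξ ∈ conjDom g, conjReal g ξ ≤ ⟪ξ, y⟫_ℝ - g y + η := by
  obtain ⟨l, c, h1, h2⟩ := hg.exists_affine_le_of_lt (𝕜 := ℝ) (Set.mem_univ y)
    (sub_lt_self (g y) hη) isClosed_univ (hc.lowerSemicontinuous.lowerSemicontinuousOn _)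
  set ξ := (InnerProductSpace.toDual ℝ V).symm l with hξ
  have hl : ∀ w, l w = ⟪ξ, w⟫_ℝ := fun w => by
    rw [hξ, InnerProductSpace.toDual_symm_apply]
  have h3 : ∀ w, ⟪ξ, w⟫_ℝ + c ≤ g w := fun w => by
    have := h1 ⟨w, Set.mem_univ w⟩
    simpa [hl] using this
  have h4 : ⟪ξ, y⟫_ℝ + c = g y - η := by simpa [hl] using h2
  refine ⟨ξ, mem_conjDom_of_le fun w => ?_⟩
  rw [real_inner_comm]
  linarith [h3 w]

lemma conjDom_nonempty [CompleteSpace V] {g : V → ℝ} (hc : Continuous g)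
    (hg : ConvexOn ℝ Set.univ g) : (conjDom g).Nonempty := by
  obtain ⟨ξ, hξ, -⟩ := exists_conjReal_le hc hg 0 one_pos
  exact ⟨ξ, hξ⟩

/-- A subgradient inequality for the conjugate gives one for the function. -/
lemma mem_subdiff_of_conj [CompleteSpace V] {g : V → ℝ} (hc : Continuous g)
    (hg : ConvexOn ℝ Set.univ g) {z y : V} (hz : z ∈ conjDom g)
    (h : ∀ w ∈ conjDom g, conjReal g z + ⟪w - z, y⟫_ℝ ≤ conjReal g w) : z ∈ subdiff g y := by
  have h1 : conjReal g z ≤ ⟪z, y⟫_ℝ - g y := by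
    refine le_of_forall_pos_le_add fun η hη => ?_
    obtain ⟨ξ, hξ, hle⟩ := exists_conjReal_le hc hg y hη
    have := h ξ hξ
    rw [inner_sub_left] at this
    linarith
  intro w
  have h2 := le_conjReal hz w
  rw [inner_sub_right, real_inner_comm w z] at *
  linarith

lemma lowerSemicontinuous_add_coe {X : Type*} [TopologicalSpace X] {f : X → EReal}
    (hf : LowerSemicontinuous f) {q : X → ℝ}
    (hq : Continuous q) : LowerSemicontinuous fun z => f z + (q z : EReal) := by
  refine hf.add' (continuous_coe_real_ereal.comp hq).lowerSemicontinuous fun z => ?_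
  exact EReal.continuousAt_add (Or.inr (EReal.coe_ne_bot _)) (Or.inr (EReal.coe_ne_top _))

/-- Since z₀ beats every point outside s, a minimizer over the compact set s ∪ {z₀} is global. -/
lemma exists_forall_le_of_compact {X : Type*} [TopologicalSpace X] {f : X → EReal}
    (hf : LowerSemicontinuous f) {s : Set X} (hs : IsCompact s) {z₀ : X} (h : ∀ z, z ∉ s → f z₀ ≤ f z) : ∃ p, ∀ q, f p ≤ f q := by
  obtain ⟨p, -, hp⟩ := LowerSemicontinuousOn.exists_isMinOn (s := insert z₀ s)
    (Set.insert_nonempty _ _) (hs.insert z₀) (hf.lowerSemicontinuousOn _)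
  refine ⟨p, fun q => ?_⟩
  by_cases hq : q ∈ s
  · exact hp (Set.mem_insert_of_mem _ hq)
  · exact (hp (Set.mem_insert _ _)).trans (h q hq)

/-- The proximal point of a conjugate function, with the strong convexity of the objective. -/
lemma prox_conj_spec [FiniteDimensional ℝ V] {g : V → ℝ} {l : ℝ} (hl : 0 ≤ l)
    (hlip : ∀ y y', |g y - g y'| ≤ l * ‖y - y'‖) (hc : Continuous g)
    (hg : ConvexOn ℝ Set.univ g) (η : ℝ) (a : V) :
    prox (conj g) η a ∈ conjDom g ∧ ∀ w ∈ conjDom g,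
      conjReal g (prox (conj g) η a) + 1 / (2 * η) * ‖prox (conj g) η a - a‖ ^ 2
        + 1 / (2 * η) * ‖w - prox (conj g) η a‖ ^ 2
        ≤ conjReal g w + 1 / (2 * η) * ‖w - a‖ ^ 2 := by
  have : CompleteSpace V := FiniteDimensional.complete ℝ V
  have : ProperSpace V := FiniteDimensional.proper_real V
  obtain ⟨z₀, hz₀⟩ := conjDom_nonempty hc hg
  have hex : ∃ p, ∀ q, conj g p + ((‖p - a‖ ^ 2 / (2 * η) : ℝ) : EReal)
      ≤ conj g q + ((‖q - a‖ ^ 2 / (2 * η) : ℝ) : EReal) := by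
    -- The domain of the conjugate lies in the ball of radius l, so compactness comes from there and
    -- not from the quadratic term.
    refine exists_forall_le_of_compact
      (lowerSemicontinuous_add_coe (lowerSemicontinuous_conj g)
        (q := fun q => ‖q - a‖ ^ 2 / (2 * η)) (by fun_prop))
      (isCompact_closedBall (0 : V) l) (z₀ := z₀) fun z hz => ?_
    have : conj g z = ⊤ := by
      by_contra hcon
      exact hz (by simpa using norm_le_of_mem_conjDom hl hlip hcon)
    rw [this, EReal.top_add_coe]
    exact le_top
  have hspec := Classical.epsilon_spec hex
  change ∀ q, conj g (prox (conj g) η a) + ((‖prox (conj g) η a - a‖ ^ 2 / (2 * η) : ℝ) : EReal)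
      ≤ conj g q + ((‖q - a‖ ^ 2 / (2 * η) : ℝ) : EReal) at hspec
  set p := prox (conj g) η a
  have hp : p ∈ conjDom g := by
    intro htop
    have h := hspec z₀
    rw [htop, EReal.top_add_coe, conj_eq_coe hz₀, ← EReal.coe_add] at h
    exact EReal.coe_ne_top _ (top_le_iff.1 h)
  refine ⟨hp, fun w hw => ?_⟩
  have := quadGrowth_of_isMin (convexOn_conjReal g) (ContinuousLinearMap.id ℝ V) a
    (c := 1 / (2 * η)) hp (fun w hw => ?_) w hw
  · simpa using this
  · have h := hspec w
    rw [conj_eq_coe hp, conj_eq_coe hw, ← EReal.coe_add, ← EReal.coe_add, EReal.coe_le_coe_iff]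
      at h
    simp only [ContinuousLinearMap.id_apply, one_div_mul_eq_div]
    exact h

/-- The proximal point of a real-valued convex function. -/
lemma prox_real_spec [FiniteDimensional ℝ V] {g : V → ℝ} {l : ℝ}
    (hlip : ∀ y y', |g y - g y'| ≤ l * ‖y - y'‖) (hc : Continuous g)
    (hg : ConvexOn ℝ Set.univ g) {η : ℝ} (hη : 0 < η) (a : V) :
    (1 / η) • (a - prox (fun y => (g y : EReal)) η a)
      ∈ subdiff g (prox (fun y => (g y : EReal)) η a) := by
  have : ProperSpace V := FiniteDimensional.proper_real V
  have hex : ∃ p, ∀ q, (g p : EReal) + ((‖p - a‖ ^ 2 / (2 * η) : ℝ) : EReal)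
      ≤ (g q : EReal) + ((‖q - a‖ ^ 2 / (2 * η) : ℝ) : EReal) := by
    have hcont : Continuous fun q => g q + ‖q - a‖ ^ 2 / (2 * η) := by fun_prop
    obtain ⟨p, hp⟩ := hcont.exists_forall_le' a (by
      -- Beyond distance 2ηl from a, the quadratic exceeds l‖q - a‖, the most that g can lose.
      filter_upwards [(isCompact_closedBall a (l * (2 * η))).compl_mem_cocompact] with q hq
      have h1 : l * (2 * η) < ‖q - a‖ := by simpa [dist_eq_norm] using hq
      have h2 := (abs_le.1 (hlip q a)).1
      have h3 : l * ‖q - a‖ ≤ ‖q - a‖ ^ 2 / (2 * η) := by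
        rw [le_div_iff₀ (by positivity)]
        nlinarith [norm_nonneg (q - a)]
      simp only [sub_self, norm_zero]
      norm_num
      linarith)
    refine ⟨p, fun q => ?_⟩
    rw [← EReal.coe_add, ← EReal.coe_add, EReal.coe_le_coe_iff]
    exact hp q
  have hspec := Classical.epsilon_spec hex
  change ∀ q, (g (prox (fun y => (g y : EReal)) η a) : EReal)
      + ((‖prox (fun y => (g y : EReal)) η a - a‖ ^ 2 / (2 * η) : ℝ) : EReal)
      ≤ (g q : EReal) + ((‖q - a‖ ^ 2 / (2 * η) : ℝ) : EReal) at hspec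
  set p := prox (fun y => (g y : EReal)) η a
  intro w
  have := firstOrder_of_isMin hg (ContinuousLinearMap.id ℝ V) a (c := 1 / (2 * η))
    (Set.mem_univ p) (fun w _ => ?_) w (Set.mem_univ w)
  · have h1 : 2 * (1 / (2 * η)) = 1 / η := by field_simp
    rw [h1] at this
    simp only [ContinuousLinearMap.id_apply] at this
    rw [real_inner_smul_left, ← neg_sub p a, inner_neg_left]
    linarith
  · have h := hspec w
    rw [← EReal.coe_add, ← EReal.coe_add, EReal.coe_le_coe_iff] at h
    simp only [ContinuousLinearMap.id_apply, one_div_mul_eq_div]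
    exact h

end Conj

/-! ### Accelerated proximal gradient, abstractly -/

section Accelerated

variable {V : Type*} [NormedAddCommGroup V] [InnerProductSpace ℝ V]

/-- One accelerated step for the proximal gradient map `T`. -/
def accelStep (T : V → V) (s : V × V × ℝ) : V × V × ℝ :=
  let α' : ℝ := (1 + Real.sqrt (1 + 4 * s.2.2 ^ 2)) / 2
  (T s.2.1, T s.2.1 + ((s.2.2 - 1) / α') • (T s.2.1 - s.1), α')

/-- The identity α'² - α' = α² makes the potential of `accel_rate` telescope, and the growth by at
least 1/2 per step produces the rate 1/j². -/
lemma accel_coeff {α : ℝ} (hα : 1 ≤ α) :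
    ((1 + Real.sqrt (1 + 4 * α ^ 2)) / 2) ^ 2 - (1 + Real.sqrt (1 + 4 * α ^ 2)) / 2 = α ^ 2 ∧
    α + 1 / 2 ≤ (1 + Real.sqrt (1 + 4 * α ^ 2)) / 2 := by
  have h1 : Real.sqrt (1 + 4 * α ^ 2) ^ 2 = 1 + 4 * α ^ 2 := Real.sq_sqrt (by positivity)
  have h2 : 2 * α ≤ Real.sqrt (1 + 4 * α ^ 2) := Real.le_sqrt_of_sq_le (by nlinarith)
  constructor
  · linarith [h1, sq (Real.sqrt (1 + 4 * α ^ 2))]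
  · linarith

/-- The estimate `O(1/j²)` for accelerated proximal gradient steps. -/
theorem accel_rate {D : V → ℝ} {K : Set V} {T : V → V} {L : ℝ} (hL : 0 < L)
    (hTK : ∀ u, T u ∈ K)
    (hT : ∀ u, ∀ w ∈ K, D (T u) + L / 2 * ‖T u - w‖ ^ 2 ≤ D w + L / 2 * ‖u - w‖ ^ 2)
    {zs : V} (hzs : zs ∈ K) (z₀ : V) {j : ℕ} (hj : 1 ≤ j) :
    ((accelStep T)^[j] (z₀, z₀, 1)).1 ∈ K ∧
    (j + 1 : ℝ) ^ 2 * (D ((accelStep T)^[j] (z₀, z₀, 1)).1 - D zs) ≤ 2 * L * ‖z₀ - zs‖ ^ 2 := by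
  -- A Lyapunov function of the state (z, ẑ, α). Its weight α² - α vanishes at α = 1, so the value
  -- of D at z₀ does not enter and z₀ may lie outside K.
  set Φ : V × V × ℝ → ℝ := fun s => (s.2.2 ^ 2 - s.2.2) * (2 / L) * (D s.1 - D zs)
    + ‖s.2.2 • s.2.1 - (s.2.2 - 1) • s.1 - zs‖ ^ 2 with hΦ
  have step : ∀ s : V × V × ℝ, 1 ≤ s.2.2 → (s.2.2 = 1 ∨ s.1 ∈ K) →
      Φ (accelStep T s) ≤ Φ s := by
    rintro ⟨z, y, α⟩ hα hs
    simp only at hα hs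
    obtain ⟨hc1, hc2⟩ := accel_coeff hα
    simp only [hΦ, accelStep]
    set α' := (1 + Real.sqrt (1 + 4 * α ^ 2)) / 2 with hα'
    have hα'0 : α' ≠ 0 := by intro h; linarith
    have hvec : α' • (T y + ((α - 1) / α') • (T y - z)) - (α' - 1) • T y - zs
        = α • T y - (α - 1) • z - zs := by
      have : α' * ((α - 1) / α') = α - 1 := by field_simp
      rw [smul_add, smul_smul, this]
      module
    rw [hvec, hc1]
    have h1 := hT y zs hzs
    have h2 : (α ^ 2 - α) * (D (T y) + L / 2 * ‖T y - z‖ ^ 2)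
        ≤ (α ^ 2 - α) * (D z + L / 2 * ‖y - z‖ ^ 2) := by
      rcases hs with h | h
      · rw [h]; simp
      · have : 0 ≤ α ^ 2 - α := by nlinarith
        exact mul_le_mul_of_nonneg_left (hT y z h) this
    have h3 : α * (D (T y) + L / 2 * ‖T y - zs‖ ^ 2) ≤ α * (D zs + L / 2 * ‖y - zs‖ ^ 2) :=
      mul_le_mul_of_nonneg_left h1 (by linarith)
    -- The inequality of `hT` at zs with weight α plus the one at z with weight α² - α yields the
    -- difference of this square between u = y and u = T y; the last term is common to both and
    -- cancels.
    have e : ∀ u : V, ‖α • u - (α - 1) • z - zs‖ ^ 2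
        = (α ^ 2 - α) * ‖u - z‖ ^ 2 + α * ‖u - zs‖ ^ 2 - (α - 1) * ‖z - zs‖ ^ 2 := by
      intro u
      have e1 : α • u - (α - 1) • z - zs = (α - 1) • (u - z) + (u - zs) := by module
      have e2 : z - zs = (u - zs) - (u - z) := by abel
      rw [e1, e2, norm_add_sq_real, norm_sub_sq_real (u - zs), inner_smul_left, norm_smul, mul_pow,
        real_inner_comm (u - zs) (u - z)]
      simp only [Real.norm_eq_abs, sq_abs, conj_trivial]
      ring
    rw [e, e]
    have h4 : (α ^ 2 * D (T y) - (α ^ 2 - α) * D z - α * D zs)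
        ≤ L / 2 * ((α ^ 2 - α) * ‖y - z‖ ^ 2 + α * ‖y - zs‖ ^ 2
          - ((α ^ 2 - α) * ‖T y - z‖ ^ 2 + α * ‖T y - zs‖ ^ 2)) := by linarith
    have h5 := mul_le_mul_of_nonneg_left h4 (by positivity : (0 : ℝ) ≤ 2 / L)
    have h6 : 2 / L * (L / 2 * ((α ^ 2 - α) * ‖y - z‖ ^ 2 + α * ‖y - zs‖ ^ 2
          - ((α ^ 2 - α) * ‖T y - z‖ ^ 2 + α * ‖T y - zs‖ ^ 2)))
        = (α ^ 2 - α) * ‖y - z‖ ^ 2 + α * ‖y - zs‖ ^ 2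
          - ((α ^ 2 - α) * ‖T y - z‖ ^ 2 + α * ‖T y - zs‖ ^ 2) := by field_simp
    rw [h6] at h5
    linarith
  have inv : ∀ i : ℕ, 1 + (i : ℝ) / 2 ≤ ((accelStep T)^[i] (z₀, z₀, 1)).2.2 ∧
      (i = 0 ∨ ((accelStep T)^[i] (z₀, z₀, 1)).1 ∈ K) ∧
      Φ ((accelStep T)^[i] (z₀, z₀, 1)) ≤ ‖z₀ - zs‖ ^ 2 := by
    intro i
    induction i with
    | zero => simp [hΦ]
    | succ i ih =>
      obtain ⟨h1, h2, h3⟩ := ih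
      rw [Function.iterate_succ_apply']
      set s := (accelStep T)^[i] (z₀, z₀, 1) with hs
      have hi : (0 : ℝ) ≤ i := Nat.cast_nonneg i
      have hs1 : 1 ≤ s.2.2 := by linarith
      refine ⟨?_, Or.inr (hTK _), (step s hs1 ?_).trans h3⟩
      · have := (accel_coeff hs1).2
        push_cast
        simp only [accelStep]
        linarith
      · rcases h2 with h | h
        · left; rw [hs, h]; rfl
        · exact Or.inr h
  obtain ⟨i, rfl⟩ : ∃ i, j = i + 1 := ⟨j - 1, by omega⟩
  obtain ⟨h1, -, -⟩ := inv i
  obtain ⟨-, h2, h3⟩ := inv (i + 1)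
  have hK := h2.resolve_left (by omega)
  refine ⟨hK, ?_⟩
  rw [Function.iterate_succ_apply'] at h3 ⊢
  set s := (accelStep T)^[i] (z₀, z₀, 1) with hs
  have hi : (0 : ℝ) ≤ i := Nat.cast_nonneg i
  have hs1 : 1 ≤ s.2.2 := by linarith
  set v := D (accelStep T s).1 - D zs with hv
  have h4 : s.2.2 ^ 2 * (2 / L) * v ≤ ‖z₀ - zs‖ ^ 2 := by
    have := (accel_coeff hs1).1
    have h5 : (accelStep T s).2.2 ^ 2 - (accelStep T s).2.2 = s.2.2 ^ 2 := this
    simp only [hΦ, h5] at h3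
    linarith [sq_nonneg ‖(accelStep T s).2.2 • (accelStep T s).2.1
      - ((accelStep T s).2.2 - 1) • (accelStep T s).1 - zs‖]
  rcases le_or_gt v 0 with hv0 | hv0
  · have : 0 ≤ 2 * L * ‖z₀ - zs‖ ^ 2 := by positivity
    refine le_trans ?_ this
    exact mul_nonpos_of_nonneg_of_nonpos (by positivity) hv0
  -- Here j = i + 1, and the coefficient before the last step is at least (i + 2)/2 = (j + 1)/2.
  · have h5 : ((i : ℝ) + 2) ^ 2 / 4 ≤ s.2.2 ^ 2 := by nlinarith
    have h6 : ((i : ℝ) + 2) ^ 2 / 4 * ((2 / L) * v) ≤ ‖z₀ - zs‖ ^ 2 := by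
      refine le_trans ?_ (le_of_eq_of_le (mul_assoc _ _ _).symm h4)
      gcongr
    calc ((i + 1 : ℕ) + 1 : ℝ) ^ 2 * v
        = 2 * L * (((i : ℝ) + 2) ^ 2 / 4 * ((2 / L) * v)) := by
          push_cast
          field_simp
          ring
      _ ≤ 2 * L * ‖z₀ - zs‖ ^ 2 := by gcongr

end Accelerated

end IPG

namespace IPG

namespace Data

variable {d n nbar : ℕ} {P : Data d n nbar}

/-! ### The stacked operator -/

lemma inner_dual (z w : Dual nbar n) : ⟪z, w⟫_ℝ = ⟪z.fst, w.fst⟫_ℝ + ⟪z.snd, w.snd⟫_ℝ := rfl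

lemma norm_dual_sq (z : Dual nbar n) : ‖z‖ ^ 2 = ‖z.fst‖ ^ 2 + ‖z.snd‖ ^ 2 := by
  rw [← real_inner_self_eq_norm_sq, ← real_inner_self_eq_norm_sq, ← real_inner_self_eq_norm_sq,
    inner_dual]

lemma norm_fst_le (z : Dual nbar n) : ‖z.fst‖ ≤ ‖z‖ := by
  refine le_of_sq_le_sq ?_ (norm_nonneg _)
  rw [norm_dual_sq]
  linarith [sq_nonneg ‖z.snd‖]

lemma norm_snd_le (z : Dual nbar n) : ‖z.snd‖ ≤ ‖z‖ := by
  refine le_of_sq_le_sq ?_ (norm_nonneg _)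
  rw [norm_dual_sq]
  linarith [sq_nonneg ‖z.fst‖]

lemma norm_dual_le (z : Dual nbar n) : ‖z‖ ≤ ‖z.fst‖ + ‖z.snd‖ := by
  refine le_of_sq_le_sq ?_ (by positivity)
  rw [norm_dual_sq]
  nlinarith [mul_nonneg (norm_nonneg z.fst) (norm_nonneg z.snd)]

@[simp] lemma M_fst (x : E d) : (P.M x).fst = P.Abar x := rfl

@[simp] lemma M_snd (x : E d) : (P.M x).snd = P.A x := rfl

lemma inner_Mt (z : Dual nbar n) (x : E d) : ⟪P.Mt z, x⟫_ℝ = ⟪z, P.M x⟫_ℝ :=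
  ContinuousLinearMap.adjoint_inner_left _ _ _

lemma Mt_apply (z : Dual nbar n) :
    P.Mt z = ContinuousLinearMap.adjoint P.Abar z.fst + ContinuousLinearMap.adjoint P.A z.snd := by
  refine ext_inner_right ℝ fun x => ?_
  rw [inner_Mt, inner_dual, inner_add_left, ContinuousLinearMap.adjoint_inner_left,
    ContinuousLinearMap.adjoint_inner_left, M_fst, M_snd]

lemma inner_gram (u w : Dual nbar n) : ⟪P.gram u, w⟫_ℝ = ⟪P.Mt u, P.Mt w⟫_ℝ := by
  rw [real_inner_comm, real_inner_comm (P.Mt w), inner_Mt]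
  rfl

lemma norm_Mt : ‖P.Mt‖ = ‖P.M‖ := LinearIsometryEquiv.norm_map ContinuousLinearMap.adjoint P.M

lemma norm_Mt_le (z : Dual nbar n) : ‖P.Mt z‖ ≤ ‖P.M‖ * ‖z‖ := by
  rw [← norm_Mt]
  exact P.Mt.le_opNorm z

lemma norm_Abar_le : ‖P.Abar‖ ≤ ‖P.M‖ :=
  P.Abar.opNorm_le_bound (norm_nonneg _) fun x => (norm_fst_le (P.M x)).trans (P.M.le_opNorm x)

lemma norm_A_le : ‖P.A‖ ≤ ‖P.M‖ :=
  P.A.opNorm_le_bound (norm_nonneg _) fun x => (norm_snd_le (P.M x)).trans (P.M.le_opNorm x)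

lemma norm_M_le : ‖P.M‖ ≤ ‖P.Abar‖ + ‖P.A‖ := by
  refine P.M.opNorm_le_bound (by positivity) fun x => (norm_dual_le (P.M x)).trans ?_
  rw [add_mul]
  exact add_le_add (P.Abar.le_opNorm x) (P.A.le_opNorm x)

lemma norm_adjoint_Abar_le (z : E nbar) : ‖ContinuousLinearMap.adjoint P.Abar z‖ ≤ ‖P.Abar‖ * ‖z‖ := by
  refine (ContinuousLinearMap.le_opNorm _ _).trans_eq ?_
  rw [LinearIsometryEquiv.norm_map]

/-- The base point `∇f₀(x) - τ x` of the dual residual. -/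
def base (P : Data d n nbar) (x : E d) : E d := gradient P.f₀ x - P.τ • x

lemma resid_eq (x : E d) (z : Dual nbar n) : P.resid x z = P.Mt z + P.base x := by
  rw [Mt_apply, resid, base]
  abel

lemma resid_sub (x : E d) (z w : Dual nbar n) : P.resid x z - P.resid x w = P.Mt (z - w) := by
  rw [resid_eq, resid_eq, map_sub]
  abel

lemma xUpdate_eq (hτ : P.τ ≠ 0) (x : E d) (z : Dual nbar n) :
    P.xUpdate x z = -((1 / P.τ) • P.resid x z) := by
  rw [xUpdate, resid, smul_sub, smul_smul, one_div_mul_cancel hτ, one_smul]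
  abel

/-- The vector of the linear term of the dual objective. -/
def beta (P : Data d n nbar) : Dual nbar n := WithLp.toLp 2 (P.bbar, P.b)

lemma inner_beta (z : Dual nbar n) : ⟪z, P.beta⟫_ℝ = ⟪z.fst, P.bbar⟫_ℝ + ⟪z.snd, P.b⟫_ℝ := rfl

/-- The effective domain of the dual objective. -/
def dualDom (P : Data d n nbar) : Set (Dual nbar n) := {z | z.fst ∈ conjDom P.gbar}

/-- The nonsmooth and linear part of the dual objective. -/
def dualLin (P : Data d n nbar) (z : Dual nbar n) : ℝ := conjReal P.gbar z.fst - ⟪z, P.beta⟫_ℝ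

/-- The dual objective as a real-valued function on its effective domain. -/
def dualReal (P : Data d n nbar) (x : E d) (z : Dual nbar n) : ℝ :=
  P.dualLin z + 1 / (2 * P.τ) * ‖P.resid x z‖ ^ 2

lemma dualObj_eq {x : E d} {z : Dual nbar n} (hz : z ∈ P.dualDom) :
    P.dualObj x z = (P.dualReal x z : EReal) := by
  rw [dualObj, conj_eq_coe hz, ← EReal.coe_add, dualReal, dualLin, inner_beta]
  congr 1
  ring

lemma dualObj_eq_top {x : E d} {z : Dual nbar n} (hz : z ∉ P.dualDom) : P.dualObj x z = ⊤ := by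
  have : conj P.gbar z.fst = ⊤ := by
    by_contra h
    exact hz h
  rw [dualObj, this, EReal.coe_add_top]

lemma convexOn_dualLin : ConvexOn ℝ P.dualDom P.dualLin := by
  have h := convexOn_conjReal P.gbar
  refine ⟨fun x hx y hy a b ha hb hab => h.1 hx hy ha hb hab, fun x hx y hy a b ha hb hab => ?_⟩
  have h1 := h.2 hx hy ha hb hab
  simp only [dualLin, inner_add_left, real_inner_smul_left, smul_eq_mul] at h1 ⊢
  have h2 : (a • x + b • y).fst = a • x.fst + b • y.fst := rfl
  rw [h2]
  linarith

/-! ### Dual solutions: existence, values and bounds. -/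

section Standing

variable (S : P.Standing)
include S

lemma Standing.tau_pos : 0 < P.τ := mul_pos two_pos S.Lf_pos

lemma Standing.gbar_continuous : Continuous P.gbar := by
  have : LipschitzWith ⟨P.lg, S.lg_nonneg⟩ P.gbar :=
    LipschitzWith.of_dist_le_mul fun y y' => by
      rw [Real.dist_eq, dist_eq_norm]
      exact S.g_lip y y'
  exact this.continuous

lemma Standing.norm_gradient_le (x : E d) : ‖gradient P.f₀ x‖ ≤ P.lf := by
  have : LipschitzWith ⟨P.lf, S.lf_nonneg⟩ P.f₀ :=
    LipschitzWith.of_dist_le_mul fun y y' => by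
      rw [Real.dist_eq, dist_eq_norm]
      exact S.f_lip y y'
  have h := norm_fderiv_le_of_lipschitz ℝ this (x₀ := x)
  rw [← toDual_gradient, LinearIsometryEquiv.norm_map] at h
  exact h

lemma Standing.norm_base_le (x : E d) : ‖P.base x‖ ≤ P.lf + P.τ * ‖x‖ := by
  refine (norm_sub_le _ _).trans ?_
  rw [norm_smul, Real.norm_eq_abs, abs_of_pos S.tau_pos]
  gcongr
  exact S.norm_gradient_le x

lemma Standing.gram_isUnit : IsUnit (P.A.comp (ContinuousLinearMap.adjoint P.A)) := by
  rw [ContinuousLinearMap.isUnit_iff_bijective]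
  have hinj : Function.Injective (P.A.comp (ContinuousLinearMap.adjoint P.A)) := by
    rw [injective_iff_map_eq_zero]
    intro w hw
    have h1 : ContinuousLinearMap.adjoint P.A w = 0 := by
      rw [← inner_self_eq_zero (𝕜 := ℝ), ContinuousLinearMap.adjoint_inner_left]
      have : P.A (ContinuousLinearMap.adjoint P.A w) = 0 := hw
      rw [this, inner_zero_right]
    obtain ⟨x, rfl⟩ := S.A_fullRowRank w
    rw [← inner_self_eq_zero (𝕜 := ℝ), ← ContinuousLinearMap.adjoint_inner_left, h1,
      inner_zero_left]
  exact ⟨hinj, LinearMap.surjective_of_injective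
    (f := (P.A.comp (ContinuousLinearMap.adjoint P.A)).toLinearMap) hinj⟩

/-- This left inverse recovers z₂ from Aᵀz₂; every bound for the multipliers z₂ goes through it. -/
lemma Standing.AAtInvA_adjoint (w : E n) :
    P.AAtInvA (ContinuousLinearMap.adjoint P.A w) = w := by
  have := Ring.inverse_mul_cancel _ S.gram_isUnit
  exact congrArg (fun T : E n →L[ℝ] E n => T w) this

omit S in
lemma AAtInvA_congr {u v : E d} (h : P.A u = P.A v) : P.AAtInvA u = P.AAtInvA v := by
  simp only [AAtInvA, ContinuousLinearMap.comp_apply, h]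

lemma Standing.norm_fst_le_of_mem {z : Dual nbar n} (hz : z ∈ P.dualDom) : ‖z.fst‖ ≤ P.lg :=
  norm_le_of_mem_conjDom S.lg_nonneg S.g_lip hz

lemma Standing.norm_snd_le_resid (x : E d) {z : Dual nbar n} (hz : z ∈ P.dualDom) :
    ‖z.snd‖ ≤ ‖P.AAtInvA‖ * (‖P.resid x z‖ + ‖P.base x‖ + ‖P.Abar‖ * P.lg) := by
  have h1 : ContinuousLinearMap.adjoint P.A z.snd
      = P.resid x z - P.base x - ContinuousLinearMap.adjoint P.Abar z.fst := by
    rw [resid_eq, Mt_apply]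
    abel
  calc ‖z.snd‖ = ‖P.AAtInvA (ContinuousLinearMap.adjoint P.A z.snd)‖ := by
        rw [S.AAtInvA_adjoint]
    _ ≤ ‖P.AAtInvA‖ * ‖P.resid x z - P.base x - ContinuousLinearMap.adjoint P.Abar z.fst‖ := by
        rw [h1]
        exact P.AAtInvA.le_opNorm _
    _ ≤ _ := by
        gcongr
        refine (norm_sub_le _ _).trans (add_le_add (norm_sub_le _ _) ?_)
        refine (norm_adjoint_Abar_le _).trans ?_
        gcongr
        exact S.norm_fst_le_of_mem hz

/-- Feasibility of (x₀, y₀) expresses b̄ and b through y₀ and x₀, so that the linear dual term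
depends on z only through z₁ and Mᵀz. Weak duality follows. -/
lemma Standing.beta_eq (z : Dual nbar n) : ⟪z, P.beta⟫_ℝ = ⟪z.fst, P.y₀⟫_ℝ - ⟪P.Mt z, P.x₀⟫_ℝ := by
  have hb : P.b = -P.A P.x₀ := (neg_eq_of_add_eq_zero_right S.feas_x).symm
  rw [inner_beta, inner_Mt, inner_dual, S.feas_y, hb, M_fst, M_snd, inner_add_right,
    inner_neg_right]
  ring

/-- Weak duality at the feasible point `x₀`. -/
lemma Standing.dualReal_ge (x : E d) {z : Dual nbar n} (hz : z ∈ P.dualDom) :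
    1 / (2 * P.τ) * ‖P.resid x z‖ ^ 2 + ⟪P.resid x z, P.x₀⟫_ℝ - ⟪P.base x, P.x₀⟫_ℝ - P.gbar P.y₀
      ≤ P.dualReal x z := by
  have h := le_conjReal hz P.y₀
  rw [real_inner_comm] at h
  rw [dualReal, dualLin, S.beta_eq]
  have h2 : ⟪P.resid x z, P.x₀⟫_ℝ = ⟪P.Mt z, P.x₀⟫_ℝ + ⟪P.base x, P.x₀⟫_ℝ := by
    rw [resid_eq, inner_add_left]
  linarith

omit S in
lemma lowerSemicontinuous_dualObj (x : E d) : LowerSemicontinuous (P.dualObj x) := by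
  have h1 : LowerSemicontinuous fun z : Dual nbar n => conj P.gbar z.fst := by
    have : Continuous fun z : Dual nbar n => z.fst := by fun_prop
    exact (lowerSemicontinuous_conj P.gbar).comp this
  have h2 := lowerSemicontinuous_add_coe h1 (q := fun z : Dual nbar n =>
    1 / (2 * P.τ) * ‖P.resid x z‖ ^ 2 - ⟪z.fst, P.bbar⟫_ℝ - ⟪z.snd, P.b⟫_ℝ) (by
      simp only [resid_eq]
      fun_prop)
  have h3 : P.dualObj x = fun z => conj P.gbar z.fst + ((1 / (2 * P.τ) * ‖P.resid x z‖ ^ 2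
      - ⟪z.fst, P.bbar⟫_ℝ - ⟪z.snd, P.b⟫_ℝ : ℝ) : EReal) := funext fun z => add_comm _ _
  rw [h3]
  exact h2

lemma Standing.exists_mem_dualDom : ∃ z, z ∈ P.dualDom := by
  obtain ⟨ξ, hξ⟩ := conjDom_nonempty S.gbar_continuous S.g_convex
  exact ⟨WithLp.toLp 2 (ξ, 0), hξ⟩

/-- The quadratic part may be degenerate in z, yet sublevel sets are bounded: weak duality bounds
the residual, z₁ is bounded by l_g, and z₂ is recovered from the residual and z₁. -/
lemma Standing.Omega_nonempty (x : E d) : (P.Omega x).Nonempty := by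
  obtain ⟨z₀, hz₀⟩ := S.exists_mem_dualDom
  have hτ := S.tau_pos
  set c := P.dualReal x z₀ + P.gbar P.y₀ + ⟪P.base x, P.x₀⟫_ℝ with hc
  set R₁ := 2 * P.τ * ‖P.x₀‖ + |2 * P.τ * c| + 1 with hR₁
  set R := P.lg + ‖P.AAtInvA‖ * (R₁ + ‖P.base x‖ + ‖P.Abar‖ * P.lg) with hR
  refine exists_forall_le_of_compact (lowerSemicontinuous_dualObj x)
    (isCompact_closedBall (0 : Dual nbar n) R) (z₀ := z₀) fun z hz => ?_
  by_cases hzd : z ∈ P.dualDom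
  swap
  · rw [dualObj_eq_top hzd]
    exact le_top
  rw [dualObj_eq hz₀, dualObj_eq hzd, EReal.coe_le_coe_iff]
  by_contra hcon
  push Not at hcon
  refine hz ?_
  have h1 := S.dualReal_ge x hzd
  have h2 : -(‖P.resid x z‖ * ‖P.x₀‖) ≤ ⟪P.resid x z, P.x₀⟫_ℝ :=
    neg_le_of_abs_le (abs_real_inner_le_norm _ _)
  have h3 : 1 / (2 * P.τ) * ‖P.resid x z‖ ^ 2 ≤ ‖P.resid x z‖ * ‖P.x₀‖ + c := by linarith
  have h4 : ‖P.resid x z‖ ^ 2 ≤ 2 * P.τ * (‖P.resid x z‖ * ‖P.x₀‖ + c) := by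
    rw [one_div_mul_eq_div, div_le_iff₀ (by positivity)] at h3
    linarith
  have h5 : ‖P.resid x z‖ ≤ R₁ := by
    by_contra h6
    push Not at h6
    have h7 : 1 ≤ ‖P.resid x z‖ := by
      have : 0 ≤ 2 * P.τ * ‖P.x₀‖ := by positivity
      have := abs_nonneg (2 * P.τ * c)
      linarith
    have h8 := le_abs_self (2 * P.τ * c)
    have h9 : |2 * P.τ * c| ≤ |2 * P.τ * c| * ‖P.resid x z‖ :=
      le_mul_of_one_le_right (abs_nonneg _) h7
    nlinarith
  have h6 : ‖z‖ ≤ R := by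
    refine (norm_dual_le z).trans (add_le_add (S.norm_fst_le_of_mem hzd) ?_)
    refine (S.norm_snd_le_resid x hzd).trans ?_
    gcongr
  simpa using h6

lemma Standing.mem_Omega_iff {x : E d} {z : Dual nbar n} :
    z ∈ P.Omega x ↔ z ∈ P.dualDom ∧ ∀ w ∈ P.dualDom, P.dualReal x z ≤ P.dualReal x w := by
  constructor
  · intro h
    have hz : z ∈ P.dualDom := by
      by_contra hz
      obtain ⟨z₀, hz₀⟩ := S.exists_mem_dualDom
      have := h z₀
      rw [dualObj_eq_top hz, dualObj_eq hz₀, top_le_iff] at this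
      exact EReal.coe_ne_top _ this
    refine ⟨hz, fun w hw => ?_⟩
    have := h w
    rwa [dualObj_eq hz, dualObj_eq hw, EReal.coe_le_coe_iff] at this
  · rintro ⟨hz, h⟩ w
    by_cases hw : w ∈ P.dualDom
    · rw [dualObj_eq hz, dualObj_eq hw, EReal.coe_le_coe_iff]
      exact h w hw
    · rw [dualObj_eq_top hw]
      exact le_top

omit S in
lemma isClosed_Omega (x : E d) : IsClosed (P.Omega x) := by
  have : P.Omega x = ⋂ w, P.dualObj x ⁻¹' Set.Iic (P.dualObj x w) := by
    ext z
    simp [Omega]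
  rw [this]
  exact isClosed_iInter fun w => (lowerSemicontinuous_dualObj x).isClosed_preimage _

lemma Standing.dualOpt_eq {x : E d} {z : Dual nbar n} (hz : z ∈ P.Omega x) :
    P.dualOpt x = (P.dualReal x z : EReal) := by
  rw [← dualObj_eq (S.mem_Omega_iff.1 hz).1]
  exact le_antisymm (iInf_le _ z) (le_iInf hz)

lemma Standing.gap_eq (h : P.zini ∈ P.dualDom) {x : E d} {z : Dual nbar n} (hz : z ∈ P.Omega x) :
    P.gap x = P.dualReal x P.zini - P.dualReal x z := by
  rw [gap, S.dualOpt_eq hz, dualObj_eq h, ← EReal.coe_sub, EReal.toReal_coe]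

lemma Standing.gap_nonneg (h : P.zini ∈ P.dualDom) (x : E d) : 0 ≤ P.gap x := by
  obtain ⟨z, hz⟩ := S.Omega_nonempty x
  rw [S.gap_eq h hz]
  have := (S.mem_Omega_iff.1 hz).2 _ h
  linarith

/-! ### Optimality conditions for the dual subproblem -/

lemma Standing.firstOrder {x : E d} {z : Dual nbar n} (hz : z ∈ P.Omega x) {w : Dual nbar n}
    (hw : w ∈ P.dualDom) :
    0 ≤ P.dualLin w - P.dualLin z + 1 / P.τ * ⟪P.resid x z, P.Mt (w - z)⟫_ℝ := by
  obtain ⟨hzd, hmin⟩ := S.mem_Omega_iff.1 hz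
  have h := firstOrder_of_isMin convexOn_dualLin P.Mt (-P.base x) (c := 1 / (2 * P.τ)) hzd
    (fun w hw => ?_) w hw
  · have h1 : 2 * (1 / (2 * P.τ)) = 1 / P.τ := by
      have := S.tau_pos.ne'
      field_simp
    rwa [h1, sub_neg_eq_add, ← resid_eq] at h
  · rw [sub_neg_eq_add, sub_neg_eq_add, ← resid_eq, ← resid_eq]
    exact hmin w hw

/-- The smooth part is quadratic in Mᵀz, so the second-order expansion is exact, with no domain
condition on the points. -/
lemma dualReal_sub (x : E d) (z w : Dual nbar n) : P.dualReal x w - P.dualReal x z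
    = P.dualLin w - P.dualLin z + 1 / P.τ * ⟪P.resid x z, P.Mt (w - z)⟫_ℝ
      + 1 / (2 * P.τ) * ‖P.Mt (w - z)‖ ^ 2 := by
  have h3 : P.resid x w = P.resid x z + P.Mt (w - z) := by
    rw [← resid_sub]
    abel
  have h1 : 1 / P.τ = 2 * (1 / (2 * P.τ)) := by
    have := S.tau_pos.ne'
    field_simp
  rw [dualReal, dualReal, h3, norm_add_sq_real, h1]
  ring

lemma Standing.growth_Mt {x : E d} {z : Dual nbar n} (hz : z ∈ P.Omega x) {w : Dual nbar n}
    (hw : w ∈ P.dualDom) :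
    1 / (2 * P.τ) * ‖P.Mt (w - z)‖ ^ 2 ≤ P.dualReal x w - P.dualReal x z := by
  rw [dualReal_sub S]
  linarith [S.firstOrder hz hw]

/-- The dual residual is the same at all dual solutions. -/
lemma Standing.nu_eq {x : E d} {z : Dual nbar n} (hz : z ∈ P.Omega x) :
    P.nu x = P.resid x z := by
  have hw : (Classical.epsilon fun z => z ∈ P.Omega x) ∈ P.Omega x :=
    Classical.epsilon_spec (S.Omega_nonempty x)
  have h1 := S.growth_Mt hz (S.mem_Omega_iff.1 hw).1
  have h2 := (S.mem_Omega_iff.1 hw).2 z (S.mem_Omega_iff.1 hz).1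
  have h3 : 0 < 1 / (2 * P.τ) := by
    have := S.tau_pos
    positivity
  have h4 : ‖P.Mt ((Classical.epsilon fun z => z ∈ P.Omega x) - z)‖ ^ 2 ≤ 0 := by
    by_contra hcon
    push Not at hcon
    have := mul_pos h3 hcon
    linarith
  have h5 : P.Mt ((Classical.epsilon fun z => z ∈ P.Omega x) - z) = 0 := by
    have : ‖P.Mt ((Classical.epsilon fun z => z ∈ P.Omega x) - z)‖ = 0 := by
      nlinarith [norm_nonneg (P.Mt ((Classical.epsilon fun z => z ∈ P.Omega x) - z))]
    simpa using this
  rw [← resid_sub, sub_eq_zero] at h5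
  exact h5

/-- The gradient of the quadratic part at z is -M x⁺, where x⁺ is the primal update. Dual optimality
therefore reads Āx⁺ + b̄ ∈ ∂ḡ⋆(z₁) and Ax⁺ + b = 0, here in one variational inequality. -/
lemma Standing.firstOrder_primal {x : E d} {z : Dual nbar n} (hz : z ∈ P.Omega x)
    {w : Dual nbar n} (hw : w ∈ P.dualDom) :
    conjReal P.gbar z.fst + ⟪w.fst - z.fst, P.Abar (P.xUpdate x z) + P.bbar⟫_ℝ
      + ⟪w.snd - z.snd, P.A (P.xUpdate x z) + P.b⟫_ℝ ≤ conjReal P.gbar w.fst := by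
  have h := S.firstOrder hz hw
  have h1 : 1 / P.τ * ⟪P.resid x z, P.Mt (w - z)⟫_ℝ = -⟪w - z, P.M (P.xUpdate x z)⟫_ℝ := by
    rw [← inner_Mt, xUpdate_eq S.tau_pos.ne', inner_neg_right, inner_smul_right,
      real_inner_comm (P.Mt (w - z))]
    ring
  rw [h1, dualLin, dualLin] at h
  have h2 : ⟪w, P.beta⟫_ℝ - ⟪z, P.beta⟫_ℝ = ⟪w - z, P.beta⟫_ℝ := (inner_sub_left _ _ _).symm
  have h3 : ⟪w - z, P.beta⟫_ℝ = ⟪w.fst - z.fst, P.bbar⟫_ℝ + ⟪w.snd - z.snd, P.b⟫_ℝ := rfl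
  have h4 : ⟪w - z, P.M (P.xUpdate x z)⟫_ℝ = ⟪w.fst - z.fst, P.Abar (P.xUpdate x z)⟫_ℝ
    + ⟪w.snd - z.snd, P.A (P.xUpdate x z)⟫_ℝ := rfl
  rw [inner_add_right, inner_add_right]
  linarith

/-- The exact primal point of the subproblem is feasible. -/
lemma Standing.feasible_of_mem_Omega {x : E d} {z : Dual nbar n} (hz : z ∈ P.Omega x) :
    P.A (P.xUpdate x z) + P.b = 0 := by
  have hzd := (S.mem_Omega_iff.1 hz).1
  -- The component z₂ is free, so it can be moved by the constraint residual itself, whose squared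
  -- norm is then at most 0.
  have h := S.firstOrder_primal hz (w := WithLp.toLp 2
    (z.fst, z.snd + (P.A (P.xUpdate x z) + P.b))) hzd
  simp only [WithLp.toLp_fst, WithLp.toLp_snd, sub_self, inner_zero_left, add_zero,
    add_sub_cancel_left, real_inner_self_eq_norm_sq] at h
  have : ‖P.A (P.xUpdate x z) + P.b‖ = 0 := by
    nlinarith [norm_nonneg (P.A (P.xUpdate x z) + P.b)]
  simpa using this

lemma Standing.subdiff_of_mem_Omega {x : E d} {z : Dual nbar n} (hz : z ∈ P.Omega x) :
    z.fst ∈ subdiff P.gbar (P.Abar (P.xUpdate x z) + P.bbar) := by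
  refine mem_subdiff_of_conj S.gbar_continuous S.g_convex (S.mem_Omega_iff.1 hz).1 fun w hw => ?_
  have h := S.firstOrder_primal hz (w := WithLp.toLp 2 (w, z.snd)) hw
  simpa using h

/-- A bound for the multipliers of the equality constraint. -/
lemma Standing.norm_snd_le_of_mem_Omega {x : E d} {z : Dual nbar n} (hz : z ∈ P.Omega x) {u : E d}
    (hu : P.A u + P.b = 0) :
    ‖z.snd‖ ≤ P.B₂ + P.τ * ‖P.AAtInvA (u - x)‖ := by
  have hf := S.feasible_of_mem_Omega hz
  have h1 : ContinuousLinearMap.adjoint P.A z.snd = -(gradient P.f₀ x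
      + ContinuousLinearMap.adjoint P.Abar z.fst) - P.τ • (P.xUpdate x z - x) := by
    rw [xUpdate]
    rw [sub_sub_cancel_left, smul_neg, smul_smul, mul_one_div_cancel S.tau_pos.ne', one_smul]
    abel
  -- The operator sees its argument only through A, and x⁺ and u have the same image -b. Thus a
  -- feasible u near x controls the multiplier even when x⁺ is far away.
  have h2 : P.AAtInvA (P.xUpdate x z - x) = P.AAtInvA (u - x) := by
    refine AAtInvA_congr ?_
    rw [map_sub, map_sub, eq_neg_of_add_eq_zero_left hf, eq_neg_of_add_eq_zero_left hu]
  rw [← S.AAtInvA_adjoint z.snd, h1, map_sub, map_smul, h2]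
  refine (norm_sub_le _ _).trans (add_le_add ?_ ?_)
  · refine (P.AAtInvA.le_opNorm _).trans ?_
    rw [norm_neg, B₂]
    gcongr
    refine (norm_add_le _ _).trans (add_le_add (S.norm_gradient_le x) ?_)
    refine (norm_adjoint_Abar_le _).trans ?_
    gcongr
    exact S.norm_fst_le_of_mem (S.mem_Omega_iff.1 hz).1
  · rw [norm_smul, Real.norm_eq_abs, abs_of_pos S.tau_pos]

end Standing

end Data

end IPG

/-! ### Accelerated steps on the dual objective, restarts and growth. -/

namespace IPG

/-- Hoffman constants of nonzero equality operators are positive. -/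
lemma hoffman_pos {V W : Type*} [NormedAddCommGroup V] [InnerProductSpace ℝ V]
    [FiniteDimensional ℝ V] [NormedAddCommGroup W] [InnerProductSpace ℝ W] {m : ℕ}
    (T : V →L[ℝ] W) (S : V →L[ℝ] E m) {u : V} (hu : T u ≠ 0) : 0 < hoffman T S := by
  -- With this right-hand side both 0 and u satisfy the inequalities, so only the equations
  -- contribute to the residual of u.
  set e : E m := WithLp.toLp 2 fun i => |S u i| with he
  have h0 : (0 : V) ∈ linSol T S 0 e := ⟨map_zero _, fun i => by simp [he]⟩
  have h1 := infDist_le_hoffman_of_feasible T S 0 e ⟨0, h0⟩ u fun i => by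
    simpa [he] using le_abs_self (S u i)
  have h2 : 0 < Metric.infDist u (linSol T S 0 e) := by
    rw [← (isClosed_linSol T S 0 e).notMem_iff_infDist_pos ⟨0, h0⟩]
    exact fun h => hu h.1
  rcases (hoffman_nonneg T S).lt_or_eq with h | h
  · exact h
  · rw [← h, zero_mul] at h1
    linarith

namespace Data

variable {d n nbar : ℕ} {P : Data d n nbar}

/-- The proximal gradient map of the dual objective. -/
def apgMap (P : Data d n nbar) (x : E d) (u : Dual nbar n) : Dual nbar n :=
  WithLp.toLp 2
    (prox (conj P.gbar) (1 / P.LD)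
      (u.fst - (1 / P.LD) • ((1 / P.τ) • P.Abar (P.resid x u) - P.bbar)),
      u.snd - (1 / P.LD) • ((1 / P.τ) • P.A (P.resid x u) - P.b))

section Standing

variable (S : P.Standing)
include S

lemma Standing.nontrivial : Nontrivial (Dual nbar n) := by
  by_contra h
  rw [not_nontrivial_iff_subsingleton] at h
  exact S.M_ne_zero (ContinuousLinearMap.ext fun x => Subsingleton.elim _ _)

lemma Standing.norm_M_pos : 0 < ‖P.M‖ := norm_pos_iff.2 S.M_ne_zero

lemma Standing.lamMax_eq : lamMax P.gram = ‖P.M‖ ^ 2 := by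
  have := S.nontrivial
  rw [IPG.lamMax_eq (inner_gram (P := P)), norm_Mt]

lemma Standing.LD_pos : 0 < P.LD := by
  have h1 := S.norm_M_pos
  have h2 := S.tau_pos
  rw [LD, S.lamMax_eq]
  positivity

lemma Standing.norm_Mt_sq_le (z : Dual nbar n) :
    1 / (2 * P.τ) * ‖P.Mt z‖ ^ 2 ≤ P.LD / 2 * ‖z‖ ^ 2 := by
  have h := norm_Mt_le (P := P) z
  have h2 := S.tau_pos
  have h3 : ‖P.Mt z‖ ^ 2 ≤ ‖P.M‖ ^ 2 * ‖z‖ ^ 2 := by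
    rw [← mul_pow]
    gcongr
  calc 1 / (2 * P.τ) * ‖P.Mt z‖ ^ 2 ≤ 1 / (2 * P.τ) * (‖P.M‖ ^ 2 * ‖z‖ ^ 2) := by gcongr
    _ = P.LD / 2 * ‖z‖ ^ 2 := by
      rw [LD, S.lamMax_eq]
      field_simp

lemma Standing.apgMap_mem (x : E d) (u : Dual nbar n) : P.apgMap x u ∈ P.dualDom :=
  (prox_conj_spec S.lg_nonneg S.g_lip S.gbar_continuous S.g_convex _ _).1

/-- The proximal step minimizes a strongly convex model, in which z₂ is a plain gradient step. The
model majorizes D_k since L = ‖M‖²/τ, and convexity of the smooth part handles the comparison point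
w. -/
lemma Standing.apgMap_spec (x : E d) (u : Dual nbar n) {w : Dual nbar n} (hw : w ∈ P.dualDom) :
    P.dualReal x (P.apgMap x u) + P.LD / 2 * ‖P.apgMap x u - w‖ ^ 2
      ≤ P.dualReal x w + P.LD / 2 * ‖u - w‖ ^ 2 := by
  have hL := S.LD_pos
  set G : Dual nbar n := (1 / P.τ) • P.M (P.resid x u) - P.beta with hG
  set a : Dual nbar n := u - (1 / P.LD) • G with ha
  set v := P.apgMap x u with hv
  have hη : 1 / (2 * (1 / P.LD)) = P.LD / 2 := by field_simp
  have h1 : conjReal P.gbar v.fst + P.LD / 2 * ‖v.fst - a.fst‖ ^ 2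
      + P.LD / 2 * ‖w.fst - v.fst‖ ^ 2 ≤ conjReal P.gbar w.fst + P.LD / 2 * ‖w.fst - a.fst‖ ^ 2 := by
    have := (prox_conj_spec S.lg_nonneg S.g_lip S.gbar_continuous S.g_convex (1 / P.LD) a.fst).2
      w.fst hw
    rwa [hη] at this
  have hs : v.snd = a.snd := rfl
  have h2 : conjReal P.gbar v.fst + P.LD / 2 * ‖v - a‖ ^ 2 + P.LD / 2 * ‖w - v‖ ^ 2
      ≤ conjReal P.gbar w.fst + P.LD / 2 * ‖w - a‖ ^ 2 := by
    rw [norm_dual_sq (v - a), norm_dual_sq (w - v), norm_dual_sq (w - a)]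
    simp only [WithLp.sub_fst, WithLp.sub_snd, hs, sub_self, norm_zero]
    linarith
  have hexp : ∀ y : Dual nbar n, P.LD / 2 * ‖y - a‖ ^ 2
      = P.LD / 2 * ‖y - u‖ ^ 2 + ⟪y - u, G⟫_ℝ + 1 / (2 * P.LD) * ‖G‖ ^ 2 := by
    intro y
    have : y - a = (y - u) + (1 / P.LD) • G := by rw [ha]; abel
    rw [this, norm_add_sq_real, inner_smul_right, norm_smul, mul_pow, Real.norm_eq_abs, sq_abs]
    field_simp
  -- An extrapolated point u may leave the domain, where `conjReal` has a default value; that value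
  -- occurs on both sides and cancels.
  have hD : ∀ y : Dual nbar n, P.dualReal x y = P.dualReal x u
      + (conjReal P.gbar y.fst - conjReal P.gbar u.fst) + ⟪y - u, G⟫_ℝ
      + 1 / (2 * P.τ) * ‖P.Mt (y - u)‖ ^ 2 := by
    intro y
    have e1 := dualReal_sub S x u y
    have e2 : ⟪y - u, G⟫_ℝ = 1 / P.τ * ⟪P.resid x u, P.Mt (y - u)⟫_ℝ
        - (⟪y, P.beta⟫_ℝ - ⟪u, P.beta⟫_ℝ) := by
      rw [hG, inner_sub_right, inner_smul_right, ← inner_Mt, real_inner_comm, inner_sub_left]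
    simp only [dualLin] at e1
    linarith
  rw [hexp, hexp] at h2
  have h3 := S.norm_Mt_sq_le (v - u)
  have h4 : 0 ≤ 1 / (2 * P.τ) * ‖P.Mt (w - u)‖ ^ 2 := by
    have := S.tau_pos
    positivity
  rw [hD v, hD w, norm_sub_rev v w, norm_sub_rev u w]
  linarith

/-- The convergence rate of an inner loop. -/
lemma Standing.epoch_rate (x : E d) {j : ℕ} (hj : 1 ≤ j) (z₀ : Dual nbar n) {zs : Dual nbar n}
    (hzs : zs ∈ P.Omega x) : P.apgEpoch x j z₀ ∈ P.dualDom ∧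
      (j + 1 : ℝ) ^ 2 * (P.dualReal x (P.apgEpoch x j z₀) - P.dualReal x zs)
        ≤ 2 * P.LD * ‖z₀ - zs‖ ^ 2 :=
  accel_rate S.LD_pos (S.apgMap_mem x) (fun u _ hw => S.apgMap_spec x u hw)
    (S.mem_Omega_iff.1 hzs).1 z₀ hj

/-- A loop that is long compared with the growth modulus `ρ`. -/
lemma Standing.epoch_gap (x : E d) {j : ℕ} (hj : 1 ≤ j) {ρ : ℝ}
    (hlen : 8 * P.LD ≤ ρ * (j : ℝ) ^ 2) (hρ : 0 < ρ) (z₀ : Dual nbar n) :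
    P.apgEpoch x j z₀ ∈ P.dualDom ∧ ∀ zs ∈ P.Omega x,
      P.dualReal x (P.apgEpoch x j z₀) - P.dualReal x zs
        ≤ ρ / 4 * Metric.infDist z₀ (P.Omega x) ^ 2 := by
  obtain ⟨p, hp, hpd⟩ := (isClosed_Omega x).exists_infDist_eq_dist (S.Omega_nonempty x) z₀
  obtain ⟨h1, h2⟩ := S.epoch_rate x hj z₀ hp
  refine ⟨h1, fun zs hzs => ?_⟩
  have h3 : P.dualReal x zs = P.dualReal x p := by
    obtain ⟨a1, a2⟩ := S.mem_Omega_iff.1 hzs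
    obtain ⟨b1, b2⟩ := S.mem_Omega_iff.1 hp
    exact le_antisymm (a2 p b1) (b2 zs a1)
  rw [h3, hpd, dist_eq_norm]
  have hj0 : (0 : ℝ) < j := by exact_mod_cast hj
  have h4 : 8 * P.LD ≤ ρ * (j + 1 : ℝ) ^ 2 := by
    refine hlen.trans ?_
    gcongr
    linarith
  have h5 : (j + 1 : ℝ) ^ 2 * (P.dualReal x (P.apgEpoch x j z₀) - P.dualReal x p)
      ≤ (j + 1 : ℝ) ^ 2 * (ρ / 4 * ‖z₀ - p‖ ^ 2) := by
    refine h2.trans ?_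
    nlinarith [sq_nonneg ‖z₀ - p‖]
  exact le_of_mul_le_mul_left h5 (by positivity)

/-- Quadratic growth of the dual objective on a sublevel set. -/
def GrowthOn (P : Data d n nbar) (x : E d) (ρ G : ℝ) : Prop :=
  ∀ z ∈ P.dualDom, ∀ zs ∈ P.Omega x, P.dualReal x z - P.dualReal x zs ≤ G →
    ρ / 2 * Metric.infDist z (P.Omega x) ^ 2 ≤ P.dualReal x z - P.dualReal x zs

omit S in
lemma restartedAPG_succ (x : E d) (i j : ℕ) :
    P.restartedAPG x (i + 1) j = P.apgEpoch x j (P.restartedAPG x i j) :=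
  Function.iterate_succ_apply' _ _ _

/-- A loop brings the gap below ρ/4 · dist², and growth bounds ρ/2 · dist² by the previous gap, so
each loop halves it. The gap never exceeds its initial value; growth on that sublevel set is enough.
-/
lemma Standing.restart_gap {x : E d} {j : ℕ} (hj : 1 ≤ j) {ρ : ℝ}
    (hlen : 8 * P.LD ≤ ρ * (j : ℝ) ^ 2) (hρ : 0 < ρ) (hini : P.zini ∈ P.dualDom)
    (hg : P.GrowthOn x ρ (P.gap x)) (i : ℕ) {zs : Dual nbar n} (hzs : zs ∈ P.Omega x) :
    P.restartedAPG x i j ∈ P.dualDom ∧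
      2 ^ i * (P.dualReal x (P.restartedAPG x i j) - P.dualReal x zs) ≤ P.gap x := by
  induction i with
  | zero =>
    refine ⟨hini, ?_⟩
    rw [S.gap_eq hini hzs, pow_zero, one_mul]
    exact le_rfl
  | succ i ih =>
    rw [restartedAPG_succ]
    obtain ⟨h1, h2⟩ := ih
    obtain ⟨h3, h4⟩ := S.epoch_gap x hj hlen hρ (P.restartedAPG x i j)
    refine ⟨h3, ?_⟩
    have h5 := h4 zs hzs
    have h0 : 0 ≤ P.dualReal x (P.restartedAPG x i j) - P.dualReal x zs := by
      linarith [(S.mem_Omega_iff.1 hzs).2 _ h1]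
    have h6 : P.dualReal x (P.restartedAPG x i j) - P.dualReal x zs ≤ P.gap x := by
      refine le_trans ?_ h2
      exact le_mul_of_one_le_left h0 (one_le_pow₀ one_le_two)
    have h7 := hg _ h1 zs hzs h6
    calc (2 : ℝ) ^ (i + 1) * (P.dualReal x (P.apgEpoch x j (P.restartedAPG x i j))
          - P.dualReal x zs)
        ≤ 2 ^ (i + 1) * ((P.dualReal x (P.restartedAPG x i j) - P.dualReal x zs) / 2) := by
          gcongr
          linarith
      _ = 2 ^ i * (P.dualReal x (P.restartedAPG x i j) - P.dualReal x zs) := by ring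
      _ ≤ P.gap x := h2

lemma Standing.crit_of_infDist {x : E d} {δ : ℝ} {z : Dual nbar n}
    (hz : z ∈ P.dualDom) (h : Metric.infDist z (P.Omega x) ≤ δ) : P.Crit δ x z := by
  refine ⟨hz, ?_⟩
  rw [← ENNReal.ofReal_toReal (Metric.infEDist_ne_top (S.Omega_nonempty x))]
  exact ENNReal.ofReal_le_ofReal h

lemma Standing.exists_of_crit {x : E d} {δ : ℝ} (hδ : 0 ≤ δ) {z : Dual nbar n}
    (h : P.Crit δ x z) : ∃ zs ∈ P.Omega x, ‖z - zs‖ ≤ δ := by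
  obtain ⟨p, hp, hpd⟩ := (isClosed_Omega x).exists_infDist_eq_dist (S.Omega_nonempty x) z
  refine ⟨p, hp, ?_⟩
  rw [← dist_eq_norm, ← hpd]
  exact ENNReal.toReal_le_of_le_ofReal hδ h.2

/-- Accuracy after enough loops, from a finite initial dual gap. -/
lemma Standing.crit_of_gap {x : E d} {j : ℕ} (hj : 1 ≤ j) {ρ : ℝ}
    (hlen : 8 * P.LD ≤ ρ * (j : ℝ) ^ 2) (hρ : 0 < ρ) (hini : P.zini ∈ P.dualDom)
    (hg : P.GrowthOn x ρ (P.gap x)) {δ : ℝ} (hδ : 0 < δ) {i : ℕ}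
    (hi : 2 * P.gap x / (ρ * δ ^ 2) ≤ 2 ^ i) : P.Crit δ x (P.restartedAPG x i j) := by
  obtain ⟨zs, hzs⟩ := S.Omega_nonempty x
  obtain ⟨h1, h2⟩ := S.restart_gap hj hlen hρ hini hg i hzs
  refine S.crit_of_infDist h1 ?_
  set v := P.dualReal x (P.restartedAPG x i j) - P.dualReal x zs with hv
  have h0 : 0 ≤ v := by linarith [(S.mem_Omega_iff.1 hzs).2 _ h1]
  have h6 : v ≤ P.gap x := le_trans (le_mul_of_one_le_left h0 (one_le_pow₀ one_le_two)) h2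
  have h7 := hg _ h1 zs hzs h6
  rw [div_le_iff₀ (by positivity)] at hi
  have h8 : 2 ^ i * (2 * v) ≤ 2 ^ i * (ρ * δ ^ 2) := by linarith
  have h9 : 2 * v ≤ ρ * δ ^ 2 := le_of_mul_le_mul_left h8 (by positivity)
  have h10 : ρ * Metric.infDist (P.restartedAPG x i j) (P.Omega x) ^ 2 ≤ ρ * δ ^ 2 := by linarith
  exact le_of_sq_le_sq (le_of_mul_le_mul_left h10 hρ) hδ.le

/-- Accuracy after enough loops, from the initial distance and global growth. -/
lemma Standing.crit_of_infDist_zini {x : E d} {j : ℕ} (hj : 1 ≤ j) {ρ : ℝ}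
    (hlen : 8 * P.LD ≤ ρ * (j : ℝ) ^ 2) (hρ : 0 < ρ) (hg : ∀ G, P.GrowthOn x ρ G)
    {δ : ℝ} (hδ : 0 < δ) {i : ℕ} (hi1 : 1 ≤ i)
    (hi : Metric.infDist P.zini (P.Omega x) ^ 2 ≤ δ ^ 2 * 2 ^ i) :
    P.Crit δ x (P.restartedAPG x i j) := by
  obtain ⟨zs, hzs⟩ := S.Omega_nonempty x
  -- Since `zini` may lie outside the domain, squared distances are compared instead: ρ/2 · dist² of
  -- the new point is at most its gap, hence at most ρ/4 · dist² of the old point.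
  have key : ∀ i : ℕ, 2 ^ i * Metric.infDist (P.restartedAPG x i j) (P.Omega x) ^ 2
      ≤ Metric.infDist P.zini (P.Omega x) ^ 2 := by
    intro i
    induction i with
    | zero => simp [restartedAPG]
    | succ i ih =>
      rw [restartedAPG_succ]
      obtain ⟨h3, h4⟩ := S.epoch_gap x hj hlen hρ (P.restartedAPG x i j)
      have h5 := h4 zs hzs
      have h7 := hg _ _ h3 zs hzs le_rfl
      have h8 : ρ * Metric.infDist (P.apgEpoch x j (P.restartedAPG x i j)) (P.Omega x) ^ 2
          ≤ ρ * (Metric.infDist (P.restartedAPG x i j) (P.Omega x) ^ 2 / 2) := by linarith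
      have h9 := le_of_mul_le_mul_left h8 hρ
      calc (2 : ℝ) ^ (i + 1) * _ ≤ 2 ^ (i + 1)
            * (Metric.infDist (P.restartedAPG x i j) (P.Omega x) ^ 2 / 2) := by gcongr
        _ = 2 ^ i * Metric.infDist (P.restartedAPG x i j) (P.Omega x) ^ 2 := by ring
        _ ≤ _ := ih
  have hdom : P.restartedAPG x i j ∈ P.dualDom := by
    -- At least one loop must have run, as domain membership comes from its last proximal step.
    obtain ⟨k, rfl⟩ : ∃ k, i = k + 1 := ⟨i - 1, by omega⟩
    rw [restartedAPG_succ]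
    exact (S.epoch_gap x hj hlen hρ _).1
  refine S.crit_of_infDist hdom ?_
  have h1 : 2 ^ i * Metric.infDist (P.restartedAPG x i j) (P.Omega x) ^ 2 ≤ 2 ^ i * δ ^ 2 := by
    linarith [key i]
  exact le_of_sq_le_sq (le_of_mul_le_mul_left h1 (by positivity)) hδ.le

/-! ### Quadratic growth -/

omit S in
lemma Mt_injective (h : Function.Surjective P.M) : Function.Injective P.Mt := by
  rw [injective_iff_map_eq_zero]
  intro z hz
  obtain ⟨x, rfl⟩ := h z
  rw [← inner_self_eq_zero (𝕜 := ℝ), ← inner_Mt, hz, inner_zero_left]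

lemma Standing.lamMin_spec (h : Function.Surjective P.M) :
    0 < lamMin P.gram ∧ lamMin P.gram ≤ lamMax P.gram ∧
      ∀ u, lamMin P.gram * ‖u‖ ^ 2 ≤ ‖P.Mt u‖ ^ 2 := by
  have := S.nontrivial
  exact IPG.lamMin_spec (inner_gram (P := P)) (Mt_injective h)

lemma Standing.growth_strong (h : Function.Surjective P.M) (x : E d) (G : ℝ) :
    P.GrowthOn x P.muD G := by
  intro z hz zs hzs _
  refine le_trans ?_ (S.growth_Mt hzs hz)
  have h1 := (S.lamMin_spec h).2.2 (z - zs)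
  have hτ := S.tau_pos
  have h2 : Metric.infDist z (P.Omega x) ≤ ‖z - zs‖ := by
    rw [← dist_eq_norm]
    exact Metric.infDist_le_dist_of_mem hzs
  have h3 : Metric.infDist z (P.Omega x) ^ 2 ≤ ‖z - zs‖ ^ 2 := by
    have := Metric.infDist_nonneg (x := z) (s := P.Omega x)
    gcongr
  have h4 : P.muD / 2 = 1 / (2 * P.τ) * lamMin P.gram := by
    rw [muD]
    field_simp
  rw [h4, mul_assoc]
  gcongr
  refine le_trans ?_ h1
  have := (S.lamMin_spec h).1
  gcongr

section Polyhedral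

variable {m : ℕ} {C : E nbar →L[ℝ] E m} {c : E m}

omit S in
lemma Polyhedral.gbar_zero (h : P.Polyhedral C c) : P.gbar 0 = 0 := by
  obtain ⟨u, -, hu⟩ := (h 0).1
  rw [hu, inner_zero_right]

omit S in
-- Here ḡ is the support function of {Cu ≤ c}. If row i of C is violated by z, then along multiples
-- s · row the pairing with z exceeds ḡ by s(Cz - c)ᵢ, which is unbounded.
lemma Polyhedral.mem_conjDom_iff (h : P.Polyhedral C c) (z : E nbar) :
    z ∈ conjDom P.gbar ↔ ∀ i, C z i ≤ c i := by
  constructor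
  · intro hz i
    by_contra hcon
    push Not at hcon
    set row : E nbar := ContinuousLinearMap.adjoint C (EuclideanSpace.single i 1) with hrow
    have hin : ∀ u, ⟪u, row⟫_ℝ = C u i := by
      intro u
      rw [hrow, ContinuousLinearMap.adjoint_inner_right, EuclideanSpace.inner_single_right]
      simp
    have key : ∀ s : ℝ, 0 ≤ s → s * (C z i - c i) ≤ conjReal P.gbar z := by
      intro s hs
      have h1 := le_conjReal hz (s • row)
      obtain ⟨u, hu, hut⟩ := (h (s • row)).1
      rw [hut, real_inner_comm, inner_smul_right, inner_smul_right, hin, hin] at h1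
      nlinarith [hu i]
    have hpos : 0 < C z i - c i := by linarith
    have h1 := key ((|conjReal P.gbar z| + 1) / (C z i - c i)) (by positivity)
    rw [div_mul_cancel₀ _ hpos.ne'] at h1
    linarith [le_abs_self (conjReal P.gbar z)]
  · intro hz
    refine (mem_conjDom_of_le (t := 0) fun y => ?_).1
    have := (h y).2 ⟨z, hz, rfl⟩
    rw [real_inner_comm]
    linarith

omit S in
lemma Polyhedral.conjReal_eq_zero (h : P.Polyhedral C c) {z : E nbar} (hz : z ∈ conjDom P.gbar) :
    conjReal P.gbar z = 0 := by
  refine le_antisymm ?_ ?_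
  · refine (mem_conjDom_of_le (t := 0) fun y => ?_).2
    have := (h y).2 ⟨z, (h.mem_conjDom_iff z).1 hz, rfl⟩
    rw [real_inner_comm]
    linarith
  · have := le_conjReal hz 0
    rwa [h.gbar_zero, inner_zero_left, sub_zero] at this

omit S in
lemma Polyhedral.mem_dualDom_iff (h : P.Polyhedral C c) (z : Dual nbar n) :
    z ∈ P.dualDom ↔ ∀ i, ineqOp (n := n) C z i ≤ c i :=
  h.mem_conjDom_iff z.fst

omit S in
lemma Polyhedral.dualLin_eq (h : P.Polyhedral C c) {z : Dual nbar n} (hz : z ∈ P.dualDom) :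
    P.dualLin z = -⟪z, P.beta⟫_ℝ := by
  rw [dualLin, h.conjReal_eq_zero hz, zero_sub]

lemma Standing.thetaHom_pos : 0 < P.thetaHom C := by
  obtain ⟨u, hu⟩ : ∃ u, P.Mt u ≠ 0 := by
    by_contra hcon
    push Not at hcon
    have : P.Mt = 0 := ContinuousLinearMap.ext hcon
    have h2 := S.norm_M_pos
    rw [← norm_Mt, this, norm_zero] at h2
    exact lt_irrefl _ h2
  exact hoffman_pos _ _ hu

omit S in
lemma eqOp_fst (z : Dual nbar n) : (P.eqOp z).fst = P.Mt z := rfl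

omit S in
lemma eqOp_snd (z : Dual nbar n) : (P.eqOp z).snd = -⟪z, P.beta⟫_ℝ := by
  rw [real_inner_comm]
  rfl

omit S in
lemma norm_eqOp_sub_sq (z w : Dual nbar n) : ‖P.eqOp z - P.eqOp w‖ ^ 2
    = ‖P.Mt (z - w)‖ ^ 2 + ⟪z - w, P.beta⟫_ℝ ^ 2 := by
  rw [← map_sub, WithLp.prod_norm_sq_eq_of_L2, eqOp_fst, eqOp_snd, norm_neg, Real.norm_eq_abs,
    sq_abs]

lemma Standing.thetaFull_pos : 0 < P.thetaFull C := by
  obtain ⟨u, hu⟩ : ∃ u, P.Mt u ≠ 0 := by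
    by_contra hcon
    push Not at hcon
    have : P.Mt = 0 := ContinuousLinearMap.ext hcon
    have h2 := S.norm_M_pos
    rw [← norm_Mt, this, norm_zero] at h2
    exact lt_irrefl _ h2
  refine hoffman_pos (u := u) _ _ fun h => hu ?_
  rw [← eqOp_fst, h]
  rfl

/-- On the polyhedral domain D_k depends on z only through `eqOp`, so every solution of the linear
system through zs is again a minimizer. Hoffman's bound applies to that system, and z has no
inequality residual. -/
lemma Standing.infDist_Omega_le (h : P.Polyhedral C c) {x : E d} {z zs : Dual nbar n}
    (hz : z ∈ P.dualDom) (hzs : zs ∈ P.Omega x) :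
    Metric.infDist z (P.Omega x) ≤ P.thetaFull C * ‖P.eqOp z - P.eqOp zs‖ := by
  obtain ⟨h1, h2⟩ := S.mem_Omega_iff.1 hzs
  have hne : zs ∈ linSol P.eqOp (ineqOp (n := n) C) (P.eqOp zs) c :=
    ⟨rfl, (h.mem_dualDom_iff zs).1 h1⟩
  refine le_trans (Metric.infDist_le_infDist_of_subset ?_ ⟨zs, hne⟩)
    (infDist_le_hoffman_of_feasible P.eqOp (ineqOp (n := n) C) (P.eqOp zs) c ⟨zs, hne⟩ z
      ((h.mem_dualDom_iff z).1 hz))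
  rintro w ⟨hw1, hw2⟩
  have hw := (h.mem_dualDom_iff w).2 hw2
  have e1 : P.Mt w = P.Mt zs := by rw [← eqOp_fst, hw1, eqOp_fst]
  have e2 : ⟪w, P.beta⟫_ℝ = ⟪zs, P.beta⟫_ℝ := by
    have : (P.eqOp w).snd = (P.eqOp zs).snd := by rw [hw1]
    rw [eqOp_snd, eqOp_snd] at this
    linarith
  refine S.mem_Omega_iff.2 ⟨hw, fun y hy => ?_⟩
  have : P.dualReal x w = P.dualReal x zs := by
    rw [dualReal, dualReal, h.dualLin_eq hw, h.dualLin_eq h1, e2, resid_eq, resid_eq, e1]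
  rw [this]
  exact h2 y hy

lemma Standing.infDist_Omega_le_hom (h : P.Polyhedral C c) (hβ : P.beta = 0) {x : E d}
    {z zs : Dual nbar n} (hz : z ∈ P.dualDom) (hzs : zs ∈ P.Omega x) :
    Metric.infDist z (P.Omega x) ≤ P.thetaHom C * ‖P.Mt (z - zs)‖ := by
  obtain ⟨h1, h2⟩ := S.mem_Omega_iff.1 hzs
  have hne : zs ∈ linSol P.Mt (ineqOp (n := n) C) (P.Mt zs) c :=
    ⟨rfl, (h.mem_dualDom_iff zs).1 h1⟩
  rw [map_sub]
  refine le_trans (Metric.infDist_le_infDist_of_subset ?_ ⟨zs, hne⟩)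
    (infDist_le_hoffman_of_feasible P.Mt (ineqOp (n := n) C) (P.Mt zs) c ⟨zs, hne⟩ z
      ((h.mem_dualDom_iff z).1 hz))
  rintro w ⟨hw1, hw2⟩
  have hw := (h.mem_dualDom_iff w).2 hw2
  refine S.mem_Omega_iff.2 ⟨hw, fun y hy => ?_⟩
  have : P.dualReal x w = P.dualReal x zs := by
    rw [dualReal, dualReal, h.dualLin_eq hw, h.dualLin_eq h1, hβ, inner_zero_right,
      inner_zero_right, resid_eq, resid_eq, hw1]
  rw [this]
  exact h2 y hy

lemma Standing.growth_hom (h : P.Polyhedral C c) (hβ : P.beta = 0) (x : E d) (G : ℝ) :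
    P.GrowthOn x (1 / (P.thetaHom C ^ 2 * P.τ)) G := by
  intro z hz zs hzs _
  refine le_trans ?_ (S.growth_Mt hzs hz)
  have hτ := S.tau_pos
  have hθ := S.thetaHom_pos (C := C)
  have h1 := S.infDist_Omega_le_hom h hβ hz hzs
  have h2 : Metric.infDist z (P.Omega x) ^ 2 ≤ (P.thetaHom C * ‖P.Mt (z - zs)‖) ^ 2 := by
    have := Metric.infDist_nonneg (x := z) (s := P.Omega x)
    gcongr
  calc 1 / (P.thetaHom C ^ 2 * P.τ) / 2 * Metric.infDist z (P.Omega x) ^ 2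
      ≤ 1 / (P.thetaHom C ^ 2 * P.τ) / 2 * (P.thetaHom C * ‖P.Mt (z - zs)‖) ^ 2 := by gcongr
    _ = 1 / (2 * P.τ) * ‖P.Mt (z - zs)‖ ^ 2 := by field_simp

/-- Write the gap as g = H + a²/(2τ), with H ≥ 0 the first-order term and a = ‖Mᵀ(z - zs)‖. Up to
sign the linear term changes by H - q/τ, where q pairs ν with Mᵀ(z - zs). Then a² ≤ 2τg, H² ≤ gG and
(q/τ)² ≤ 2‖ν‖²g/τ bound the squared Hoffman residual by 2g(τ + G + 2‖ν‖²/τ). -/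
lemma Standing.growth_full (h : P.Polyhedral C c) (x : E d) {G : ℝ} (hG : 0 ≤ G) :
    P.GrowthOn x (1 / (P.thetaFull C ^ 2 * (P.τ + G + 2 * ‖P.nu x‖ ^ 2 / P.τ))) G := by
  intro z hz zs hzs hle
  have hτ := S.tau_pos
  have hθ := S.thetaFull_pos (C := C)
  have hzsd := (S.mem_Omega_iff.1 hzs).1
  have h1 := S.infDist_Omega_le h hz hzs
  rw [S.nu_eq hzs]
  set g := P.dualReal x z - P.dualReal x zs with hg
  set H := P.dualLin z - P.dualLin zs + 1 / P.τ * ⟪P.resid x zs, P.Mt (z - zs)⟫_ℝ with hH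
  have hH0 : 0 ≤ H := S.firstOrder hzs hz
  have hgH : g = H + 1 / (2 * P.τ) * ‖P.Mt (z - zs)‖ ^ 2 := dualReal_sub S x zs z
  set a := ‖P.Mt (z - zs)‖ with ha
  set ν := ‖P.resid x zs‖ with hν
  have hβ : ⟪z - zs, P.beta⟫_ℝ = -(H - 1 / P.τ * ⟪P.resid x zs, P.Mt (z - zs)⟫_ℝ) := by
    rw [hH, h.dualLin_eq hz, h.dualLin_eq hzsd, inner_sub_left]
    ring
  have hcs : ⟪P.resid x zs, P.Mt (z - zs)⟫_ℝ ^ 2 ≤ ν ^ 2 * a ^ 2 := by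
    rw [← mul_pow, ← sq_abs]
    gcongr
    exact abs_real_inner_le_norm _ _
  set q := ⟪P.resid x zs, P.Mt (z - zs)⟫_ℝ with hq
  have ha2 : a ^ 2 = 2 * P.τ * (g - H) := by
    rw [hgH]
    field_simp
    ring
  have hHg : H ≤ g := by
    have : 0 ≤ 1 / (2 * P.τ) * a ^ 2 := by positivity
    linarith
  have h2 : a ^ 2 + ⟪z - zs, P.beta⟫_ℝ ^ 2 ≤ 2 * g * (P.τ + G + 2 * ν ^ 2 / P.τ) := by
    have e1 : ⟪z - zs, P.beta⟫_ℝ ^ 2 ≤ 2 * H ^ 2 + 2 * (1 / P.τ * q) ^ 2 := by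
      rw [hβ]
      nlinarith [sq_nonneg (H + 1 / P.τ * q)]
    have e2 : (1 / P.τ * q) ^ 2 ≤ 2 * ν ^ 2 / P.τ * g := by
      calc (1 / P.τ * q) ^ 2 = (1 / P.τ) ^ 2 * q ^ 2 := by ring
        _ ≤ (1 / P.τ) ^ 2 * (ν ^ 2 * a ^ 2) := by gcongr
        _ = 2 * ν ^ 2 / P.τ * (g - H) := by
          rw [ha2]
          field_simp
        _ ≤ 2 * ν ^ 2 / P.τ * g := by
          gcongr
          linarith
    have e3 : H ^ 2 ≤ g * G := by nlinarith
    have e4 : a ^ 2 ≤ 2 * P.τ * g := by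
      rw [ha2]
      gcongr
      linarith
    nlinarith
  have h3 : Metric.infDist z (P.Omega x) ^ 2
      ≤ P.thetaFull C ^ 2 * (2 * g * (P.τ + G + 2 * ν ^ 2 / P.τ)) := by
    calc Metric.infDist z (P.Omega x) ^ 2 ≤ (P.thetaFull C * ‖P.eqOp z - P.eqOp zs‖) ^ 2 := by
          have := Metric.infDist_nonneg (x := z) (s := P.Omega x)
          gcongr
      _ = P.thetaFull C ^ 2 * (a ^ 2 + ⟪z - zs, P.beta⟫_ℝ ^ 2) := by
          rw [mul_pow, norm_eqOp_sub_sq]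
      _ ≤ _ := by gcongr
  have hpos : 0 < P.τ + G + 2 * ν ^ 2 / P.τ := by positivity
  calc 1 / (P.thetaFull C ^ 2 * (P.τ + G + 2 * ν ^ 2 / P.τ)) / 2
        * Metric.infDist z (P.Omega x) ^ 2
      ≤ 1 / (P.thetaFull C ^ 2 * (P.τ + G + 2 * ν ^ 2 / P.τ)) / 2
        * (P.thetaFull C ^ 2 * (2 * g * (P.τ + G + 2 * ν ^ 2 / P.τ))) := by gcongr
    _ = g := by field_simp

/-- The homogeneous Hoffman constant of the dual system is at least `1 / ‖M‖`. -/
lemma Standing.one_le_thetaHom_mul : 1 ≤ P.thetaHom C * ‖P.M‖ := by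
  obtain ⟨x, hx⟩ : ∃ x, P.M x ≠ 0 := by
    by_contra hcon
    push Not at hcon
    exact S.M_ne_zero (ContinuousLinearMap.ext hcon)
  set u := P.M x with hu
  set e : E m := WithLp.toLp 2 fun i => |ineqOp (n := n) C u i| with he
  have h0 : (0 : Dual nbar n) ∈ linSol P.Mt (ineqOp (n := n) C) 0 e :=
    ⟨map_zero _, fun i => by simp [he]⟩
  have h1 := infDist_le_hoffman_of_feasible P.Mt (ineqOp (n := n) C) 0 e ⟨0, h0⟩ u fun i => by
    simpa [he] using le_abs_self (ineqOp (n := n) C u i)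
  -- The vector u is in the range of M, hence orthogonal to the kernel of Mᵀ, which contains the
  -- whole solution set.
  have h2 : ‖u‖ ≤ Metric.infDist u (linSol P.Mt (ineqOp (n := n) C) 0 e) := by
    refine (Metric.le_infDist ⟨0, h0⟩).2 fun w hw => ?_
    have hin : ⟪u, w⟫_ℝ = 0 := by
      rw [hu, real_inner_comm, ← inner_Mt, hw.1, inner_zero_left]
    rw [dist_eq_norm]
    refine le_of_sq_le_sq ?_ (norm_nonneg _)
    rw [norm_sub_sq_real, hin]
    linarith [sq_nonneg ‖w‖]
  have h3 : ‖u‖ * 1 ≤ ‖u‖ * (P.thetaHom C * ‖P.M‖) := by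
    rw [sub_zero] at h1
    calc ‖u‖ * 1 ≤ P.thetaHom C * ‖P.Mt u‖ := by
          rw [mul_one]
          exact h2.trans h1
      _ ≤ P.thetaHom C * (‖P.M‖ * ‖u‖) := by
          have := S.thetaHom_pos (C := C)
          gcongr
          exact norm_Mt_le u
      _ = _ := by ring
  exact le_of_mul_le_mul_left h3 (norm_pos_iff.2 hx)

omit S in
-- For β = 0 the extra equation is 0 = s, so each homogeneous system is a full system with s = 0.
-- This lets (c) cover the branch of `rho` that uses `thetaHom`.
lemma thetaHom_le_thetaFull (hβ : P.beta = 0) : P.thetaHom C ≤ P.thetaFull C := by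
  refine csInf_le ⟨0, fun _ h => h.1⟩ ⟨hoffman_nonneg _ _, fun r e hne z => ?_⟩
  have heq : linSol P.eqOp (ineqOp (n := n) C) (WithLp.toLp 2 (r, 0)) e
      = linSol P.Mt (ineqOp (n := n) C) r e := by
    ext w
    have : P.eqOp w = WithLp.toLp 2 (r, 0) ↔ P.Mt w = r := by
      constructor
      · intro h
        rw [← eqOp_fst, h, WithLp.toLp_fst]
      · intro h
        have h1 := eqOp_fst (P := P) w
        have h2 := eqOp_snd (P := P) w
        rw [hβ, inner_zero_right, neg_zero] at h2
        rw [h] at h1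
        exact congrArg (WithLp.toLp 2) (Prod.ext h1 h2)
    simp only [linSol, Set.mem_ofPred_eq, this]
  have h := infDist_le_hoffman P.eqOp (ineqOp (n := n) C) (WithLp.toLp 2 (r, 0)) e
    (by rwa [heq]) z
  rw [heq] at h
  have hn : ‖P.eqOp z - WithLp.toLp 2 (r, 0)‖ ^ 2 = ‖P.Mt z - r‖ ^ 2 := by
    rw [WithLp.prod_norm_sq_eq_of_L2, WithLp.sub_fst, WithLp.sub_snd, eqOp_fst, eqOp_snd, hβ]
    simp
  rw [hn] at h
  exact h

end Polyhedral

end Standing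

end Data

end IPG

/-! ### Inequalities among the constants B₁, …, B₄. -/

namespace IPG

namespace Data

variable {d n nbar : ℕ} {P : Data d n nbar}

lemma B₁_nonneg (hτ : 0 < P.τ) (hσ : 0 < P.σ) : 0 < P.B₁ := by
  rw [B₁]
  positivity

section Standing

variable (S : P.Standing)
include S

lemma Standing.B₁_pos : 0 < P.B₁ := B₁_nonneg S.tau_pos S.σ_pos

lemma Standing.B₂_nonneg : 0 ≤ P.B₂ := by
  have h1 := S.lf_nonneg
  have h2 := S.lg_nonneg
  rw [B₂]
  positivity

omit S in
lemma one_le_B₃ : 1 ≤ P.B₃ := by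
  have : 0 ≤ ‖P.AAtInvA‖ * ‖P.M‖ := by positivity
  rw [B₃]
  linarith

lemma Standing.lf_le_B₄ : 1 / P.τ * P.lf ≤ P.B₄ := by
  have h1 := S.tau_pos
  have h2 := S.lg_nonneg
  have h3 := S.B₂_nonneg
  rw [B₄]
  have : 0 ≤ ‖P.M‖ * (P.lg + P.B₂) := by positivity
  gcongr
  linarith

lemma Standing.B₄_nonneg : 0 ≤ P.B₄ := by
  have h1 := S.tau_pos
  have h2 := S.lf_nonneg
  exact le_trans (by positivity) S.lf_le_B₄

lemma Standing.norm_A_le_B₁ : 1 / P.τ * ‖P.A‖ * ‖P.M‖ ≤ P.B₁ := by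
  have h1 := S.tau_pos
  have h2 := S.σ_pos
  have h3 : 0 ≤ 1 / P.τ * ‖P.Abar‖ * ‖P.M‖ := by positivity
  have h4 : 0 ≤ 1 / P.σ := by positivity
  rw [B₁, mul_add, add_mul]
  linarith

lemma Standing.norm_Abar_le_B₁ : 1 / P.τ * ‖P.Abar‖ * ‖P.M‖ ≤ P.B₁ := by
  have h1 := S.tau_pos
  have h2 := S.σ_pos
  have h3 : 0 ≤ 1 / P.τ * (‖P.Abar‖ + ‖P.A‖) * ‖P.M‖ := by positivity
  have h4 : 0 ≤ 1 / P.σ := by positivity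
  rw [B₁]
  linarith

lemma Standing.one_div_σ_le_B₁ : 1 / P.σ ≤ P.B₁ := by
  have h1 := S.tau_pos
  have h3 : 0 ≤ 1 / P.τ * ‖P.Abar‖ * ‖P.M‖ := by positivity
  have h4 : 0 ≤ 1 / P.τ * (‖P.Abar‖ + ‖P.A‖) * ‖P.M‖ := by positivity
  rw [B₁]
  linarith

/-- A nonzero A has (AAᵀ)⁻¹AAᵀ = 1 on a nonzero space. The dichotomy serves to estimate ‖M‖ by the
constants B_i: a nonzero A permits a factor ‖(AAᵀ)⁻¹A‖‖A‖ ≥ 1, and for A = 0 the norm of M is at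
most that of Ā. -/
lemma Standing.A_zero_or : ‖P.A‖ = 0 ∨ 1 ≤ ‖P.AAtInvA‖ * ‖P.A‖ := by
  by_cases hA : P.A = 0
  · left; rw [hA, norm_zero]
  right
  obtain ⟨x, hx⟩ : ∃ x, P.A x ≠ 0 := by
    by_contra hcon
    push Not at hcon
    exact hA (ContinuousLinearMap.ext hcon)
  have hpos : 0 < ‖P.A x‖ := norm_pos_iff.2 hx
  have h : 1 * ‖P.A x‖ ≤ ‖P.AAtInvA‖ * ‖P.A‖ * ‖P.A x‖ := by
    calc 1 * ‖P.A x‖ = ‖P.AAtInvA (ContinuousLinearMap.adjoint P.A (P.A x))‖ := by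
          rw [S.AAtInvA_adjoint, one_mul]
      _ ≤ ‖P.AAtInvA‖ * ‖ContinuousLinearMap.adjoint P.A (P.A x)‖ := P.AAtInvA.le_opNorm _
      _ ≤ ‖P.AAtInvA‖ * (‖P.A‖ * ‖P.A x‖) := by
          gcongr
          refine (ContinuousLinearMap.le_opNorm _ _).trans_eq ?_
          rw [LinearIsometryEquiv.norm_map]
      _ = _ := by ring
  exact le_of_mul_le_mul_right h hpos

/-- The change of f₀ caused by dual inexactness has no visible counterpart in δ_ε; this shows that
the third term of δ_ε covers it. -/
lemma Standing.lf_mul_le : P.lf * (1 / P.τ * ‖P.M‖) ≤ P.B₁ * (P.B₂ + P.σ * ‖P.Abar‖ * P.B₄) := by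
  have hτ := S.tau_pos
  have hσ := S.σ_pos
  have hlf := S.lf_nonneg
  have hlg := S.lg_nonneg
  have hB₁ := S.B₁_pos
  have hB₂ := S.B₂_nonneg
  have hB₄ := S.B₄_nonneg
  rcases S.A_zero_or with h | h
  · have h1 : ‖P.M‖ ≤ ‖P.Abar‖ := by
      have := norm_M_le (P := P)
      rwa [h, add_zero] at this
    calc P.lf * (1 / P.τ * ‖P.M‖) ≤ P.lf * (1 / P.τ * ‖P.Abar‖) := by gcongr
      _ = 1 / P.σ * (P.σ * ‖P.Abar‖ * (1 / P.τ * P.lf)) := by field_simp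
      _ ≤ P.B₁ * (P.σ * ‖P.Abar‖ * P.B₄) := by
        gcongr
        · exact S.one_div_σ_le_B₁
        · exact S.lf_le_B₄
      _ ≤ _ := by
        gcongr
        linarith
  · calc P.lf * (1 / P.τ * ‖P.M‖) ≤ P.lf * (1 / P.τ * ‖P.M‖) * (‖P.AAtInvA‖ * ‖P.A‖) :=
          le_mul_of_one_le_right (by positivity) h
      _ = (1 / P.τ * ‖P.A‖ * ‖P.M‖) * (‖P.AAtInvA‖ * P.lf) := by ring
      _ ≤ P.B₁ * P.B₂ := by
        rw [B₂]
        gcongr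
        · exact S.norm_A_le_B₁
        · have : 0 ≤ ‖P.Abar‖ * P.lg := by positivity
          linarith
      _ ≤ _ := by
        gcongr
        have : 0 ≤ P.σ * ‖P.Abar‖ * P.B₄ := by positivity
        linarith

lemma Standing.norm_M_sq_le :
    ‖P.M‖ ^ 2 ≤ P.τ * (P.B₁ * P.B₃ * (1 + 1 / P.τ * P.σ * ‖P.Abar‖ * ‖P.M‖)) := by
  have hτ := S.tau_pos
  have hσ := S.σ_pos
  have hB₁ := S.B₁_pos
  have hB₃ := one_le_B₃ (P := P)
  have hX : 0 ≤ 1 / P.τ * P.σ * ‖P.Abar‖ * ‖P.M‖ := by positivity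
  rcases S.A_zero_or with h | h
  · have h1 : ‖P.M‖ ≤ ‖P.Abar‖ := by
      have := norm_M_le (P := P)
      rwa [h, add_zero] at this
    calc ‖P.M‖ ^ 2 = ‖P.M‖ * ‖P.M‖ := sq _
      _ ≤ ‖P.Abar‖ * ‖P.M‖ := by gcongr
      _ = P.τ * (1 / P.σ * 1 * (1 / P.τ * P.σ * ‖P.Abar‖ * ‖P.M‖)) := by field_simp
      _ ≤ _ := by
        gcongr
        · exact S.one_div_σ_le_B₁
        · linarith
  · calc ‖P.M‖ ^ 2 ≤ ‖P.M‖ ^ 2 * (‖P.AAtInvA‖ * ‖P.A‖) :=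
          le_mul_of_one_le_right (by positivity) h
      _ = P.τ * ((1 / P.τ * ‖P.A‖ * ‖P.M‖) * (‖P.AAtInvA‖ * ‖P.M‖) * 1) := by field_simp
      _ ≤ _ := by
        gcongr
        · exact S.norm_A_le_B₁
        · rw [B₃]; linarith
        · linarith

/-! ### The accuracy `δ_ε` -/

/-- The constant `B₂ + σ ‖Ā‖ B₄ + l_g` in the third term of `δ_ε`. -/
def Bsum (P : Data d n nbar) : ℝ := P.B₂ + P.σ * ‖P.Abar‖ * P.B₄ + P.lg

lemma Standing.Bsum_nonneg : 0 ≤ P.Bsum := by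
  have h1 := S.B₂_nonneg
  have h2 := S.B₄_nonneg
  have h3 := S.lg_nonneg
  have h4 := S.σ_pos
  rw [Bsum]
  positivity

lemma Standing.DeltaF_nonneg : 0 ≤ P.DeltaF := by
  have := csInf_le S.F_bddBelow ⟨(P.x₀, P.y₀), rfl⟩
  rw [DeltaF]
  linarith

/-- The third term of `δ_ε` degenerates only when `F` is constant. -/
lemma Standing.Bsum_pos (hΔ : P.DeltaF ≠ 0) : 0 < P.Bsum := by
  rcases S.Bsum_nonneg.lt_or_eq with h | h
  · exact h
  exfalso
  have hB₁ := S.B₁_pos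
  have hB₂ := S.B₂_nonneg
  have hB₄ := S.B₄_nonneg
  have hσ := S.σ_pos
  have hτ := S.tau_pos
  have h1 : 0 ≤ P.σ * ‖P.Abar‖ * P.B₄ := by positivity
  have hlg : P.lg = 0 := by
    have := S.lg_nonneg
    rw [Bsum] at h
    linarith
  have h2 : P.B₂ + P.σ * ‖P.Abar‖ * P.B₄ = 0 := by
    rw [Bsum] at h
    linarith
  have hlf : P.lf = 0 := by
    have h3 := S.lf_mul_le
    rw [h2, mul_zero] at h3
    have h4 : 0 < 1 / P.τ * ‖P.M‖ := by
      have := S.norm_M_pos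
      positivity
    have := S.lf_nonneg
    by_contra hne
    have : 0 < P.lf := lt_of_le_of_ne this (Ne.symm hne)
    have := mul_pos this h4
    linarith
  have hF : ∀ p, P.F p = P.F (P.x₀, P.y₀) := by
    rintro ⟨x, y⟩
    have h3 := S.f_lip x P.x₀
    have h4 := S.g_lip y P.y₀
    rw [hlf, zero_mul] at h3
    rw [hlg, zero_mul] at h4
    have h5 := abs_eq_zero.1 (le_antisymm h3 (abs_nonneg _))
    have h6 := abs_eq_zero.1 (le_antisymm h4 (abs_nonneg _))
    simp only [F]
    linarith
  have hr : Set.range P.F = {P.F (P.x₀, P.y₀)} := by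
    ext t
    constructor
    · rintro ⟨p, rfl⟩
      exact hF p
    · rintro rfl
      exact ⟨_, rfl⟩
  refine hΔ ?_
  rw [DeltaF, hr, csInf_singleton, sub_self]

variable {ε : ℝ} (hε : 0 < ε)
include hε

/-- When `Bsum` is 0 the third quotient is a division by zero with value 0, and so is δ_ε; Δ_F ≠ 0
excludes this. -/
lemma Standing.deltaEps_pos (hΔ : P.DeltaF ≠ 0) : 0 < P.deltaEps ε := by
  have h1 := S.B₁_pos
  have h2 := S.σ_pos
  have h3 := S.Bsum_pos hΔ
  rw [Bsum] at h3
  have h4 := one_le_B₃ (P := P)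
  have h5 := S.Lf_pos
  have h6 := S.tau_pos
  have h7 : 0 < P.B₃ := by linarith
  rw [deltaEps]
  refine lt_min (lt_min ?_ ?_) (lt_min ?_ (Real.sqrt_pos.2 ?_)) <;> positivity

lemma Standing.deltaEps_nonneg : 0 ≤ P.deltaEps ε := by
  have h1 := S.B₁_pos
  have h2 := S.σ_pos
  have h3 := S.Bsum_nonneg
  rw [Bsum] at h3
  have h5 := S.Lf_pos
  rw [deltaEps]
  refine le_min (le_min ?_ ?_) (le_min ?_ (Real.sqrt_nonneg _)) <;> positivity

omit hε in
lemma Standing.deltaEps_le₁ : P.σ * (P.B₁ * P.deltaEps ε) ≤ ε := by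
  have h1 := S.B₁_pos
  have h2 := S.σ_pos
  have h : P.deltaEps ε ≤ ε / (P.B₁ * P.σ) := (min_le_left _ _).trans (min_le_left _ _)
  rw [le_div_iff₀ (by positivity)] at h
  linarith

omit hε in
lemma Standing.deltaEps_le₂ : P.B₁ * P.deltaEps ε ≤ ε := by
  have h1 := S.B₁_pos
  have h : P.deltaEps ε ≤ ε / P.B₁ := (min_le_left _ _).trans (min_le_right _ _)
  rw [le_div_iff₀ (by positivity)] at h
  linarith

lemma Standing.deltaEps_le₃ : P.B₁ * P.deltaEps ε * P.Bsum ≤ ε ^ 2 / (48 * P.Lf) := by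
  have h1 := S.B₁_pos
  have h2 := S.Lf_pos
  rcases S.Bsum_nonneg.lt_or_eq with h0 | h0
  · have h : P.deltaEps ε ≤ ε ^ 2 / (48 * P.Lf * P.B₁ * P.Bsum) :=
      (min_le_right _ _).trans (min_le_left _ _)
    rw [le_div_iff₀ (by positivity)] at h ⊢
    linarith
  · rw [← h0, mul_zero]
    positivity

lemma Standing.deltaEps_le₄ : 48 * P.Lf * (P.B₁ * P.B₃ * (1 + 1 / P.τ * P.σ * ‖P.Abar‖ * ‖P.M‖))
    * P.deltaEps ε ^ 2 ≤ ε ^ 2 := by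
  have h1 := S.B₁_pos
  have h2 := S.Lf_pos
  have h3 := one_le_B₃ (P := P)
  have h4 : 0 < P.B₃ := by linarith
  have h5 := S.tau_pos
  have h6 := S.σ_pos
  have h : P.deltaEps ε ≤ Real.sqrt (ε ^ 2 /
        (48 * P.Lf * P.B₁ * P.B₃ * (1 + 1 / P.τ * P.σ * ‖P.Abar‖ * ‖P.M‖))) :=
    (min_le_right _ _).trans (min_le_right _ _)
  have h7 : P.deltaEps ε ^ 2 ≤ ε ^ 2 /
        (48 * P.Lf * P.B₁ * P.B₃ * (1 + 1 / P.τ * P.σ * ‖P.Abar‖ * ‖P.M‖)) := by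
    have := S.deltaEps_nonneg hε
    rw [← Real.sq_sqrt (show 0 ≤ ε ^ 2 /
        (48 * P.Lf * P.B₁ * P.B₃ * (1 + 1 / P.τ * P.σ * ‖P.Abar‖ * ‖P.M‖)) by positivity)]
    gcongr
  rw [le_div_iff₀ (by positivity)] at h7
  linarith

/-- The fourth term of δ_ε gives 24‖M‖²δ² ≤ ε², and 5/24 is a rational upper bound for 1/√24. -/
lemma Standing.norm_M_mul_deltaEps_le : ‖P.M‖ * P.deltaEps ε ≤ 5 / 24 * ε := by
  have h1 := S.deltaEps_le₄ hε
  have h2 := S.norm_M_sq_le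
  have h3 : 24 * ‖P.M‖ ^ 2 * P.deltaEps ε ^ 2 ≤ ε ^ 2 := by
    refine le_trans ?_ h1
    rw [τ] at h2
    rw [τ]
    have := sq_nonneg (P.deltaEps ε)
    nlinarith
  refine le_of_sq_le_sq ?_ (by positivity)
  nlinarith [sq_nonneg ε]

/-- The error terms of one inexact step. -/
lemma Standing.error_le :
    (P.B₂ + P.B₃ * P.deltaEps ε) * (‖P.A‖ * (1 / P.τ * ‖P.M‖ * P.deltaEps ε))
      + (P.lf + P.lg * ‖P.Abar‖) * (1 / P.τ * ‖P.M‖ * P.deltaEps ε) ≤ ε ^ 2 / (16 * P.Lf) := by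
  have hδ := S.deltaEps_nonneg hε
  have h3 := S.deltaEps_le₃ hε
  have h4 := S.deltaEps_le₄ hε
  have hL := S.Lf_pos
  have hτ := S.tau_pos
  have hσ := S.σ_pos
  have hB₁ := S.B₁_pos
  have hB₂ := S.B₂_nonneg
  have hB₃ := one_le_B₃ (P := P)
  have hB₄ := S.B₄_nonneg
  have hlg := S.lg_nonneg
  set δ := P.deltaEps ε
  -- The error splits into three parts of at most ε²/(48 L_f) each: infeasibility with ḡ, the change
  -- of f₀, and the part quadratic in δ.
  have e1 : P.B₂ * (‖P.A‖ * (1 / P.τ * ‖P.M‖ * δ)) + P.lg * ‖P.Abar‖ * (1 / P.τ * ‖P.M‖ * δ)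
      ≤ P.B₁ * δ * P.Bsum := by
    calc P.B₂ * (‖P.A‖ * (1 / P.τ * ‖P.M‖ * δ)) + P.lg * ‖P.Abar‖ * (1 / P.τ * ‖P.M‖ * δ)
        = (1 / P.τ * ‖P.A‖ * ‖P.M‖) * (δ * P.B₂) + (1 / P.τ * ‖P.Abar‖ * ‖P.M‖) * (δ * P.lg) := by
          ring
      _ ≤ P.B₁ * (δ * P.B₂) + P.B₁ * (δ * P.lg) := by
          gcongr
          · exact S.norm_A_le_B₁
          · exact S.norm_Abar_le_B₁
      _ = P.B₁ * δ * (P.B₂ + 0 + P.lg) := by ring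
      _ ≤ P.B₁ * δ * P.Bsum := by
          rw [Bsum]
          gcongr
          positivity
  have e2 : P.lf * (1 / P.τ * ‖P.M‖ * δ) ≤ P.B₁ * δ * P.Bsum := by
    calc P.lf * (1 / P.τ * ‖P.M‖ * δ) = P.lf * (1 / P.τ * ‖P.M‖) * δ := by ring
      _ ≤ P.B₁ * (P.B₂ + P.σ * ‖P.Abar‖ * P.B₄) * δ := mul_le_mul_of_nonneg_right S.lf_mul_le hδ
      _ = P.B₁ * δ * (P.B₂ + P.σ * ‖P.Abar‖ * P.B₄) := by ring
      _ ≤ _ := by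
          refine mul_le_mul_of_nonneg_left ?_ (by positivity)
          rw [Bsum]
          linarith
  have e3 : P.B₃ * δ * (‖P.A‖ * (1 / P.τ * ‖P.M‖ * δ)) ≤ ε ^ 2 / (48 * P.Lf) := by
    rw [le_div_iff₀ (by positivity)]
    refine le_trans ?_ h4
    have hX : 0 ≤ 1 / P.τ * P.σ * ‖P.Abar‖ * ‖P.M‖ := by positivity
    calc P.B₃ * δ * (‖P.A‖ * (1 / P.τ * ‖P.M‖ * δ)) * (48 * P.Lf)
        = 48 * P.Lf * ((1 / P.τ * ‖P.A‖ * ‖P.M‖) * P.B₃ * 1) * δ ^ 2 := by ring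
      _ ≤ _ := by
        gcongr
        · exact S.norm_A_le_B₁
        · linarith
  have e4 : ε ^ 2 / (16 * P.Lf) = 3 * (ε ^ 2 / (48 * P.Lf)) := by
    field_simp
    norm_num
  rw [e4]
  linarith

end Standing

/-! ### One inexact step -/

section Step

variable (S : P.Standing)
include S

/-- The descent lemma for `f₀`. -/
lemma Standing.descent (x x' : E d) :
    P.f₀ x' ≤ P.f₀ x + ⟪gradient P.f₀ x, x' - x⟫_ℝ + P.Lf / 2 * ‖x' - x‖ ^ 2 := by
  set v := x' - x with hv
  have hder : ∀ t : ℝ, HasDerivAt (fun t : ℝ => P.f₀ (x + t • v) - t * ⟪gradient P.f₀ x, v⟫_ℝ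
      - P.Lf / 2 * t ^ 2 * ‖v‖ ^ 2)
      (⟪gradient P.f₀ (x + t • v), v⟫_ℝ - ⟪gradient P.f₀ x, v⟫_ℝ - P.Lf * t * ‖v‖ ^ 2) t := by
    intro t
    have h1 : HasDerivAt (fun t : ℝ => x + t • v) v t := by
      simpa using ((hasDerivAt_id t).smul_const v).const_add x
    have h2 : HasDerivAt (fun t : ℝ => P.f₀ (x + t • v)) ⟪gradient P.f₀ (x + t • v), v⟫_ℝ t := by
      have h3 := (S.diff (x + t • v)).hasGradientAt.hasFDerivAt.comp_hasDerivAt t h1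
      rwa [InnerProductSpace.toDual_apply_apply] at h3
    have h4 : HasDerivAt (fun t : ℝ => t * ⟪gradient P.f₀ x, v⟫_ℝ) ⟪gradient P.f₀ x, v⟫_ℝ t := by
      simpa using (hasDerivAt_id t).mul_const ⟪gradient P.f₀ x, v⟫_ℝ
    have h5 : HasDerivAt (fun t : ℝ => P.Lf / 2 * t ^ 2 * ‖v‖ ^ 2) (P.Lf * t * ‖v‖ ^ 2) t := by
      refine (((hasDerivAt_pow 2 t).const_mul (P.Lf / 2)).mul_const (‖v‖ ^ 2)).congr_deriv ?_
      rw [show 2 - 1 = 1 from rfl, pow_one]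
      push_cast
      ring
    exact (h2.sub h4).sub h5
  have hanti : AntitoneOn (fun t : ℝ => P.f₀ (x + t • v) - t * ⟪gradient P.f₀ x, v⟫_ℝ
      - P.Lf / 2 * t ^ 2 * ‖v‖ ^ 2) (Set.Icc 0 1) := by
    refine antitoneOn_of_deriv_nonpos (convex_Icc 0 1)
      (fun t _ => (hder t).continuousAt.continuousWithinAt)
      (fun t _ => (hder t).differentiableAt.differentiableWithinAt) fun t ht => ?_
    rw [interior_Icc] at ht
    rw [(hder t).deriv, ← inner_sub_left]
    have h1 : ⟪gradient P.f₀ (x + t • v) - gradient P.f₀ x, v⟫_ℝ ≤ P.Lf * t * ‖v‖ * ‖v‖ := by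
      refine (real_inner_le_norm _ _).trans ?_
      gcongr
      refine (S.grad_lip _ _).trans_eq ?_
      rw [add_sub_cancel_left, norm_smul, Real.norm_eq_abs, abs_of_pos ht.1]
      ring
    nlinarith
  have h := hanti (Set.left_mem_Icc.2 zero_le_one) (Set.right_mem_Icc.2 zero_le_one) zero_le_one
  have e : x + (1 : ℝ) • v = x' := by rw [one_smul, hv]; abel
  simp only [e, zero_smul, add_zero, one_mul, zero_mul, mul_one, one_pow, ne_eq, OfNat.ofNat_ne_zero,
    not_false_eq_true, zero_pow, mul_zero, sub_zero] at h
  linarith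

lemma Standing.norm_xUpdate_sub (x : E d) (z zs : Dual nbar n) :
    ‖P.xUpdate x z - P.xUpdate x zs‖ ≤ 1 / P.τ * ‖P.M‖ * ‖z - zs‖ := by
  have hτ := S.tau_pos
  have : P.xUpdate x z - P.xUpdate x zs = -((1 / P.τ) • P.Mt (z - zs)) := by
    rw [xUpdate_eq hτ.ne', xUpdate_eq hτ.ne', ← resid_sub, smul_sub]
    abel
  rw [this, norm_neg, norm_smul, Real.norm_eq_abs, abs_of_pos (by positivity), mul_assoc]
  gcongr
  exact norm_Mt_le _

/-- The reduced objective `f₀(x) + ḡ(Ā x + b̄)`. -/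
def phi (P : Data d n nbar) (x : E d) : ℝ := P.f₀ x + P.gbar (P.Abar x + P.bbar)

omit S in
lemma xUpdate_stationarity (hτ : P.τ ≠ 0) (x : E d) (z : Dual nbar n) :
    gradient P.f₀ x + ContinuousLinearMap.adjoint P.Abar z.fst
      + ContinuousLinearMap.adjoint P.A z.snd = -(P.τ • (P.xUpdate x z - x)) := by
  rw [xUpdate, sub_sub_cancel_left, smul_neg, smul_smul, mul_one_div_cancel hτ, one_smul]
  abel

/-- Descent of the reduced objective in one exact step. -/
lemma Standing.exact_descent {x : E d} {zs : Dual nbar n} (hzs : zs ∈ P.Omega x) :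
    P.phi (P.xUpdate x zs) ≤ P.phi x - 3 / 2 * P.Lf * ‖P.xUpdate x zs - x‖ ^ 2
      + ⟪zs.snd, P.A x + P.b⟫_ℝ := by
  set xs := P.xUpdate x zs with hxs
  have hsub := S.subdiff_of_mem_Omega hzs (P.Abar x + P.bbar)
  have hf := S.feasible_of_mem_Omega hzs
  have hd := S.descent x xs
  have hst := xUpdate_stationarity S.tau_pos.ne' x zs
  rw [← hxs] at hsub hf hst
  have e1 : P.Abar x + P.bbar - (P.Abar xs + P.bbar) = P.Abar (x - xs) := by
    rw [map_sub]; abel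
  have e2 : P.A x + P.b = P.A (x - xs) := by
    rw [map_sub, eq_neg_of_add_eq_zero_left hf]; abel
  have e3 := congrArg (fun u => ⟪u, x - xs⟫_ℝ) hst
  simp only [inner_add_left, ContinuousLinearMap.adjoint_inner_left, inner_neg_left,
    real_inner_smul_left] at e3
  have e4 : ⟪xs - x, x - xs⟫_ℝ = -‖xs - x‖ ^ 2 := by
    rw [← neg_sub xs x, inner_neg_right, real_inner_self_eq_norm_sq]
  have e5 : ⟪gradient P.f₀ x, x - xs⟫_ℝ = -⟪gradient P.f₀ x, xs - x⟫_ℝ := by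
    rw [← neg_sub xs x, inner_neg_right]
  rw [e1] at hsub
  rw [e4, e5] at e3
  rw [e2, phi, phi]
  -- With τ = 2L_f, the gain τ‖xs - x‖² less the curvature L_f/2 · ‖xs - x‖² leaves 3/2 · L_f.
  rw [τ] at e3
  linarith

lemma Standing.phi_lipschitz (x x' : E d) :
    P.phi x' ≤ P.phi x + (P.lf + P.lg * ‖P.Abar‖) * ‖x' - x‖ := by
  have h1 := (abs_le.1 (S.f_lip x' x)).2
  have h2 := (abs_le.1 (S.g_lip (P.Abar x' + P.bbar) (P.Abar x + P.bbar))).2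
  have h3 : ‖P.Abar x' + P.bbar - (P.Abar x + P.bbar)‖ ≤ ‖P.Abar‖ * ‖x' - x‖ := by
    rw [add_sub_add_right_eq_sub, ← map_sub]
    exact P.Abar.le_opNorm _
  have h4 := mul_le_mul_of_nonneg_left h3 S.lg_nonneg
  simp only [phi]
  linarith

variable {ε : ℝ} (hε : 0 < ε)
include hε

/-- A point within `‖M‖ δ_ε / τ` of the feasible set. -/
def NearFeasible (P : Data d n nbar) (ε : ℝ) (x : E d) : Prop :=
  ∃ u : E d, P.A u + P.b = 0 ∧ ‖x - u‖ ≤ 1 / P.τ * ‖P.M‖ * P.deltaEps ε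

lemma Standing.nearFeasible_x₀ : P.NearFeasible ε P.x₀ := by
  refine ⟨P.x₀, S.feas_x, ?_⟩
  have h1 := S.deltaEps_nonneg hε
  have h2 := S.tau_pos
  rw [sub_self, norm_zero]
  positivity

lemma Standing.nearFeasible_xUpdate {x : E d} {z : Dual nbar n} (h : P.Crit (P.deltaEps ε) x z) :
    P.NearFeasible ε (P.xUpdate x z) := by
  obtain ⟨zs, hzs, hz⟩ := S.exists_of_crit (S.deltaEps_nonneg hε) h
  refine ⟨P.xUpdate x zs, S.feasible_of_mem_Omega hzs, (S.norm_xUpdate_sub x z zs).trans ?_⟩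
  have h2 := S.tau_pos
  gcongr

/-- Only the distance from x to the feasible set matters, not ‖x‖; this keeps the multipliers
bounded along an unbounded run. -/
lemma Standing.norm_snd_le_of_near {x : E d} (hx : P.NearFeasible ε x) {zs : Dual nbar n}
    (hzs : zs ∈ P.Omega x) : ‖zs.snd‖ ≤ P.B₂ + P.B₃ * P.deltaEps ε := by
  obtain ⟨u, hu, hxu⟩ := hx
  have hδ := S.deltaEps_nonneg hε
  have hτ := S.tau_pos
  refine (S.norm_snd_le_of_mem_Omega hzs hu).trans (add_le_add le_rfl ?_)
  calc P.τ * ‖P.AAtInvA (u - x)‖ ≤ P.τ * (‖P.AAtInvA‖ * (1 / P.τ * ‖P.M‖ * P.deltaEps ε)) := by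
        gcongr
        refine (P.AAtInvA.le_opNorm _).trans ?_
        gcongr
        rwa [norm_sub_rev]
    _ = ‖P.AAtInvA‖ * ‖P.M‖ * P.deltaEps ε := by field_simp
    _ ≤ P.B₃ * P.deltaEps ε := by
        refine mul_le_mul_of_nonneg_right ?_ hδ
        rw [B₃]
        linarith

/-- Descent of the reduced objective in one inexact step. -/
lemma Standing.inexact_descent {x : E d} (hx : P.NearFeasible ε x) {z : Dual nbar n}
    (h : P.Crit (P.deltaEps ε) x z) : ∃ s : ℝ, 0 ≤ s ∧
      ‖P.xUpdate x z - x‖ ≤ s + 1 / P.τ * (5 / 24 * ε) ∧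
      P.phi (P.xUpdate x z) ≤ P.phi x - 3 / 2 * P.Lf * s ^ 2 + ε ^ 2 / (16 * P.Lf) := by
  have hδ := S.deltaEps_nonneg hε
  have hτ := S.tau_pos
  obtain ⟨zs, hzs, hz⟩ := S.exists_of_crit hδ h
  have hnear : ‖P.xUpdate x z - P.xUpdate x zs‖ ≤ 1 / P.τ * ‖P.M‖ * P.deltaEps ε := by
    refine (S.norm_xUpdate_sub x z zs).trans ?_
    gcongr
  -- The witness s is the length of the exact step from x, taken with the dual solution zs near z.
  refine ⟨‖P.xUpdate x zs - x‖, norm_nonneg _, ?_, ?_⟩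
  · have h1 : P.xUpdate x z - x = (P.xUpdate x zs - x) + (P.xUpdate x z - P.xUpdate x zs) := by
      abel
    rw [h1]
    refine (norm_add_le _ _).trans (add_le_add le_rfl (hnear.trans ?_))
    rw [mul_assoc]
    exact mul_le_mul_of_nonneg_left (S.norm_M_mul_deltaEps_le hε) (by positivity)
  · have h1 := S.exact_descent hzs
    have h2 := S.phi_lipschitz (P.xUpdate x zs) (P.xUpdate x z)
    have h3 : (P.lf + P.lg * ‖P.Abar‖) * ‖P.xUpdate x z - P.xUpdate x zs‖
        ≤ (P.lf + P.lg * ‖P.Abar‖) * (1 / P.τ * ‖P.M‖ * P.deltaEps ε) := by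
      have := S.lf_nonneg
      have := S.lg_nonneg
      gcongr
    have h4 : ⟪zs.snd, P.A x + P.b⟫_ℝ ≤ (P.B₂ + P.B₃ * P.deltaEps ε)
        * (‖P.A‖ * (1 / P.τ * ‖P.M‖ * P.deltaEps ε)) := by
      have hs := S.norm_snd_le_of_near hε hx hzs
      obtain ⟨u, hu, hxu⟩ := hx
      refine (real_inner_le_norm _ _).trans ?_
      have e : P.A x + P.b = P.A (x - u) := by
        rw [map_sub, eq_neg_of_add_eq_zero_left hu]; abel
      rw [e]
      have h5 : ‖P.A (x - u)‖ ≤ ‖P.A‖ * (1 / P.τ * ‖P.M‖ * P.deltaEps ε) := by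
        refine (P.A.le_opNorm _).trans ?_
        gcongr
      exact mul_le_mul hs h5 (norm_nonneg _) ((norm_nonneg _).trans hs)
    have h5 := S.error_le hε
    linarith

/-- The bound for the length of a step. -/
def stepBound (P : Data d n nbar) (ε : ℝ) : ℝ :=
  1 / P.τ * (P.lf + ‖P.M‖ * P.lg + ‖P.M‖ * (P.B₂ + P.B₃ * P.deltaEps ε) + ‖P.M‖ * P.deltaEps ε)

lemma Standing.norm_step_le {x : E d} (hx : P.NearFeasible ε x) {z : Dual nbar n}
    (h : P.Crit (P.deltaEps ε) x z) : ‖P.xUpdate x z - x‖ ≤ P.stepBound ε := by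
  have hδ := S.deltaEps_nonneg hε
  have hτ := S.tau_pos
  obtain ⟨zs, hzs, hz⟩ := S.exists_of_crit hδ h
  have h0 : P.xUpdate x z - x = (P.xUpdate x zs - x) + (P.xUpdate x z - P.xUpdate x zs) := by
    abel
  have h1 : ‖P.xUpdate x z - P.xUpdate x zs‖ ≤ 1 / P.τ * ‖P.M‖ * P.deltaEps ε := by
    refine (S.norm_xUpdate_sub x z zs).trans ?_
    gcongr
  have h2 : P.xUpdate x zs - x = -((1 / P.τ) • (gradient P.f₀ x
      + ContinuousLinearMap.adjoint P.Abar zs.fst + ContinuousLinearMap.adjoint P.A zs.snd)) := by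
    rw [xUpdate_stationarity hτ.ne', smul_neg, smul_smul, one_div_mul_cancel hτ.ne', one_smul,
      neg_neg]
  have h3 : ‖P.xUpdate x zs - x‖ ≤ 1 / P.τ * (P.lf + ‖P.M‖ * P.lg
      + ‖P.M‖ * (P.B₂ + P.B₃ * P.deltaEps ε)) := by
    rw [h2, norm_neg, norm_smul, Real.norm_eq_abs, abs_of_pos (by positivity)]
    gcongr
    refine (norm_add_le _ _).trans (add_le_add ((norm_add_le _ _).trans (add_le_add ?_ ?_)) ?_)
    · exact S.norm_gradient_le x
    · refine (norm_adjoint_Abar_le _).trans ?_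
      gcongr
      · exact norm_Abar_le
      · exact S.norm_fst_le_of_mem (S.mem_Omega_iff.1 hzs).1
    · refine (ContinuousLinearMap.le_opNorm _ _).trans ?_
      rw [LinearIsometryEquiv.norm_map]
      gcongr
      · exact norm_A_le
      · exact S.norm_snd_le_of_near hε hx hzs
  rw [h0]
  refine (norm_add_le _ _).trans ((add_le_add h3 h1).trans_eq ?_)
  rw [stepBound]
  ring

/-- A short step ends at an `ε`-stationary point. -/
lemma Standing.stationary_of_short {x : E d} {z : Dual nbar n} (h : P.Crit (P.deltaEps ε) x z)
    (hshort : 3 * P.Lf * ‖P.xUpdate x z - x‖ ≤ ε) :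
    P.Stationary ε (P.xUpdate x z, P.yUpdate (P.xUpdate x z) z) := by
  have hδ := S.deltaEps_nonneg hε
  have hτ := S.tau_pos
  have hσ := S.σ_pos
  obtain ⟨zs, hzs, hz⟩ := S.exists_of_crit hδ h
  set x' := P.xUpdate x z with hx'
  set xs := P.xUpdate x zs with hxs
  set δ := P.deltaEps ε with hδdef
  set y' := P.yUpdate x' z with hy'
  set w := P.Abar x' + P.bbar with hw
  set ys := P.Abar xs + P.bbar with hys
  have hnear : ‖x' - xs‖ ≤ 1 / P.τ * ‖P.M‖ * δ := by
    refine (S.norm_xUpdate_sub x z zs).trans ?_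
    gcongr
  have hwy : ‖w - ys‖ ≤ ‖P.Abar‖ * (1 / P.τ * ‖P.M‖ * δ) := by
    rw [hw, hys, add_sub_add_right_eq_sub, ← map_sub]
    refine (P.Abar.le_opNorm _).trans ?_
    gcongr
  have hξ : z.fst + P.σ • (w - y') ∈ subdiff P.gbar y' := by
    have h1 := prox_real_spec S.g_lip S.gbar_continuous S.g_convex (one_div_pos.2 hσ)
      ((1 / P.σ) • z.fst + P.Abar x' + P.bbar)
    have h2 : (1 / (1 / P.σ)) • ((1 / P.σ) • z.fst + P.Abar x' + P.bbar - y')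
        = z.fst + P.σ • (w - y') := by
      rw [one_div_one_div, add_assoc, ← hw, add_sub_assoc, smul_add, smul_smul,
        mul_one_div_cancel hσ.ne', one_smul]
    rw [← h2]
    exact h1
  have hys' : zs.fst ∈ subdiff P.gbar ys := S.subdiff_of_mem_Omega hzs
  -- Monotonicity of ∂ḡ between y' and the exact point ys: the term σ‖y' - ys‖² is dominated by the
  -- pairing with the perturbation of z₁ and w.
  have hprox : ‖y' - ys‖ ≤ 1 / P.σ * δ + ‖P.Abar‖ * (1 / P.τ * ‖P.M‖ * δ) := by
    have h1 := hξ ys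
    have h2 := hys' y'
    have h3 : ⟪z.fst + P.σ • (w - y'), ys - y'⟫_ℝ + ⟪zs.fst, y' - ys⟫_ℝ
        = P.σ * ‖y' - ys‖ ^ 2 - ⟪(z.fst - zs.fst) + P.σ • (w - ys), y' - ys⟫_ℝ := by
      have e : z.fst + P.σ • (w - y') = ((z.fst - zs.fst) + P.σ • (w - ys)) + zs.fst
          - P.σ • (y' - ys) := by module
      rw [e, ← neg_sub y' ys, inner_neg_right, inner_sub_left, inner_add_left, real_inner_smul_left,
        real_inner_self_eq_norm_sq]
      ring
    have h4 : P.σ * ‖y' - ys‖ ^ 2 ≤ (δ + P.σ * (‖P.Abar‖ * (1 / P.τ * ‖P.M‖ * δ))) * ‖y' - ys‖ := by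
      have h5 := real_inner_le_norm ((z.fst - zs.fst) + P.σ • (w - ys)) (y' - ys)
      have h6 : ‖(z.fst - zs.fst) + P.σ • (w - ys)‖
          ≤ δ + P.σ * (‖P.Abar‖ * (1 / P.τ * ‖P.M‖ * δ)) := by
        refine (norm_add_le _ _).trans (add_le_add ((norm_fst_le (z - zs)).trans hz) ?_)
        rw [norm_smul, Real.norm_eq_abs, abs_of_pos hσ]
        gcongr
      have h7 := mul_le_mul_of_nonneg_right h6 (norm_nonneg (y' - ys))
      linarith
    rcases (norm_nonneg (y' - ys)).eq_or_lt with h5 | h5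
    · rw [← h5]
      positivity
    · have h6 : P.σ * ‖y' - ys‖ ≤ δ + P.σ * (‖P.Abar‖ * (1 / P.τ * ‖P.M‖ * δ)) := by
        refine le_of_mul_le_mul_right ?_ h5
        linarith
      have h7 : P.σ * ‖y' - ys‖ ≤ P.σ * (1 / P.σ * δ + ‖P.Abar‖ * (1 / P.τ * ‖P.M‖ * δ)) := by
        refine h6.trans_eq ?_
        field_simp
      exact le_of_mul_le_mul_left h7 hσ
  have hyw : ‖y' - w‖ ≤ P.B₁ * δ := by
    have e : y' - w = (y' - ys) - (w - ys) := by abel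
    rw [e]
    refine (norm_sub_le _ _).trans ((add_le_add hprox hwy).trans ?_)
    rw [B₁]
    have : 0 ≤ 1 / P.τ * ‖P.A‖ * ‖P.M‖ * δ := by positivity
    linarith
  refine ⟨z.fst, z.snd, ?_, ?_, ?_, ?_⟩
  · have hmem : z.fst + P.σ • (w - y') - z.fst ∈ (fun ξ => ξ - z.fst) '' subdiff P.gbar y' :=
      ⟨_, hξ, rfl⟩
    refine (Metric.infEDist_le_edist_of_mem hmem).trans ?_
    rw [edist_dist, dist_zero_left]
    refine ENNReal.ofReal_le_ofReal ?_
    rw [add_sub_cancel_left, norm_smul, Real.norm_eq_abs, abs_of_pos hσ, norm_sub_rev]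
    refine le_trans ?_ S.deltaEps_le₁
    gcongr
  · have hst := xUpdate_stationarity hτ.ne' x z
    rw [← hx'] at hst
    have e : gradient P.f₀ x' + ContinuousLinearMap.adjoint P.Abar z.fst
        + ContinuousLinearMap.adjoint P.A z.snd
        = (gradient P.f₀ x' - gradient P.f₀ x) - P.τ • (x' - x) := by
      rw [sub_eq_add_neg _ (P.τ • (x' - x)), ← hst]
      abel
    change ‖gradient P.f₀ x' + ContinuousLinearMap.adjoint P.Abar z.fst
        + ContinuousLinearMap.adjoint P.A z.snd‖ ≤ ε
    rw [e]
    refine (norm_sub_le _ _).trans (le_trans ?_ hshort)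
    rw [norm_smul, Real.norm_eq_abs, abs_of_pos hτ, τ]
    linarith [S.grad_lip x' x]
  · change ‖y' - P.Abar x' - P.bbar‖ ≤ ε
    rw [sub_sub]
    exact hyw.trans S.deltaEps_le₂
  · have e : P.A x' + P.b = P.A (x' - xs) := by
      rw [map_sub, eq_neg_of_add_eq_zero_left (S.feasible_of_mem_Omega hzs)]
      abel
    change ‖P.A x' + P.b‖ ≤ ε
    rw [e]
    refine (P.A.le_opNorm _).trans (le_trans ?_ S.deltaEps_le₂)
    calc ‖P.A‖ * ‖x' - xs‖ ≤ ‖P.A‖ * (1 / P.τ * ‖P.M‖ * δ) := by gcongr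
      _ = 1 / P.τ * ‖P.A‖ * ‖P.M‖ * δ := by ring
      _ ≤ P.B₁ * δ := by
        gcongr
        exact S.norm_A_le_B₁

/-- A step that does not end at an `ε`-stationary point decreases the reduced objective. -/
lemma Standing.decrease {x : E d} (hx : P.NearFeasible ε x) {z : Dual nbar n}
    (h : P.Crit (P.deltaEps ε) x z)
    (hns : ¬ P.Stationary ε (P.xUpdate x z, P.yUpdate (P.xUpdate x z) z)) :
    P.phi (P.xUpdate x z) ≤ P.phi x - ε ^ 2 / (64 * P.Lf) := by
  have hL := S.Lf_pos
  have hlong : ε < 3 * P.Lf * ‖P.xUpdate x z - x‖ := by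
    by_contra hcon
    push Not at hcon
    exact hns (S.stationary_of_short hε h hcon)
  obtain ⟨s, hs0, hs1, hs2⟩ := S.inexact_descent hε hx h
  -- Inexactness costs 3L_f · (1/τ) · 5ε/24 = 5ε/16 of the step length. The remaining 11/16 gives a
  -- decrease of 121/1536 ≥ 5/64 times ε²/L_f, of which the error 4/64 leaves 1/64.
  have h1 : 11 / 16 * ε ≤ 3 * P.Lf * s := by
    have h2 : 3 * P.Lf * ‖P.xUpdate x z - x‖ ≤ 3 * P.Lf * (s + 1 / P.τ * (5 / 24 * ε)) := by
      gcongr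
    have h3 : 3 * P.Lf * (s + 1 / P.τ * (5 / 24 * ε)) = 3 * P.Lf * s + 5 / 16 * ε := by
      rw [τ]
      field_simp
      ring
    linarith
  have h2 : (11 / 16 * ε) ^ 2 ≤ (3 * P.Lf * s) ^ 2 := by gcongr
  have h3 : 5 / 64 * (ε ^ 2 / P.Lf) ≤ 3 / 2 * P.Lf * s ^ 2 := by
    rw [← mul_div_assoc, div_le_iff₀ hL]
    nlinarith [sq_nonneg ε]
  have h4 : ε ^ 2 / (16 * P.Lf) = 4 / 64 * (ε ^ 2 / P.Lf) := by field_simp; norm_num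
  have h5 : ε ^ 2 / (64 * P.Lf) = 1 / 64 * (ε ^ 2 / P.Lf) := by field_simp
  rw [h4] at hs2
  rw [h5]
  linarith

/-! ### The outer loop -/

omit S hε in
lemma iterate_succ_fst (I J : E d → ℕ) (k : ℕ) : (P.iterate I J (k + 1)).1
    = P.xUpdate (P.iterate I J k).1
      (P.restartedAPG (P.iterate I J k).1 (I (P.iterate I J k).1) (J (P.iterate I J k).1)) := rfl

lemma Standing.nearFeasible_iterate {I J : E d → ℕ}
    (hcrit : ∀ k, P.Crit (P.deltaEps ε) (P.iterate I J k).1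
      (P.restartedAPG (P.iterate I J k).1 (I (P.iterate I J k).1) (J (P.iterate I J k).1)))
    (k : ℕ) : P.NearFeasible ε (P.iterate I J k).1 := by
  cases k with
  | zero => exact S.nearFeasible_x₀ hε
  | succ k =>
    rw [iterate_succ_fst]
    exact S.nearFeasible_xUpdate hε (hcrit k)

lemma Standing.norm_iterate_le {I J : E d → ℕ}
    (hcrit : ∀ k, P.Crit (P.deltaEps ε) (P.iterate I J k).1
      (P.restartedAPG (P.iterate I J k).1 (I (P.iterate I J k).1) (J (P.iterate I J k).1)))
    (k : ℕ) : ‖(P.iterate I J k).1‖ ≤ ‖P.x₀‖ + k * P.stepBound ε := by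
  induction k with
  | zero =>
    simp [iterate]
  | succ k ih =>
    have h := S.norm_step_le hε (S.nearFeasible_iterate hε hcrit k) (hcrit k)
    rw [← iterate_succ_fst] at h
    have h2 := norm_le_norm_add_norm_sub' (P.iterate I J (k + 1)).1 (P.iterate I J k).1
    push_cast
    linarith

/-- The number of outer steps. -/
lemma Standing.exists_stationary {I J : E d → ℕ}
    (hcrit : ∀ k, P.Crit (P.deltaEps ε) (P.iterate I J k).1
      (P.restartedAPG (P.iterate I J k).1 (I (P.iterate I J k).1) (J (P.iterate I J k).1))) :
    ∃ K : ℕ, (K : ℝ) ≤ 64 * (P.Lf * P.DeltaF / ε ^ 2) + 1 ∧ P.Stationary ε (P.iterate I J K) := by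
  have hL := S.Lf_pos
  set r := 64 * (P.Lf * P.DeltaF / ε ^ 2) with hr
  have hr0 : 0 ≤ r := by
    have := S.DeltaF_nonneg
    positivity
  by_contra hcon
  push Not at hcon
  have key : ∀ k : ℕ, (k : ℝ) ≤ r + 1 →
      P.phi (P.iterate I J k).1 ≤ P.phi P.x₀ - k * (ε ^ 2 / (64 * P.Lf)) := by
    intro k
    induction k with
    | zero => intro _; simp [iterate]
    | succ k ih =>
      intro hk
      have h1 := ih (by push_cast at hk; linarith)
      have h2 := S.decrease hε (S.nearFeasible_iterate hε hcrit k) (hcrit k) (hcon (k + 1) hk)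
      rw [← iterate_succ_fst] at h2
      push_cast
      linarith
  have h1 := key (⌊r⌋₊ + 1) (by
    push_cast
    linarith [Nat.floor_le hr0])
  have h2 : r < ((⌊r⌋₊ + 1 : ℕ) : ℝ) := by exact_mod_cast Nat.lt_floor_add_one r
  have h3 : P.phi P.x₀ - P.phi (P.iterate I J (⌊r⌋₊ + 1)).1 ≤ P.DeltaF := by
    have h4 := csInf_le S.F_bddBelow ⟨((P.iterate I J (⌊r⌋₊ + 1)).1,
      P.Abar (P.iterate I J (⌊r⌋₊ + 1)).1 + P.bbar), rfl⟩
    rw [DeltaF]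
    have h5 : P.F (P.x₀, P.y₀) = P.phi P.x₀ := by
      rw [F, phi, S.feas_y]
    rw [h5]
    have h6 : P.F ((P.iterate I J (⌊r⌋₊ + 1)).1, P.Abar (P.iterate I J (⌊r⌋₊ + 1)).1 + P.bbar)
      = P.phi (P.iterate I J (⌊r⌋₊ + 1)).1 := rfl
    rw [h6] at h4
    linarith
  have h4 : r * (ε ^ 2 / (64 * P.Lf)) = P.DeltaF := by
    rw [hr]
    field_simp
  have h5 : r * (ε ^ 2 / (64 * P.Lf)) < ((⌊r⌋₊ + 1 : ℕ) : ℝ) * (ε ^ 2 / (64 * P.Lf)) := by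
    have : 0 < ε ^ 2 / (64 * P.Lf) := by positivity
    gcongr
  linarith

end Step

/-- If `Δ_F = 0` then the initial point is stationary. -/
lemma Standing.stationary_of_DeltaF_eq_zero (S : P.Standing) (hΔ : P.DeltaF = 0) {ε : ℝ}
    (hε : 0 < ε) : P.Stationary ε (P.x₀, P.y₀) := by
  have hmin : ∀ p, P.F (P.x₀, P.y₀) ≤ P.F p := by
    intro p
    have := csInf_le S.F_bddBelow ⟨p, rfl⟩
    rw [DeltaF] at hΔ
    linarith
  have hgrad : gradient P.f₀ P.x₀ = 0 := by
    have hloc : IsLocalMin P.f₀ P.x₀ := Filter.Eventually.of_forall fun x => by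
      have := hmin (x, P.y₀)
      simp only [F] at this
      linarith
    have := hloc.fderiv_eq_zero
    rw [← toDual_gradient] at this
    exact (LinearIsometryEquiv.map_eq_zero_iff _).1 this
  refine ⟨0, 0, ?_, ?_, ?_, ?_⟩
  · have h0 : (0 : E nbar) ∈ subdiff P.gbar P.y₀ := fun y => by
      have := hmin (P.x₀, y)
      simp only [F] at this
      rw [inner_zero_left]
      linarith
    have hmem : (0 : E nbar) ∈ (fun ξ => ξ - (0 : E nbar)) '' subdiff P.gbar P.y₀ :=
      ⟨0, h0, sub_zero _⟩
    refine (Metric.infEDist_le_edist_of_mem hmem).trans ?_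
    simp
  · simp [hgrad, hε.le]
  · have : P.y₀ - P.Abar P.x₀ - P.bbar = 0 := by rw [S.feas_y]; abel
    simp only [this, norm_zero]
    exact hε.le
  · simp only [S.feas_x, norm_zero]
    exact hε.le

end Data

end IPG

namespace IPG

/-! ### Bounds by powers -/

lemma pow_mono_bound {T a : ℝ} {i k : ℕ} (hT : 2 ≤ T) (ha : a ≤ T ^ i) (hk : i ≤ k) : a ≤ T ^ k :=
  ha.trans (pow_le_pow_right₀ (by linarith) hk)

/-- Because T ≥ 2, a sum costs one extra power of T and numerical constants are absorbed as powers.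
All estimates with T = 1/ε reduce to counting exponents. -/
lemma pow_add_bound {T a b : ℝ} {i j k : ℕ} (hT : 2 ≤ T) (ha : a ≤ T ^ i) (hb : b ≤ T ^ j)
    (hi : i < k) (hj : j < k) : a + b ≤ T ^ k := by
  obtain ⟨k, rfl⟩ : ∃ l, k = l + 1 := ⟨k - 1, by omega⟩
  have h1 := pow_mono_bound hT ha (Nat.lt_succ_iff.1 hi)
  have h2 := pow_mono_bound hT hb (Nat.lt_succ_iff.1 hj)
  have h3 : 0 ≤ T ^ k := pow_nonneg (by linarith) _
  rw [pow_succ]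
  nlinarith

lemma pow_mul_bound {T a b : ℝ} {i j k : ℕ} (hT : 2 ≤ T) (hb0 : 0 ≤ b) (ha : a ≤ T ^ i)
    (hb : b ≤ T ^ j) (hk : i + j ≤ k) : a * b ≤ T ^ k := by
  refine pow_mono_bound hT ?_ hk
  rw [pow_add]
  exact mul_le_mul ha hb hb0 (pow_nonneg (by linarith) _)

lemma le_two_pow_ceil_logb {X : ℝ} : X ≤ 2 ^ ⌈Real.logb 2 X⌉₊ := by
  rcases le_or_gt X 0 with h | h
  · exact h.trans (by positivity)
  · have h1 := Nat.le_ceil (Real.logb 2 X)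
    rw [Real.logb_le_iff_le_rpow one_lt_two h, Real.rpow_natCast] at h1
    exact h1

lemma ceil_logb_le {X : ℝ} (hX : 0 ≤ X) {i : ℕ} (h : X ≤ 2 ^ i) : ⌈Real.logb 2 X⌉₊ ≤ i := by
  rw [Nat.ceil_le]
  rcases hX.eq_or_lt with h0 | h0
  · rw [← h0, Real.logb_zero]
    exact Nat.cast_nonneg i
  · rw [Real.logb_le_iff_le_rpow one_lt_two h0, Real.rpow_natCast]
    exact h

lemma ceil_logb_pow_le {T : ℝ} (hT : 2 ≤ T) (q : ℕ) :
    (⌈Real.logb 2 (T ^ q)⌉₊ : ℝ) ≤ 2 * (q + 1) * Real.log T := by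
  have hT0 : 0 < T := by linarith
  have hlog2 : (1 : ℝ) / 2 < Real.log 2 := by linarith [Real.log_two_gt_d9]
  have h1 : Real.log 2 ≤ Real.log T := Real.log_le_log two_pos hT
  have h2 : 0 ≤ Real.logb 2 (T ^ q) :=
    Real.logb_nonneg one_lt_two (one_le_pow₀ (by linarith))
  refine (Nat.ceil_lt_add_one h2).le.trans ?_
  have h3 : Real.logb 2 (T ^ q) ≤ 2 * q * Real.log T := by
    rw [Real.logb, Real.log_pow, div_le_iff₀ (by linarith)]
    have : 0 ≤ (q : ℝ) * Real.log T := mul_nonneg (Nat.cast_nonneg q) (by linarith)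
    nlinarith
  nlinarith

namespace Data

variable {d n nbar : ℕ} {P : Data d n nbar}

/-- All parameters of the problem are at most `T`. -/
structure SizeLe (P : Data d n nbar) (T : ℝ) : Prop where
  two_le : 2 ≤ T
  Lf_le : P.Lf ≤ T
  Lf_inv_le : P.Lf⁻¹ ≤ T
  lf_le : P.lf ≤ T
  lg_le : P.lg ≤ T
  σ_le : P.σ ≤ T
  σ_inv_le : P.σ⁻¹ ≤ T
  M_le : ‖P.M‖ ≤ T
  AAtInvA_le : ‖P.AAtInvA‖ ≤ T
  x₀_le : ‖P.x₀‖ ≤ T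
  y₀_le : ‖P.y₀‖ ≤ T
  DeltaF_le : P.DeltaF ≤ T
  DeltaF_inv_le : P.DeltaF⁻¹ ≤ T
  conj_le : (conj P.gbar P.y₀ + (P.gbar 0 : EReal)).toReal ≤ T

section Standing

variable (S : P.Standing)
include S

omit S in
lemma conj_zero_nonneg : 0 ≤ (conj P.gbar P.y₀ + (P.gbar 0 : EReal)).toReal := by
  by_cases h : conj P.gbar P.y₀ = ⊤
  · rw [h, EReal.top_add_coe, EReal.toReal_top]
  · have h1 := le_conjReal (g := P.gbar) (z := P.y₀) h 0
    rw [conj_eq_coe (g := P.gbar) (z := P.y₀) h, ← EReal.coe_add, EReal.toReal_coe]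
    rw [inner_zero_left] at h1
    linarith

lemma Standing.sizeLe_size : P.SizeLe P.size := by
  have h1 := S.Lf_pos
  have h2 := inv_pos.2 h1
  have h3 := S.lf_nonneg
  have h4 := S.lg_nonneg
  have h5 := S.σ_pos
  have h6 := inv_pos.2 h5
  have h7 := norm_nonneg P.M
  have h8 := norm_nonneg P.AAtInvA
  have h9 := norm_nonneg P.x₀
  have h10 := norm_nonneg P.y₀
  have h11 := S.DeltaF_nonneg
  have h12 := inv_nonneg.2 h11
  have h13 := conj_zero_nonneg (P := P)
  constructor <;> rw [size] <;> linarith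

omit S in
lemma SizeLe.mono {T T' : ℝ} (h : P.SizeLe T) (hT : T ≤ T') : P.SizeLe T' where
  two_le := h.two_le.trans hT
  Lf_le := h.Lf_le.trans hT
  Lf_inv_le := h.Lf_inv_le.trans hT
  lf_le := h.lf_le.trans hT
  lg_le := h.lg_le.trans hT
  σ_le := h.σ_le.trans hT
  σ_inv_le := h.σ_inv_le.trans hT
  M_le := h.M_le.trans hT
  AAtInvA_le := h.AAtInvA_le.trans hT
  x₀_le := h.x₀_le.trans hT
  y₀_le := h.y₀_le.trans hT
  DeltaF_le := h.DeltaF_le.trans hT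
  DeltaF_inv_le := h.DeltaF_inv_le.trans hT
  conj_le := h.conj_le.trans hT

variable {T : ℝ} (H : P.SizeLe T)
include H

omit S in
lemma SizeLe.tau_le : P.τ ≤ T ^ 2 := by
  have h1 := H.Lf_le
  have h2 := H.two_le
  rw [τ]
  nlinarith

lemma Standing.one_div_tau_le : 1 / P.τ ≤ T ^ 1 := by
  have h1 := H.Lf_inv_le
  have h2 := S.Lf_pos
  have h3 : 1 / P.τ = P.Lf⁻¹ / 2 := by
    rw [τ]
    field_simp
  have h4 := inv_pos.2 h2
  rw [h3, pow_one]
  linarith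

lemma Standing.B₁_le : P.B₁ ≤ T ^ 5 := by
  have hT := H.two_le
  have hτ := S.tau_pos
  have h1 : ‖P.M‖ ≤ T ^ 1 := by simpa using H.M_le
  have h2 := S.one_div_tau_le H
  have h3 : ‖P.Abar‖ ≤ T ^ 1 := norm_Abar_le.trans h1
  have h4 : ‖P.A‖ ≤ T ^ 1 := norm_A_le.trans h1
  have h5 : 1 / P.σ ≤ T ^ 1 := by simpa using H.σ_inv_le
  rw [B₁]
  refine pow_add_bound hT (i := 4) (j := 4) (pow_add_bound hT (i := 3) (j := 1) ?_ h5 (by norm_num)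
    (by norm_num)) ?_ (by norm_num) (by norm_num)
  · exact pow_mul_bound hT (norm_nonneg _) (pow_mul_bound hT (norm_nonneg _) h2 h3 le_rfl) h1
      (by norm_num)
  · exact pow_mul_bound hT (norm_nonneg _) (pow_mul_bound hT (by positivity) h2
      (pow_add_bound hT h3 h4 (k := 2) (by norm_num) (by norm_num)) le_rfl) h1 (by norm_num)

lemma Standing.B₂_le : P.B₂ ≤ T ^ 4 := by
  have hT := H.two_le
  have h1 : ‖P.M‖ ≤ T ^ 1 := by simpa using H.M_le
  have h3 : ‖P.Abar‖ ≤ T ^ 1 := norm_Abar_le.trans h1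
  have h4 : ‖P.AAtInvA‖ ≤ T ^ 1 := by simpa using H.AAtInvA_le
  have h5 : P.lf ≤ T ^ 1 := by simpa using H.lf_le
  have h6 : P.lg ≤ T ^ 1 := by simpa using H.lg_le
  have h7 := S.lf_nonneg
  have h8 := S.lg_nonneg
  rw [B₂]
  exact pow_mul_bound hT (by positivity) h4 (pow_add_bound hT h5
    (pow_mul_bound hT h8 h3 h6 (k := 2) (by norm_num)) (k := 3) (by norm_num) (by norm_num))
    (by norm_num)

omit S in
lemma SizeLe.B₃_le : P.B₃ ≤ T ^ 3 := by
  have hT := H.two_le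
  have h1 : ‖P.M‖ ≤ T ^ 1 := by simpa using H.M_le
  have h4 : ‖P.AAtInvA‖ ≤ T ^ 1 := by simpa using H.AAtInvA_le
  rw [B₃]
  exact pow_add_bound hT (i := 0) (by simp) (pow_mul_bound hT (norm_nonneg _) h4 h1 (k := 2)
    (by norm_num)) (by norm_num) (by norm_num)

lemma Standing.B₄_le : P.B₄ ≤ T ^ 8 := by
  have hT := H.two_le
  have h1 : ‖P.M‖ ≤ T ^ 1 := by simpa using H.M_le
  have h2 := S.one_div_tau_le H
  have h5 : P.lf ≤ T ^ 1 := by simpa using H.lf_le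
  have h6 : P.lg ≤ T ^ 1 := by simpa using H.lg_le
  have h7 := S.lf_nonneg
  have h8 := S.lg_nonneg
  have h9 := S.B₂_nonneg
  rw [B₄]
  exact pow_mul_bound hT (by positivity) h2 (pow_add_bound hT h5 (pow_mul_bound hT (by positivity)
    h1 (pow_add_bound hT h6 (S.B₂_le H) (k := 5) (by norm_num) (by norm_num)) (k := 6)
    (by norm_num)) (k := 7) (by norm_num) (by norm_num)) (by norm_num)

lemma Standing.Bsum_le : P.Bsum ≤ T ^ 12 := by
  have hT := H.two_le
  have h1 : ‖P.M‖ ≤ T ^ 1 := by simpa using H.M_le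
  have h3 : ‖P.Abar‖ ≤ T ^ 1 := norm_Abar_le.trans h1
  have h5 : P.σ ≤ T ^ 1 := by simpa using H.σ_le
  have h6 : P.lg ≤ T ^ 1 := by simpa using H.lg_le
  rw [Bsum]
  exact pow_add_bound hT (pow_add_bound hT (S.B₂_le H) (pow_mul_bound hT S.B₄_nonneg
    (pow_mul_bound hT (norm_nonneg _) h5 h3 (k := 2) (by norm_num)) (S.B₄_le H) (k := 10)
    (by norm_num)) (k := 11) (by norm_num) (by norm_num)) h6 (by norm_num) (by norm_num)

/-- Every denominator in δ_ε is polynomial in parameters at most T = 1/ε, so δ_ε ≥ ε²⁶; it enters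
the number of loops only through its logarithm. -/
lemma Standing.deltaEps_ge (hΔ : P.DeltaF ≠ 0) {ε : ℝ} (hεT : ε * T = 1) :
    1 ≤ P.deltaEps ε * T ^ 26 := by
  have hT := H.two_le
  have hT0 : 0 < T := by linarith
  have hτ := S.tau_pos
  have hσ := S.σ_pos
  have hL := S.Lf_pos
  have hB₁ := S.B₁_pos
  have hB₃ : 0 < P.B₃ := lt_of_lt_of_le one_pos one_le_B₃
  have hs := S.Bsum_pos hΔ
  have h1 : ‖P.M‖ ≤ T ^ 1 := by simpa using H.M_le
  have h3 : ‖P.Abar‖ ≤ T ^ 1 := norm_Abar_le.trans h1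
  have h5 : P.σ ≤ T ^ 1 := by simpa using H.σ_le
  have h6 : P.Lf ≤ T ^ 1 := by simpa using H.Lf_le
  have h48 : (48 : ℝ) ≤ T ^ 6 := by
    calc (48 : ℝ) ≤ 2 ^ 6 := by norm_num
      _ ≤ T ^ 6 := by gcongr
  have e1 : ε * T ^ 26 = T ^ 25 := by
    rw [pow_succ' T 25, ← mul_assoc, hεT, one_mul]
  have e2 : ε ^ 2 * T ^ 26 = T ^ 24 := by
    have : ε ^ 2 * T ^ 26 = (ε * T) ^ 2 * T ^ 24 := by ring
    rw [this, hεT, one_pow, one_mul]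
  have e3 : ε ^ 2 * T ^ 52 = T ^ 50 := by
    have : ε ^ 2 * T ^ 52 = (ε * T) ^ 2 * T ^ 50 := by ring
    rw [this, hεT, one_pow, one_mul]
  have hLB : 48 * P.Lf * P.B₁ ≤ T ^ 12 :=
    pow_mul_bound hT hB₁.le (pow_mul_bound hT hL.le h48 h6 le_rfl) (S.B₁_le H) (by norm_num)
  rw [Bsum] at hs
  rw [← div_le_iff₀ (by positivity), deltaEps]
  refine le_min (le_min ?_ ?_) (le_min ?_ (Real.le_sqrt_of_sq_le ?_))
  · rw [div_le_div_iff₀ (by positivity) (by positivity), one_mul, e1]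
    exact pow_mul_bound hT hσ.le (S.B₁_le H) h5 (by norm_num)
  · rw [div_le_div_iff₀ (by positivity) (by positivity), one_mul, e1]
    exact pow_mono_bound hT (S.B₁_le H) (by norm_num)
  · rw [div_le_div_iff₀ (by positivity) (by positivity), one_mul, e2]
    exact pow_mul_bound hT hs.le hLB (S.Bsum_le H) (by norm_num)
  · rw [div_pow, one_pow, ← pow_mul, div_le_div_iff₀ (by positivity) (by positivity), one_mul, e3]
    refine pow_mul_bound hT (by positivity) (pow_mul_bound hT hB₃.le hLB H.B₃_le (k := 15)
      (by norm_num)) (pow_add_bound hT (i := 0) (by simp) (pow_mul_bound hT (norm_nonneg _)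
      (pow_mul_bound hT (norm_nonneg _) (pow_mul_bound hT hσ.le (S.one_div_tau_le H) h5
      (k := 2) (by norm_num)) h3 (k := 3) (by norm_num)) h1 (k := 4) (by norm_num)) (k := 5)
      (by norm_num) (by norm_num)) (by norm_num)

lemma Standing.deltaEps_le {ε : ℝ} (hε : 0 < ε) (hεT : ε * T = 1) : P.deltaEps ε ≤ T ^ 1 := by
  have hT := H.two_le
  have hσ := S.σ_pos
  have h1 := S.deltaEps_le₂ (ε := ε)
  have h2 := S.one_div_σ_le_B₁
  have h3 := S.deltaEps_nonneg hε
  have h4 : 1 / P.σ * P.deltaEps ε ≤ ε := le_trans (by gcongr) h1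
  rw [one_div_mul_eq_div, div_le_iff₀ hσ] at h4
  have h5 : ε ≤ 1 := by nlinarith
  rw [pow_one]
  exact h4.trans ((mul_le_of_le_one_left hσ.le h5).trans H.σ_le)

lemma Standing.snd_bound_le {ε : ℝ} (hε : 0 < ε) (hεT : ε * T = 1) :
    P.B₂ + P.B₃ * P.deltaEps ε ≤ T ^ 5 :=
  pow_add_bound H.two_le (S.B₂_le H) (pow_mul_bound H.two_le (S.deltaEps_nonneg hε) H.B₃_le
    (S.deltaEps_le H hε hεT) (k := 4) (by norm_num)) (by norm_num) (by norm_num)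

lemma Standing.stepBound_le {ε : ℝ} (hε : 0 < ε) (hεT : ε * T = 1) : P.stepBound ε ≤ T ^ 9 := by
  have hT := H.two_le
  have h1 : ‖P.M‖ ≤ T ^ 1 := by simpa using H.M_le
  have h5 : P.lf ≤ T ^ 1 := by simpa using H.lf_le
  have h6 : P.lg ≤ T ^ 1 := by simpa using H.lg_le
  have h7 := S.lf_nonneg
  have h8 := S.lg_nonneg
  have h9 := S.B₂_nonneg
  have h10 := S.deltaEps_nonneg hε
  have h11 : 0 ≤ P.B₃ := zero_le_one.trans one_le_B₃
  rw [stepBound]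
  refine pow_mul_bound hT (by positivity) (S.one_div_tau_le H) (pow_add_bound hT (k := 8)
    (i := 7) (j := 2) (pow_add_bound hT (i := 3) (j := 6) (pow_add_bound hT (i := 1) (j := 2) h5
    (pow_mul_bound hT h8 h1 h6 le_rfl) (by norm_num) (by norm_num))
    (pow_mul_bound hT (by positivity) h1 (S.snd_bound_le H hε hεT) le_rfl)
    (by norm_num) (by norm_num)) (pow_mul_bound hT h10 h1 (S.deltaEps_le H hε hεT) le_rfl)
    (by norm_num) (by norm_num)) (by norm_num)

omit S in
lemma SizeLe.norm_zini_le : ‖P.zini‖ ≤ T ^ 3 := by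
  have hT := H.two_le
  have h1 : ‖P.M‖ ≤ T ^ 1 := by simpa using H.M_le
  have h3 : ‖P.x₀‖ ≤ T ^ 1 := by simpa using H.x₀_le
  have h4 : ‖P.y₀‖ ≤ T ^ 1 := by simpa using H.y₀_le
  refine (norm_dual_le P.zini).trans (pow_add_bound hT h4 (j := 2) ?_ (by norm_num) (by norm_num))
  refine (P.A.le_opNorm P.x₀).trans ?_
  exact pow_mul_bound hT (norm_nonneg _) (norm_A_le.trans h1) h3 le_rfl

lemma Standing.norm_beta_le : ‖P.beta‖ ≤ T ^ 4 := by
  have hT := H.two_le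
  have h1 : ‖P.M‖ ≤ T ^ 1 := by simpa using H.M_le
  have h3 : ‖P.x₀‖ ≤ T ^ 1 := by simpa using H.x₀_le
  have h4 : ‖P.y₀‖ ≤ T ^ 1 := by simpa using H.y₀_le
  refine (norm_dual_le P.beta).trans (pow_add_bound hT (i := 3) (j := 2) ?_ ?_ (by norm_num)
    (by norm_num))
  · have : P.beta.fst = P.y₀ - P.Abar P.x₀ := by
      rw [S.feas_y, add_sub_cancel_left]
      rfl
    rw [this]
    refine (norm_sub_le _ _).trans (pow_add_bound hT h4 (j := 2) ?_ (by norm_num) (by norm_num))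
    refine (P.Abar.le_opNorm P.x₀).trans ?_
    exact pow_mul_bound hT (norm_nonneg _) (norm_Abar_le.trans h1) h3 le_rfl
  · have : P.beta.snd = -P.A P.x₀ := (neg_eq_of_add_eq_zero_right S.feas_x).symm
    rw [this, norm_neg]
    refine (P.A.le_opNorm P.x₀).trans ?_
    exact pow_mul_bound hT (norm_nonneg _) (norm_A_le.trans h1) h3 le_rfl

lemma Standing.infDist_zini_le {ε : ℝ} (hε : 0 < ε) (hεT : ε * T = 1) {x : E d}
    (hx : P.NearFeasible ε x) : Metric.infDist P.zini (P.Omega x) ≤ T ^ 7 := by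
  have hT := H.two_le
  obtain ⟨zs, hzs⟩ := S.Omega_nonempty x
  have h6 : P.lg ≤ T ^ 1 := by simpa using H.lg_le
  have h1 : ‖zs‖ ≤ T ^ 6 := (norm_dual_le zs).trans (pow_add_bound hT
    ((S.norm_fst_le_of_mem (S.mem_Omega_iff.1 hzs).1).trans h6)
    ((S.norm_snd_le_of_near hε hx hzs).trans (S.snd_bound_le H hε hεT)) (by norm_num) (by norm_num))
  refine (Metric.infDist_le_dist_of_mem hzs).trans ?_
  rw [dist_eq_norm]
  exact (norm_sub_le _ _).trans (pow_add_bound hT (H.norm_zini_le) h1 (by norm_num)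
    (by norm_num))

/-- A polynomial bound for the initial dual gap. -/
lemma Standing.gap_le {ε : ℝ} (hε : 0 < ε) (hεT : ε * T = 1) {x : E d}
    (hx : P.NearFeasible ε x) (hxT : ‖x‖ ≤ T ^ 21) (hini : P.zini ∈ P.dualDom) :
    P.gap x ≤ T ^ 54 := by
  have hT := H.two_le
  have hτ := S.tau_pos
  have h1 : ‖P.M‖ ≤ T ^ 1 := by simpa using H.M_le
  have h3 : ‖P.x₀‖ ≤ T ^ 1 := by simpa using H.x₀_le
  have h4 : ‖P.y₀‖ ≤ T ^ 1 := by simpa using H.y₀_le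
  have h5 : P.lf ≤ T ^ 1 := by simpa using H.lf_le
  have h6 : P.lg ≤ T ^ 1 := by simpa using H.lg_le
  obtain ⟨zs, hzs⟩ := S.Omega_nonempty x
  have hzsd := (S.mem_Omega_iff.1 hzs).1
  have hn : ‖zs‖ ≤ T ^ 6 := (norm_dual_le zs).trans (pow_add_bound hT
    ((S.norm_fst_le_of_mem hzsd).trans h6)
    ((S.norm_snd_le_of_near hε hx hzs).trans (S.snd_bound_le H hε hεT)) (by norm_num) (by norm_num))
  have hbase : ‖P.base x‖ ≤ T ^ 24 := (S.norm_base_le x).trans (pow_add_bound hT h5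
    (pow_mul_bound hT (norm_nonneg _) H.tau_le hxT le_rfl) (by norm_num) (by norm_num))
  have hres : ∀ z : Dual nbar n, ‖z‖ ≤ T ^ 6 → ‖P.resid x z‖ ≤ T ^ 25 := by
    intro z hz
    rw [resid_eq]
    refine (norm_add_le _ _).trans (pow_add_bound hT (i := 7) ((norm_Mt_le z).trans
      (pow_mul_bound hT (norm_nonneg _) h1 hz le_rfl)) hbase (by norm_num) (by norm_num))
  have hr1 := hres P.zini (pow_mono_bound hT (H.norm_zini_le) (by norm_num))
  have hr2 := hres zs hn
  have hge := S.dualReal_ge x hzsd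
  rw [S.gap_eq hini hzs]
  have a1 : 1 / (2 * P.τ) * ‖P.resid x P.zini‖ ^ 2 ≤ T ^ 51 := by
    have e : 1 / (2 * P.τ) ≤ T ^ 1 := by
      refine le_trans ?_ (S.one_div_tau_le H)
      gcongr
      linarith
    refine pow_mul_bound hT (by positivity) e (j := 50) ?_ le_rfl
    calc ‖P.resid x P.zini‖ ^ 2 ≤ (T ^ 25) ^ 2 := by gcongr
      _ = T ^ 50 := by ring
  have a2 : -⟪P.zini, P.beta⟫_ℝ ≤ T ^ 7 := by
    refine (neg_le_abs _).trans ((abs_real_inner_le_norm _ _).trans ?_)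
    exact pow_mul_bound hT (norm_nonneg _) (H.norm_zini_le) (S.norm_beta_le H) le_rfl
  -- Neither ḡ⋆(y₀) nor ḡ(y₀) is bounded by the size alone, but their sum is: it equals this
  -- quantity plus ḡ(y₀) - ḡ(0).
  have a3 : conjReal P.gbar P.y₀ + P.gbar 0 ≤ T ^ 1 := by
    have h := H.conj_le
    rw [conj_eq_coe (g := P.gbar) (z := P.y₀) hini, ← EReal.coe_add, EReal.toReal_coe] at h
    simpa using h
  have a4 : P.gbar P.y₀ - P.gbar 0 ≤ T ^ 2 := by
    have h := (abs_le.1 (S.g_lip P.y₀ 0)).2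
    rw [sub_zero] at h
    exact h.trans (pow_mul_bound hT (norm_nonneg _) h6 h4 le_rfl)
  have a5 : -⟪P.resid x zs, P.x₀⟫_ℝ ≤ T ^ 26 := by
    refine (neg_le_abs _).trans ((abs_real_inner_le_norm _ _).trans ?_)
    exact pow_mul_bound hT (norm_nonneg _) hr2 h3 le_rfl
  have a6 : ⟪P.base x, P.x₀⟫_ℝ ≤ T ^ 25 := by
    refine (real_inner_le_norm _ _).trans ?_
    exact pow_mul_bound hT (norm_nonneg _) hbase h3 le_rfl
  have a7 : 0 ≤ 1 / (2 * P.τ) * ‖P.resid x zs‖ ^ 2 := by positivity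
  have a8 : P.dualReal x P.zini = conjReal P.gbar P.y₀ - ⟪P.zini, P.beta⟫_ℝ
      + 1 / (2 * P.τ) * ‖P.resid x P.zini‖ ^ 2 := rfl
  have a9 := pow_add_bound hT (pow_add_bound hT (pow_add_bound hT a3 a4 (k := 3) (by norm_num)
    (by norm_num)) a2 (k := 8) (by norm_num) (by norm_num)) (pow_add_bound hT (pow_add_bound hT a5 a6
    (k := 27) (by norm_num) (by norm_num)) a1 (k := 52) (by norm_num) (by norm_num)) (k := 54)
    (by norm_num) (by norm_num)
  linarith

end Standing

/-! ### Loop rules -/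

section Rules

variable (S : P.Standing)
include S

/-- The loop rules under global growth. -/
lemma Standing.crit_of_rule {x : E d} {J : E d → ℕ} {μ : E d → ℝ} {δ : ℝ} (hδ : 0 < δ)
    (hj : 1 ≤ J x) (hlen : 8 * P.LD ≤ μ x * (J x : ℝ) ^ 2) (hμ : 0 < μ x)
    (hg : ∀ G, P.GrowthOn x (μ x) G) {I : E d → ℕ} (hI : P.LoopRule μ J δ I) :
    P.Crit δ x (P.restartedAPG x (I x) (J x)) ∧ ∀ i₀ : ℕ, 1 ≤ i₀ →
      Metric.infDist P.zini (P.Omega x) ^ 2 ≤ δ ^ 2 * 2 ^ i₀ →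
      (P.zini ∈ P.dualDom → 2 * P.gap x / (μ x * δ ^ 2) ≤ 2 ^ i₀) → I x ≤ i₀ := by
  rcases hI with rfl | ⟨hini, rfl⟩
  · constructor
    -- The infimum of an empty set of naturals is 0, so some loop count meeting the criterion has to
    -- be exhibited.
    · refine Nat.sInf_mem (s := {i : ℕ | P.Crit δ x (P.restartedAPG x i (J x))}) ?_
      obtain ⟨i, hi⟩ := pow_unbounded_of_one_lt
        (Metric.infDist P.zini (P.Omega x) ^ 2 / δ ^ 2) (one_lt_two (α := ℝ))
      refine ⟨i + 1, S.crit_of_infDist_zini hj hlen hμ hg hδ (by omega) ?_⟩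
      rw [div_lt_iff₀ (by positivity)] at hi
      have : (0 : ℝ) < 2 ^ i * δ ^ 2 := by positivity
      rw [pow_succ (2 : ℝ) i]
      linarith
    · intro i₀ h1 h2 _
      exact Nat.sInf_le (S.crit_of_infDist_zini hj hlen hμ hg hδ h1 h2)
  · constructor
    · exact S.crit_of_gap hj hlen hμ hini (hg _) hδ le_two_pow_ceil_logb
    · intro i₀ _ _ h3
      have := S.gap_nonneg hini x
      exact ceil_logb_le (by positivity) (h3 hini)

/-- The loop rules under growth on the initial sublevel set. -/
lemma Standing.crit_of_rule_gap {x : E d} {J : E d → ℕ} {μ : E d → ℝ} {δ : ℝ} (hδ : 0 < δ)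
    (hj : 1 ≤ J x) (hlen : 8 * P.LD ≤ μ x * (J x : ℝ) ^ 2) (hμ : 0 < μ x)
    (hini : P.zini ∈ P.dualDom) (hg : P.GrowthOn x (μ x) (P.gap x)) {I : E d → ℕ}
    (hI : P.LoopRule μ J δ I) :
    P.Crit δ x (P.restartedAPG x (I x) (J x)) ∧ ∀ i₀ : ℕ,
      2 * P.gap x / (μ x * δ ^ 2) ≤ 2 ^ i₀ → I x ≤ i₀ := by
  rcases hI with rfl | ⟨-, rfl⟩
  · constructor
    · exact Nat.sInf_mem (s := {i : ℕ | P.Crit δ x (P.restartedAPG x i (J x))})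
        ⟨_, S.crit_of_gap hj hlen hμ hini hg hδ le_two_pow_ceil_logb⟩
    · intro i₀ h
      exact Nat.sInf_le (S.crit_of_gap hj hlen hμ hini hg hδ h)
  · constructor
    · exact S.crit_of_gap hj hlen hμ hini hg hδ le_two_pow_ceil_logb
    · intro i₀ h
      have := S.gap_nonneg hini x
      exact ceil_logb_le (by positivity) h

omit S in
lemma finds_of_DeltaF_eq_zero (S : P.Standing) (hΔ : P.DeltaF = 0) {ε : ℝ} (hε : 0 < ε)
    (I J : E d → ℕ) {δ N : ℝ} (hN : 0 ≤ N) : P.Finds I J δ ε N := by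
  refine ⟨0, fun k hk => absurd hk (Nat.not_lt_zero k), ?_, by simpa using hN⟩
  exact S.stationary_of_DeltaF_eq_zero hΔ hε

/-- From bounds for the inner loops to the total number of inner iterations. -/
lemma Standing.finds {ε : ℝ} (hε : 0 < ε) {I J : E d → ℕ}
    (hcrit : ∀ k, P.Crit (P.deltaEps ε) (P.iterate I J k).1
      (P.restartedAPG (P.iterate I J k).1 (I (P.iterate I J k).1) (J (P.iterate I J k).1)))
    {a b : ℝ} (hb0 : 0 ≤ b)
    (hI : ∀ k : ℕ, (k : ℝ) ≤ 64 * (P.Lf * P.DeltaF / ε ^ 2) + 1 → (I (P.iterate I J k).1 : ℝ) ≤ a)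
    (hJ : ∀ k : ℕ, (J (P.iterate I J k).1 : ℝ) ≤ b) (hr : 1 ≤ P.Lf * P.DeltaF / ε ^ 2) :
    P.Finds I J (P.deltaEps ε) ε (65 * (P.Lf * P.DeltaF / ε ^ 2) * (a * b)) := by
  obtain ⟨K, hK, hst⟩ := S.exists_stationary hε hcrit
  refine ⟨K, fun k _ => hcrit k, hst, ?_⟩
  have ha0 : 0 ≤ a := (Nat.cast_nonneg _).trans (hI 0 (by push_cast; linarith))
  push_cast
  calc ∑ k ∈ Finset.range K, (I (P.iterate I J k).1 : ℝ) * (J (P.iterate I J k).1 : ℝ)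
      ≤ ∑ k ∈ Finset.range K, a * b := by
        refine Finset.sum_le_sum fun k hk => ?_
        have hk' : (k : ℝ) ≤ K := by exact_mod_cast (Finset.mem_range.1 hk).le
        exact mul_le_mul (hI k (hk'.trans hK)) (hJ k) (Nat.cast_nonneg _) ha0
    _ = K * (a * b) := by rw [Finset.sum_const, Finset.card_range, nsmul_eq_mul]
    _ ≤ _ := by
        refine mul_le_mul_of_nonneg_right ?_ (mul_nonneg ha0 hb0)
        linarith

end Rules

end Data

end IPG

/-! ### Loop lengths, logarithms and the three complexity bounds. -/

namespace IPG

/-- The length of an inner loop for the ratio `L / ρ`. -/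
lemma len_spec {L ρ : ℝ} (hL : 0 < L) (hρ : 0 < ρ) :
    1 ≤ ⌈2 * Real.sqrt (2 * L / ρ)⌉₊ ∧ 8 * L ≤ ρ * (⌈2 * Real.sqrt (2 * L / ρ)⌉₊ : ℝ) ^ 2 ∧
    ∀ w : ℝ, 1 ≤ w → L / ρ ≤ w ^ 2 → (⌈2 * Real.sqrt (2 * L / ρ)⌉₊ : ℝ) ≤ 4 * w := by
  have hpos : 0 < Real.sqrt (2 * L / ρ) := Real.sqrt_pos.2 (by positivity)
  have hle := Nat.le_ceil (2 * Real.sqrt (2 * L / ρ))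
  refine ⟨Nat.one_le_ceil_iff.2 (by positivity), ?_, fun w hw h => ?_⟩
  · have h1 : (2 * Real.sqrt (2 * L / ρ)) ^ 2 ≤ (⌈2 * Real.sqrt (2 * L / ρ)⌉₊ : ℝ) ^ 2 := by
      gcongr
    rw [mul_pow, Real.sq_sqrt (by positivity)] at h1
    calc 8 * L = ρ * (2 ^ 2 * (2 * L / ρ)) := by field_simp; norm_num
      _ ≤ _ := by gcongr
  · have h1 := (Nat.ceil_lt_add_one (by positivity : 0 ≤ 2 * Real.sqrt (2 * L / ρ))).le
    -- Since √2 ≤ 3/2, twice the root is at most 3w, and w ≥ 1 absorbs the 1 of the ceiling.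
    have h2 : Real.sqrt (2 * L / ρ) ≤ 3 / 2 * w := by
      refine Real.sqrt_le_iff.2 ⟨by positivity, ?_⟩
      rw [mul_div_assoc]
      nlinarith [sq_nonneg w]
    linarith

/-- Comparison of `log (1 / ε)` and `log (q / ε)` when `ε` is small in terms of `q`. -/
lemma log_le_two_mul_log {ε V q : ℝ} (hε : 0 < ε) (hV : ε * V ^ 2 ≤ 1) (hq : 0 < q)
    (hqV : q⁻¹ ≤ V) : Real.log (1 / ε) ≤ 2 * Real.log (q / ε) := by
  have h1 : (2 : ℝ) * Real.log (q / ε) = Real.log ((q / ε) ^ 2) := by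
    rw [Real.log_pow]
    norm_num
  rw [h1]
  refine Real.log_le_log (by positivity) ?_
  have h2 : 1 ≤ q * V := by
    rw [inv_le_iff_one_le_mul₀ hq] at hqV
    linarith
  have h3 : 1 ≤ (q * V) ^ 2 := one_le_pow₀ h2
  rw [div_pow, div_le_div_iff₀ hε (by positivity), one_mul]
  -- This uses the second power of V in the hypothesis; it is equivalent to 1/ε ≤ (q/ε)².
  have h4 : ε ≤ q ^ 2 := by
    calc ε ≤ ε * (q * V) ^ 2 := le_mul_of_one_le_right hε.le h3
      _ = q ^ 2 * (ε * V ^ 2) := by ring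
      _ ≤ q ^ 2 := mul_le_of_le_one_right (sq_nonneg q) hV
  nlinarith

namespace Data

variable {d n nbar : ℕ} {P : Data d n nbar}

lemma Finds.mono {I J : E d → ℕ} {δ ε N N' : ℝ} (h : P.Finds I J δ ε N) (hN : N ≤ N') :
    P.Finds I J δ ε N' := by
  obtain ⟨K, h1, h2, h3⟩ := h
  exact ⟨K, h1, h2, h3.trans hN⟩

section Small

variable (S : P.Standing)
include S

/-- The hypothesis that `ε` is small gives the bounds by powers of `1 / ε`. -/
lemma Standing.sizeLe_of_small {ε V : ℝ} (hε : 0 < ε) (hV : ε * V ^ 2 ≤ 1) (hs : P.size ≤ V) :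
    P.SizeLe V ∧ P.SizeLe (1 / ε) ∧ V ≤ 1 / ε := by
  have H := S.sizeLe_size.mono hs
  have h1 : V ≤ 1 / ε := by
    rw [le_div_iff₀ hε]
    have := H.two_le
    nlinarith
  exact ⟨H, H.mono h1, h1⟩

lemma Standing.DeltaF_pos (hΔ : P.DeltaF ≠ 0) : 0 < P.DeltaF :=
  lt_of_le_of_ne S.DeltaF_nonneg hΔ.symm

lemma Standing.one_le_outer (hΔ : P.DeltaF ≠ 0) {ε V : ℝ} (hε : 0 < ε) (hV : ε * V ^ 2 ≤ 1)
    (hs : P.size ≤ V) : 1 ≤ P.Lf * P.DeltaF / ε ^ 2 := by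
  obtain ⟨H, -, -⟩ := S.sizeLe_of_small hε hV hs
  have hL := S.Lf_pos
  have hD := S.DeltaF_pos hΔ
  have h1 : 1 ≤ P.Lf * V := by
    have := H.Lf_inv_le
    rwa [inv_le_iff_one_le_mul₀ hL, mul_comm] at this
  have h2 : 1 ≤ P.DeltaF * V := by
    have := H.DeltaF_inv_le
    rwa [inv_le_iff_one_le_mul₀ hD, mul_comm] at this
  have h3 : 1 ≤ P.Lf * V * (P.DeltaF * V) := one_le_mul_of_one_le_of_one_le h1 h2
  have hT := H.two_le
  have hε1 : ε ≤ 1 := by nlinarith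
  rw [le_div_iff₀ (by positivity), one_mul]
  calc ε ^ 2 ≤ ε := by nlinarith
    _ ≤ ε * (P.Lf * V * (P.DeltaF * V)) := le_mul_of_one_le_right hε.le h3
    _ = P.Lf * P.DeltaF * (ε * V ^ 2) := by ring
    _ ≤ P.Lf * P.DeltaF := mul_le_of_le_one_right (by positivity) hV

/-- At most (1/ε)¹¹ outer steps, each of length at most (1/ε)⁹, starting from x₀. -/
lemma Standing.norm_iterate_le_pow {ε : ℝ} (hε : 0 < ε) (H : P.SizeLe (1 / ε)) {I J : E d → ℕ}
    (hcrit : ∀ k, P.Crit (P.deltaEps ε) (P.iterate I J k).1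
      (P.restartedAPG (P.iterate I J k).1 (I (P.iterate I J k).1) (J (P.iterate I J k).1)))
    {k : ℕ} (hk : (k : ℝ) ≤ 64 * (P.Lf * P.DeltaF / ε ^ 2) + 1) :
    ‖(P.iterate I J k).1‖ ≤ (1 / ε) ^ 21 := by
  have hT := H.two_le
  have hεT : ε * (1 / ε) = 1 := mul_one_div_cancel hε.ne'
  have h1 : P.Lf ≤ (1 / ε) ^ 1 := by simpa using H.Lf_le
  have h2 : P.DeltaF ≤ (1 / ε) ^ 1 := by simpa using H.DeltaF_le
  have h3 : ‖P.x₀‖ ≤ (1 / ε) ^ 1 := by simpa using H.x₀_le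
  have h64 : (64 : ℝ) ≤ (1 / ε) ^ 6 := by
    calc (64 : ℝ) = 2 ^ 6 := by norm_num
      _ ≤ (1 / ε) ^ 6 := by gcongr
  have hD := S.DeltaF_nonneg
  have hL := S.Lf_pos
  have h4 : P.Lf * P.DeltaF / ε ^ 2 ≤ (1 / ε) ^ 4 := by
    have e : P.Lf * P.DeltaF / ε ^ 2 = P.Lf * P.DeltaF * (1 / ε) ^ 2 := by
      rw [one_div, inv_pow, div_eq_mul_inv]
    rw [e]
    exact pow_mul_bound hT (by positivity) (pow_mul_bound hT hD h1 h2 le_rfl) le_rfl (by norm_num)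
  have h5 : (k : ℝ) ≤ (1 / ε) ^ 11 := hk.trans (pow_add_bound hT (pow_mul_bound hT (by positivity)
    h64 h4 le_rfl) (j := 0) (by simp) (by norm_num) (by norm_num))
  have h6 : 0 ≤ P.stepBound ε := (norm_nonneg _).trans
    (S.norm_step_le hε (S.nearFeasible_iterate hε hcrit 0) (hcrit 0))
  exact (S.norm_iterate_le hε hcrit k).trans (pow_add_bound hT h3 (pow_mul_bound hT h6 h5
    (S.stepBound_le H hε hεT) le_rfl) (by norm_num) (by norm_num))

/-- A growth modulus bounded below turns the initial gap into a number of loops. -/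
lemma Standing.gap_ratio_le (hΔ : P.DeltaF ≠ 0) {ε : ℝ} (hε : 0 < ε) (H : P.SizeLe (1 / ε))
    {G ρ : ℝ} {i j k : ℕ} (hG : G ≤ (1 / ε) ^ i) (hρ : 0 < ρ)
    (hρT : 1 / ρ ≤ (1 / ε) ^ j) (hk : i + j + 53 ≤ k) :
    2 * G / (ρ * P.deltaEps ε ^ 2) ≤ 2 ^ ⌈Real.logb 2 ((1 / ε) ^ k)⌉₊ := by
  refine le_trans ?_ le_two_pow_ceil_logb
  have hT := H.two_le
  have hδ := S.deltaEps_pos hε hΔ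
  have h1 := S.deltaEps_ge H hΔ (mul_one_div_cancel hε.ne')
  have h2 : 1 / P.deltaEps ε ^ 2 ≤ (1 / ε) ^ 52 := by
    rw [div_le_iff₀ (by positivity)]
    calc (1 : ℝ) ≤ (P.deltaEps ε * (1 / ε) ^ 26) ^ 2 := one_le_pow₀ h1
      _ = (1 / ε) ^ 52 * P.deltaEps ε ^ 2 := by ring
  have h3 : (2 : ℝ) ≤ (1 / ε) ^ 1 := by simpa using hT
  have e : 2 * G / (ρ * P.deltaEps ε ^ 2) = (G * 2) * ((1 / ρ) * (1 / P.deltaEps ε ^ 2)) := by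
    field_simp
  rw [e]
  exact pow_mul_bound hT (by positivity) (pow_mul_bound hT two_pos.le hG h3 le_rfl)
    (pow_mul_bound hT (by positivity) hρT h2 le_rfl) (by omega)

/-- Total complexity when the dual objective has global quadratic growth. -/
lemma Standing.finds_global (hΔ : P.DeltaF ≠ 0) {ε V : ℝ} (hε : 0 < ε) (hV : ε * V ^ 2 ≤ 1)
    (hs : P.size ≤ V) {μ : E d → ℝ} {J : E d → ℕ} {w : ℝ} (hw : 0 ≤ w)
    (hj : ∀ x, 1 ≤ J x) (hlen : ∀ x, 8 * P.LD ≤ μ x * (J x : ℝ) ^ 2) (hμ : ∀ x, 0 < μ x)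
    (hg : ∀ x G, P.GrowthOn x (μ x) G) (hμT : ∀ x, 1 / μ x ≤ (1 / ε) ^ 4)
    (hJ : ∀ x, (J x : ℝ) ≤ 4 * w) {I : E d → ℕ} (hI : P.LoopRule μ J (P.deltaEps ε) I) :
    P.Finds I J (P.deltaEps ε) ε
      (116480 * (w * Real.log (P.DeltaF / ε) * (P.Lf * P.DeltaF / ε ^ 2))) := by
  obtain ⟨HV, H, -⟩ := S.sizeLe_of_small hε hV hs
  have hT := H.two_le
  have hεT : ε * (1 / ε) = 1 := mul_one_div_cancel hε.ne'
  have hδ := S.deltaEps_pos hε hΔ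
  have hr := S.one_le_outer hΔ hε hV hs
  have hrule : ∀ x, _ := fun x => S.crit_of_rule hδ (hj x) (hlen x) (hμ x) (hg x) hI
  have hcrit : ∀ k, P.Crit (P.deltaEps ε) (P.iterate I J k).1
      (P.restartedAPG (P.iterate I J k).1 (I (P.iterate I J k).1) (J (P.iterate I J k).1)) :=
    fun k => (hrule _).1
  have hloops : ∀ k : ℕ, (k : ℝ) ≤ 64 * (P.Lf * P.DeltaF / ε ^ 2) + 1 →
      (I (P.iterate I J k).1 : ℝ) ≤ 224 * Real.log (1 / ε) := by
    intro k hk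
    have hx := S.norm_iterate_le_pow hε H hcrit hk
    have hnear := S.nearFeasible_iterate hε hcrit k
    set x := (P.iterate I J k).1
    -- 111 = 54 + 4 + 53: the exponents of the initial gap, of 1/μ, and of 2/δ². The distance
    -- criterion needs only 14 + 52.
    have h1 : I x ≤ ⌈Real.logb 2 ((1 / ε) ^ 111)⌉₊ := by
      refine (hrule x).2 _ ?_ ?_ ?_
      · rw [Nat.one_le_ceil_iff]
        exact Real.logb_pos one_lt_two (one_lt_pow₀ (by linarith) (by norm_num))
      · have h2 := S.infDist_zini_le H hε hεT hnear
        have h3 := S.deltaEps_ge H hΔ hεT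
        have h4 : (1 : ℝ) ≤ (P.deltaEps ε * (1 / ε) ^ 26) ^ 2 := one_le_pow₀ h3
        calc Metric.infDist P.zini (P.Omega x) ^ 2 ≤ ((1 / ε) ^ 7) ^ 2 := by
              have := Metric.infDist_nonneg (x := P.zini) (s := P.Omega x)
              gcongr
          _ = (1 / ε) ^ 14 * 1 := by ring
          _ ≤ (1 / ε) ^ 59 * (P.deltaEps ε * (1 / ε) ^ 26) ^ 2 := by
              gcongr
              · linarith
              · norm_num
          _ = P.deltaEps ε ^ 2 * (1 / ε) ^ 111 := by ring
          _ ≤ _ := by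
              gcongr
              exact le_two_pow_ceil_logb
      · intro hini
        exact S.gap_ratio_le hΔ hε H (S.gap_le H hε hεT hnear hx hini) (hμ x) (hμT x) (by norm_num)
    calc (I x : ℝ) ≤ (⌈Real.logb 2 ((1 / ε) ^ 111)⌉₊ : ℝ) := by exact_mod_cast h1
      _ ≤ 2 * ((111 : ℕ) + 1) * Real.log (1 / ε) := ceil_logb_pow_le hT 111
      _ = 224 * Real.log (1 / ε) := by norm_num
  refine (S.finds hε hcrit (by positivity) hloops (fun k => hJ _) hr).mono ?_
  have hlog := log_le_two_mul_log hε hV (S.DeltaF_pos hΔ) HV.DeltaF_inv_le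
  calc 65 * (P.Lf * P.DeltaF / ε ^ 2) * (224 * Real.log (1 / ε) * (4 * w))
      ≤ 65 * (P.Lf * P.DeltaF / ε ^ 2) * (224 * (2 * Real.log (P.DeltaF / ε)) * (4 * w)) := by
        gcongr
    _ = _ := by ring

omit S in
lemma lenStrong_eq (S : P.Standing) (h : Function.Surjective P.M) (x : E d) :
    P.lenStrong x = ⌈2 * Real.sqrt (2 * P.LD / P.muD)⌉₊ := by
  have hτ := S.tau_pos
  have h1 := (S.lamMin_spec h).1
  have h2 : 2 * P.LD / P.muD = 2 * (lamMax P.gram / lamMin P.gram) := by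
    rw [LD, muD]
    field_simp
  rw [h2, Real.sqrt_mul two_pos.le, lenStrong, kappa, mul_assoc]

/-- Complexity under full row rank of `[Ā; A]`. -/
theorem Standing.finds_strong (hM : Function.Surjective P.M) {ε : ℝ} (hε : 0 < ε)
    (hsmall : ε * (P.size + (lamMin P.gram)⁻¹) ^ 2 ≤ 1) {I : E d → ℕ}
    (hI : P.LoopRule (fun _ => P.muD) P.lenStrong (P.deltaEps ε) I) :
    P.Finds I P.lenStrong (P.deltaEps ε) ε
      (116480 * (P.kappa * Real.log (P.DeltaF / ε) * (P.Lf * P.DeltaF / ε ^ 2))) := by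
  by_cases hΔ : P.DeltaF = 0
  · exact finds_of_DeltaF_eq_zero S hΔ hε _ _ (by simp [hΔ])
  obtain ⟨h1, h2, -⟩ := S.lamMin_spec hM
  have hτ := S.tau_pos
  have hinv := inv_pos.2 h1
  have hs : P.size ≤ P.size + (lamMin P.gram)⁻¹ := by linarith
  obtain ⟨-, H, hVT⟩ := S.sizeLe_of_small hε hsmall hs
  have hsz := S.sizeLe_size.two_le
  have hμ : 0 < P.muD := div_pos h1 hτ
  have hlen := len_spec S.LD_pos hμ
  have hratio : P.LD / P.muD = lamMax P.gram / lamMin P.gram := by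
    rw [LD, muD]
    field_simp
  have hk2 : P.kappa ^ 2 = lamMax P.gram / lamMin P.gram :=
    Real.sq_sqrt (div_nonneg (h1.le.trans h2) h1.le)
  have hk1 : 1 ≤ P.kappa := by
    rw [kappa, Real.one_le_sqrt, one_le_div h1]
    exact h2
  refine S.finds_global hΔ hε hsmall hs (by linarith) (fun x => ?_) (fun x => ?_) (fun _ => hμ)
    (fun x G => S.growth_strong hM x G) (fun _ => ?_) (fun x => ?_) hI
  · rw [lenStrong_eq S hM]
    exact hlen.1
  · rw [lenStrong_eq S hM]
    exact hlen.2.1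
  · have e : 1 / P.muD = P.τ * (lamMin P.gram)⁻¹ := by
      rw [muD]
      field_simp
    rw [e]
    have h3 : (lamMin P.gram)⁻¹ ≤ (1 / ε) ^ 1 := by
      rw [pow_one]
      linarith
    exact pow_mul_bound H.two_le hinv.le H.tau_le h3 (by norm_num)
  · rw [lenStrong_eq S hM]
    exact hlen.2.2 P.kappa hk1 (by rw [hratio, hk2])

section Polyhedral

variable {m : ℕ} {C : E nbar →L[ℝ] E m} {c : E m} (hC : P.Polyhedral C c)
include hC

/-- Complexity for polyhedral `ḡ` and homogeneous constraints. -/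
theorem Standing.finds_hom (hbbar : P.bbar = 0) (hb : P.b = 0) {ε : ℝ} (hε : 0 < ε)
    (hsmall : ε * (P.size + P.thetaHom C) ^ 2 ≤ 1) {I : E d → ℕ}
    (hI : P.LoopRule (P.rho C) (P.lenPoly C) (P.deltaEps ε) I) :
    P.Finds I (P.lenPoly C) (P.deltaEps ε) ε
      (116480 * (Real.sqrt (lamMax P.gram * P.thetaHom C ^ 2)
        * Real.log (P.DeltaF / ε) * (P.Lf * P.DeltaF / ε ^ 2))) := by
  by_cases hΔ : P.DeltaF = 0
  · exact finds_of_DeltaF_eq_zero S hΔ hε _ _ (by simp [hΔ])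
  have hθ := S.thetaHom_pos (C := C)
  have hτ := S.tau_pos
  have hβ : P.beta = 0 := by
    rw [beta, hbbar, hb]
    rfl
  have hs : P.size ≤ P.size + P.thetaHom C := by linarith
  obtain ⟨-, H, hVT⟩ := S.sizeLe_of_small hε hsmall hs
  have hsz := S.sizeLe_size.two_le
  have hrho : ∀ x, P.rho C x = 1 / (P.thetaHom C ^ 2 * P.τ) := fun x => by
    rw [rho, if_pos ⟨hbbar, hb⟩]
  have hρ : ∀ x, 0 < P.rho C x := fun x => by
    rw [hrho]
    positivity
  have hsq : Real.sqrt (lamMax P.gram * P.thetaHom C ^ 2) = P.thetaHom C * ‖P.M‖ := by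
    rw [S.lamMax_eq, ← mul_pow, Real.sqrt_sq (by positivity), mul_comm]
  have hw := S.one_le_thetaHom_mul (C := C)
  -- The square root is θ₀‖M‖ ≥ 1, so this factor absorbs the ceiling and no maximum with 1 is
  -- needed, unlike in (c).
  rw [hsq]
  refine S.finds_global hΔ hε hsmall hs (by linarith) (fun x => (len_spec S.LD_pos (hρ x)).1)
    (fun x => (len_spec S.LD_pos (hρ x)).2.1) hρ (fun x G => ?_) (fun x => ?_)
    (fun x => (len_spec S.LD_pos (hρ x)).2.2 _ hw (le_of_eq ?_)) hI
  · rw [hrho]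
    exact S.growth_hom hC hβ x G
  · rw [hrho, one_div_one_div]
    have h3 : P.thetaHom C ≤ 1 / ε := by linarith
    exact pow_mul_bound H.two_le hτ.le (i := 2) (by gcongr) H.tau_le (by norm_num)
  · rw [hrho, LD, S.lamMax_eq]
    field_simp

omit hC in
lemma Standing.gap_le_of_dualBounds {B₅ B₆ : ℝ} {x : E d} (h : P.DualBounds B₅ B₆ x) :
    P.zini ∈ P.dualDom ∧ P.gap x ≤ B₆ := by
  obtain ⟨zs, hzs⟩ := S.Omega_nonempty x
  have h2 := h.2
  rw [S.dualOpt_eq hzs, ← EReal.coe_add] at h2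
  have hini : P.zini ∈ P.dualDom := by
    by_contra hcon
    rw [dualObj_eq_top hcon, top_le_iff] at h2
    exact EReal.coe_ne_top _ h2
  rw [dualObj_eq hini, EReal.coe_le_coe_iff] at h2
  refine ⟨hini, ?_⟩
  rw [S.gap_eq hini hzs]
  linarith

/-- The growth modulus in the polyhedral case. -/
lemma Standing.rho_spec {B₅ B₆ : ℝ} {x : E d} (h : P.DualBounds B₅ B₆ x) :
    0 < P.rho C x ∧ P.GrowthOn x (P.rho C x) (P.gap x) ∧
      1 / P.rho C x ≤ P.thetaFull C ^ 2 * (P.τ + B₆ + 2 * B₅ / P.τ) := by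
  obtain ⟨hini, hgap⟩ := S.gap_le_of_dualBounds h
  have hg0 := S.gap_nonneg hini x
  have hτ := S.tau_pos
  have hB₅ : 0 ≤ B₅ := (sq_nonneg _).trans h.1
  have hB₆ : 0 ≤ B₆ := hg0.trans hgap
  by_cases hb : P.bbar = 0 ∧ P.b = 0
  · have hθ := S.thetaHom_pos (C := C)
    have hβ : P.beta = 0 := by
      rw [beta, hb.1, hb.2]
      rfl
    rw [rho, if_pos hb]
    refine ⟨by positivity, S.growth_hom hC hβ x _, ?_⟩
    rw [one_div_one_div]
    have h1 := thetaHom_le_thetaFull (C := C) hβ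
    have h2 : 0 ≤ 2 * B₅ / P.τ := by positivity
    gcongr
    linarith
  · have hθ := S.thetaFull_pos (C := C)
    rw [rho, if_neg hb]
    refine ⟨by positivity, S.growth_full hC x hg0, ?_⟩
    rw [one_div_one_div]
    have := h.1
    gcongr

/-- Complexity for polyhedral `ḡ` in terms of bounds along the run. -/
theorem Standing.finds_full {B₅ B₆ ε : ℝ} (hε : 0 < ε)
    (hsmall : ε * (P.size + P.thetaFull C + B₅ + B₆ + B₆⁻¹) ^ 2 ≤ 1) {I : E d → ℕ}
    (hI : P.LoopRule (P.rho C) (P.lenPoly C) (P.deltaEps ε) I)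
    (hB : ∀ k, P.DualBounds B₅ B₆ (P.iterate I (P.lenPoly C) k).1) :
    P.Finds I (P.lenPoly C) (P.deltaEps ε) ε
      (116480 * (max 1 (Real.sqrt (lamMax P.gram * P.thetaFull C ^ 2
          * (1 + B₆ / P.τ + 2 * B₅ / P.τ ^ 2)))
        * Real.log (B₆ / ε) * (P.Lf * P.DeltaF / ε ^ 2))) := by
  by_cases hΔ : P.DeltaF = 0
  · exact finds_of_DeltaF_eq_zero S hΔ hε _ _ (by simp [hΔ])
  have hB₅ : 0 ≤ B₅ := (sq_nonneg _).trans (hB 0).1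
  have hB₆ : 0 ≤ B₆ := by
    obtain ⟨hini, hgap⟩ := S.gap_le_of_dualBounds (hB 0)
    exact (S.gap_nonneg hini _).trans hgap
  have hB₆i := inv_nonneg.2 hB₆
  have hθ := S.thetaFull_pos (C := C)
  have hτ := S.tau_pos
  have hδ := S.deltaEps_pos hε hΔ
  have hs : P.size ≤ P.size + P.thetaFull C + B₅ + B₆ + B₆⁻¹ := by linarith
  obtain ⟨-, H, hVT⟩ := S.sizeLe_of_small hε hsmall hs
  have hT := H.two_le
  have hsz := S.sizeLe_size.two_le
  have hr := S.one_le_outer hΔ hε hsmall hs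
  set J := P.lenPoly C with hJdef
  have hrule : ∀ k, _ := fun k => S.crit_of_rule_gap hδ
    (len_spec S.LD_pos (S.rho_spec hC (hB k)).1).1 (len_spec S.LD_pos (S.rho_spec hC (hB k)).1).2.1
    (S.rho_spec hC (hB k)).1 (S.gap_le_of_dualBounds (hB k)).1 (S.rho_spec hC (hB k)).2.1 hI
  have hcrit : ∀ k, P.Crit (P.deltaEps ε) (P.iterate I J k).1
      (P.restartedAPG (P.iterate I J k).1 (I (P.iterate I J k).1) (J (P.iterate I J k).1)) :=
    fun k => (hrule k).1
  set W := max 1 (Real.sqrt (lamMax P.gram * P.thetaFull C ^ 2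
    * (1 + B₆ / P.τ + 2 * B₅ / P.τ ^ 2))) with hW
  have hW1 : 1 ≤ W := le_max_left _ _
  have hlM : 0 ≤ lamMax P.gram := by
    rw [S.lamMax_eq]
    positivity
  have hJ : ∀ k, (J (P.iterate I J k).1 : ℝ) ≤ 4 * W := by
    intro k
    obtain ⟨h1, -, h3⟩ := S.rho_spec hC (hB k)
    refine (len_spec S.LD_pos h1).2.2 W hW1 ?_
    have h4 : P.LD / P.rho C (P.iterate I J k).1
        ≤ lamMax P.gram * P.thetaFull C ^ 2 * (1 + B₆ / P.τ + 2 * B₅ / P.τ ^ 2) := by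
      calc P.LD / P.rho C (P.iterate I J k).1
          = lamMax P.gram / P.τ * (1 / P.rho C (P.iterate I J k).1) := by
            rw [LD, mul_one_div]
        _ ≤ lamMax P.gram / P.τ * (P.thetaFull C ^ 2 * (P.τ + B₆ + 2 * B₅ / P.τ)) := by gcongr
        _ = _ := by field_simp
    refine h4.trans ?_
    calc _ = Real.sqrt (lamMax P.gram * P.thetaFull C ^ 2
          * (1 + B₆ / P.τ + 2 * B₅ / P.τ ^ 2)) ^ 2 := (Real.sq_sqrt (by positivity)).symm
      _ ≤ W ^ 2 := by
        gcongr
        exact le_max_right _ _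
  -- If B₆ = 0, the initial dual point is already optimal at every outer step: no loop runs, and the
  -- bound is 0 as `Real.log 0 = 0`.
  rcases hB₆.eq_or_lt with h0 | h0
  · have hloops : ∀ k, (I (P.iterate I J k).1 : ℝ) ≤ 0 := by
      intro k
      obtain ⟨hini, hgap⟩ := S.gap_le_of_dualBounds (hB k)
      have hg : P.gap (P.iterate I J k).1 = 0 :=
        le_antisymm (hgap.trans_eq h0.symm) (S.gap_nonneg hini _)
      have := (hrule k).2 0 (by rw [hg]; simp)
      exact_mod_cast this
    refine (S.finds hε hcrit (by positivity) (fun k _ => hloops k) hJ hr).mono (le_of_eq ?_)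
    rw [← h0]
    simp
  · have hloops : ∀ k, (I (P.iterate I J k).1 : ℝ) ≤ 224 * Real.log (1 / ε) := by
      intro k
      obtain ⟨hini, hgap⟩ := S.gap_le_of_dualBounds (hB k)
      obtain ⟨h1, -, h3⟩ := S.rho_spec hC (hB k)
      have hB₆T : B₆ ≤ (1 / ε) ^ 1 := by
        rw [pow_one]
        linarith
      have hB₅T : B₅ ≤ (1 / ε) ^ 1 := by
        rw [pow_one]
        linarith
      have hθT : P.thetaFull C ≤ 1 / ε := by linarith
      have hρT : 1 / P.rho C (P.iterate I J k).1 ≤ (1 / ε) ^ 7 := by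
        refine h3.trans (pow_mul_bound hT (by positivity) (i := 2) (j := 5) (by gcongr) ?_ le_rfl)
        refine pow_add_bound hT (pow_add_bound hT H.tau_le hB₆T (k := 3) (by norm_num)
          (by norm_num)) (j := 3) ?_ (by norm_num) (by norm_num)
        have e : 2 * B₅ / P.τ = 2 * B₅ * (1 / P.τ) := by rw [mul_one_div]
        rw [e]
        exact pow_mul_bound hT (by positivity) (pow_mul_bound hT hB₅ (i := 1) (by simpa using hT)
          hB₅T le_rfl) (S.one_div_tau_le H) le_rfl
      have h4 := (hrule k).2 ⌈Real.logb 2 ((1 / ε) ^ 111)⌉₊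
        (S.gap_ratio_le hΔ hε H (hgap.trans hB₆T) h1 hρT (by norm_num))
      calc (I (P.iterate I J k).1 : ℝ) ≤ (⌈Real.logb 2 ((1 / ε) ^ 111)⌉₊ : ℝ) := by
            exact_mod_cast h4
        _ ≤ 2 * ((111 : ℕ) + 1) * Real.log (1 / ε) := ceil_logb_pow_le hT 111
        _ = 224 * Real.log (1 / ε) := by norm_num
    refine (S.finds hε hcrit (by positivity) (fun k _ => hloops k) hJ hr).mono ?_
    have hlog := log_le_two_mul_log hε hsmall h0 (by linarith)
    calc 65 * (P.Lf * P.DeltaF / ε ^ 2) * (224 * Real.log (1 / ε) * (4 * W))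
        ≤ 65 * (P.Lf * P.DeltaF / ε ^ 2) * (224 * (2 * Real.log (B₆ / ε)) * (4 * W)) := by
          gcongr
      _ = _ := by ring

end Polyhedral

/-- The dual quantities are bounded on bounded sets when `ḡ⋆(y₀)` is finite. -/
theorem Standing.exists_dualBounds (hini : conj P.gbar P.y₀ ≠ ⊤) (R : ℝ) :
    ∃ B₅ B₆ : ℝ, ∀ x : E d, ‖x‖ ≤ R → P.DualBounds B₅ B₆ x := by
  have hτ := S.tau_pos
  have hlf := S.lf_nonneg
  have hlg := S.lg_nonneg
  -- The multiplier bound is taken with x₀ as the feasible reference point, so that neither ε nor δ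
  -- enters.
  set N := P.lg + (P.B₂ + P.τ * (‖P.AAtInvA‖ * (‖P.x₀‖ + R))) with hN
  set b := P.lf + P.τ * R with hb
  set r := ‖P.M‖ * N + b with hr
  refine ⟨r ^ 2, conjReal P.gbar P.y₀ + ‖P.zini‖ * ‖P.beta‖
    + 1 / (2 * P.τ) * (‖P.M‖ * ‖P.zini‖ + b) ^ 2 + r * ‖P.x₀‖ + b * ‖P.x₀‖ + P.gbar P.y₀,
    fun x hx => ?_⟩
  obtain ⟨zs, hzs⟩ := S.Omega_nonempty x
  have hzsd := (S.mem_Omega_iff.1 hzs).1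
  have hn : ‖zs‖ ≤ N := by
    refine (norm_dual_le zs).trans (add_le_add (S.norm_fst_le_of_mem hzsd)
      ((S.norm_snd_le_of_mem_Omega hzs S.feas_x).trans ?_))
    gcongr
    refine (P.AAtInvA.le_opNorm _).trans ?_
    gcongr
    refine (norm_sub_le _ _).trans ?_
    gcongr
  have hbase : ‖P.base x‖ ≤ b := (S.norm_base_le x).trans (by rw [hb]; gcongr)
  have hres : ∀ z : Dual nbar n, ‖P.resid x z‖ ≤ ‖P.M‖ * ‖z‖ + b := by
    intro z
    rw [resid_eq]
    exact (norm_add_le _ _).trans (add_le_add (norm_Mt_le z) hbase)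
  have hrs : ‖P.resid x zs‖ ≤ r := (hres zs).trans (by rw [hr]; gcongr)
  refine ⟨?_, ?_⟩
  · rw [S.nu_eq hzs]
    gcongr
  · rw [S.dualOpt_eq hzs, dualObj_eq (P := P) (z := P.zini) hini, ← EReal.coe_add,
      EReal.coe_le_coe_iff]
    have hge := S.dualReal_ge x hzsd
    have a1 : 1 / (2 * P.τ) * ‖P.resid x P.zini‖ ^ 2
        ≤ 1 / (2 * P.τ) * (‖P.M‖ * ‖P.zini‖ + b) ^ 2 := by
      gcongr
      exact hres _
    have a2 : -⟪P.zini, P.beta⟫_ℝ ≤ ‖P.zini‖ * ‖P.beta‖ :=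
      (neg_le_abs _).trans (abs_real_inner_le_norm _ _)
    have a3 : -⟪P.resid x zs, P.x₀⟫_ℝ ≤ r * ‖P.x₀‖ := by
      refine (neg_le_abs _).trans ((abs_real_inner_le_norm _ _).trans ?_)
      gcongr
    have a4 : ⟪P.base x, P.x₀⟫_ℝ ≤ b * ‖P.x₀‖ := by
      refine (real_inner_le_norm _ _).trans ?_
      gcongr
    have a5 : 0 ≤ 1 / (2 * P.τ) * ‖P.resid x zs‖ ^ 2 := by positivity
    have a6 : P.dualReal x P.zini = conjReal P.gbar P.y₀ - ⟪P.zini, P.beta⟫_ℝ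
      + 1 / (2 * P.τ) * ‖P.resid x P.zini‖ ^ 2 := rfl
    linarith

end Small

end Data

end IPG

end

theorem mainTheorem4 :
    ∃ (C₀ : ℝ) (p : ℕ), 0 < C₀ ∧ ∀ (d n nbar : ℕ) (P : IPG.Data d n nbar), P.Standing →
      -- (a) `[Ā; A]` has full row rank
      (Function.Surjective P.M →
        ∀ ε : ℝ, 0 < ε → ε * (P.size + (IPG.lamMin P.gram)⁻¹) ^ p ≤ 1 →
        ∀ I : IPG.E d → ℕ,
          P.LoopRule (fun _ => P.muD) P.lenStrong (P.deltaEps ε) I →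
          P.Finds I P.lenStrong (P.deltaEps ε) ε
            (C₀ * (P.kappa * Real.log (P.DeltaF / ε) * (P.Lf * P.DeltaF / ε ^ 2)))) ∧
      -- (b) `ḡ` is polyhedral, `b̄ = 0` and `b = 0`
      (∀ (m : ℕ) (C : IPG.E nbar →L[ℝ] IPG.E m) (c : IPG.E m), P.Polyhedral C c →
        P.bbar = 0 → P.b = 0 →
        ∀ ε : ℝ, 0 < ε → ε * (P.size + P.thetaHom C) ^ p ≤ 1 →
        ∀ I : IPG.E d → ℕ,
          P.LoopRule (P.rho C) (P.lenPoly C) (P.deltaEps ε) I →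
          P.Finds I (P.lenPoly C) (P.deltaEps ε) ε
            (C₀ * (Real.sqrt (IPG.lamMax P.gram * P.thetaHom C ^ 2)
              * Real.log (P.DeltaF / ε) * (P.Lf * P.DeltaF / ε ^ 2)))) ∧
      -- (c) `ḡ` is polyhedral and the iterates are bounded, which provides `B₅` and `B₆`
      (∀ (m : ℕ) (C : IPG.E nbar →L[ℝ] IPG.E m) (c : IPG.E m), P.Polyhedral C c →
        (IPG.conj P.gbar P.y₀ ≠ ⊤ →
          ∀ R : ℝ, ∃ B₅ B₆ : ℝ, ∀ x : IPG.E d, ‖x‖ ≤ R → P.DualBounds B₅ B₆ x) ∧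
        ∀ B₅ B₆ : ℝ,
        ∀ ε : ℝ, 0 < ε → ε * (P.size + P.thetaFull C + B₅ + B₆ + B₆⁻¹) ^ p ≤ 1 →
        ∀ I : IPG.E d → ℕ,
          P.LoopRule (P.rho C) (P.lenPoly C) (P.deltaEps ε) I →
          (∀ k, P.DualBounds B₅ B₆ (P.iterate I (P.lenPoly C) k).1) →
          P.Finds I (P.lenPoly C) (P.deltaEps ε) ε
            (C₀ * (max 1 (Real.sqrt (IPG.lamMax P.gram * P.thetaFull C ^ 2
                * (1 + B₆ / P.τ + 2 * B₅ / P.τ ^ 2)))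
              * Real.log (B₆ / ε) * (P.Lf * P.DeltaF / ε ^ 2)))) := by
  -- 116480 = 65 · 224 · 2 · 4: outer steps, loops in units of log(1/ε), the comparison of
  -- logarithms, and the loop length.
  refine ⟨116480, 2, by norm_num, fun d n nbar P S => ⟨?_, ?_, ?_⟩⟩
  · intro hM ε hε hsmall I hI
    exact S.finds_strong hM hε hsmall hI
  · intro m C c hC hbbar hb ε hε hsmall I hI
    exact S.finds_hom hC hbbar hb hε hsmall hI
  · intro m C c hC
    refine ⟨fun hini R => S.exists_dualBounds hini R, ?_⟩
    intro B₅ B₆ ε hε hsmall I hI hB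
    exact S.finds_full hC hε hsmall hI hB
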